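/- Let $\mathbb G$ be a Carnot group of step $r$: a simply connected Lie group whose Lie algebra is a direct sum $\mathfrak g=V_1\oplus\dots\oplus V_r$ with $[V_1,V_i]=V_{i+1}$ for $1\le i<r$ and $[V_1,V_r]=\{0\}$. Fix an inner product on $\mathfrak g$ for which the layers $V_i$ are mutually orthogonal, let $\mathbb G$ carry the corresponding left-invariant Riemannian metric, and let $dg$ be the Haar measure on $\mathbb G$ which is the image of Lebesgue measure on $\mathfrak g$ under $\exp$. Let $X_1,\dots,X_m$ be the left-invariant vector fields given by an orthonormal basis of $V_1$. Write $\nabla^H u=\sum_i (X_iu)X_i$, $\Delta_H u=\sum_i X_i^2u$, and let $\nabla^2_Hu$ be the symmetrized horizontal Hessian, with entries $\frac12(X_iX_ju+X_jX_iu)$ and Hilbert–Schmidt norm $\|\nabla_H^2u\|$. Let $\Omega\subset\mathbb G$ be a bounded open set of class $C^2$, with Riemannian outer unit normal $\nu$ and Riemannian surface measure $\sigma$ on $\partial\Omega$. Put $N^H=\sum_{j}\langle\nu,X_j\rangle X_j$, $W=|N^H|$, $\Sigma=\{g\in\partial\Omega: W(g)=0\}$, $\nu^H=N^H/W$ on $\partial\Omega\setminus\Sigma$,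 and let $d\sigma_H=W\,d\sigma$ be the $H$-perimeter measure. The horizontal mean curvature of $\partial\Omega$ at a point of $\partial\Omega\setminus\Sigma$ is $$\mathcal H=-\sum_{i=1}^{m-1}\langle\nabla^H_{\mathbf e_i}\mathbf e_i,\nu^H\rangle,$$ where $\mathbf e_1,\dots,\mathbf e_{m-1}$ is a local $C^1$ orthonormal frame of the horizontal tangent bundle $T\partial\Omega\cap H\mathbb G$, and $\nabla^H$ is the horizontal part of the Levi-Civita connection (so that round balls in $\mathbb R^n$ have positive curvature); at a point of $\Sigma$, which is a $\sigma_H$-null set, $\mathcal H$ is the limit of its values on $\partial\Omega\setminus\Sigma$, if that limit exists and is finite. (a) Let $u\in\Gamma^3(\overline\Omega)\cap C^2(\overline\Omega)$ (where $u\in\Gamma^3(\overline\Omega)$ means that $u$ is continuous on $\overline\Omega$ and that all derivatives $X_{j_1}\cdots X_{j_s}u$, $s\le3$, exist in $\Omega$ and extend continuously to $\overline\Omega$), with $u\le0$ in $\Omega$ and $u=0$ on $\partial\Omega$. Then all the integrands below are integrable, and $$\int_\Omega\big\{(\Delta_Hu)^2-\|\nabla^2_Hu\|^2\big\}\,dg+\frac34\sum_{i,j=1}^m\int_\Omega([X_i,X_j]u)^2\,dg+\sum_{i,j=1}^m\int_\Omega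 X_iu\,[[X_i,X_j],X_j]u\,dg=\int_{\partial\Omega}\mathcal H\,|\nabla^Hu|^2\,d\sigma_H .$$ (b) If instead $u\in C_0^\infty(\Omega)$ (smooth with compact support in $\Omega$, of arbitrary sign), then $$\int_\Omega\|\nabla^2_Hu\|^2\,dg=\int_\Omega(\Delta_Hu)^2\,dg+\frac34\sum_{i,j=1}^m\int_\Omega([X_i,X_j]u)^2\,dg+\sum_{i,j=1}^m\int_\Omega X_iu\,[[X_i,X_j],X_j]u\,dg .$$ (c) If $r=2$, then in (a) and in (b) the integrals $\int_\Omega X_iu\,[[X_i,X_j],X_j]u\,dg$ vanish for all $i,j$. -/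

import Mathlib

open MeasureTheory Topology Set
open scoped ContDiff RealInnerProductSpace

noncomputable section

/-- A Lie group whose exponential map is a global diffeomorphism (as for every simply connected
nilpotent Lie group), in exponential coordinates: the group is identified with its Lie
algebra `𝔤` through `exp`, so that the group law lives on the vector
space `𝔤`, the identity is `0`, and the one-parameter subgroups are the lines `t ↦ t • x`.
The inner product of `𝔤` is the one that defines the left-invariant Riemannian metric. -/
structure ExpLieGroup (𝔤 : Type*) [NormedAddCommGroup 𝔤] [InnerProductSpace ℝ 𝔤] where
  mul : 𝔤 → 𝔤 → 𝔤
  mul_assoc : ∀ x y z, mul (mul x y) z = mul x (mul y z)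
  zero_mul : ∀ x, mul 0 x = x
  mul_zero : ∀ x, mul x 0 = x
  mul_smul_smul : ∀ (s t : ℝ) (x : 𝔤), mul (s • x) (t • x) = (s + t) • x
  contDiff_mul : ContDiff ℝ ∞ (fun p : 𝔤 × 𝔤 => mul p.1 p.2)

namespace ExpLieGroup

variable {𝔤 : Type*} [NormedAddCommGroup 𝔤] [InnerProductSpace ℝ 𝔤] (G : ExpLieGroup 𝔤)

/-- The left-invariant vector field `p ↦ (L_p)_* ξ`. -/
def leftField (ξ : 𝔤) (p : 𝔤) : 𝔤 := fderiv ℝ (G.mul p) 0 ξ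

/-- The inverse trivialization: a vector `w` tangent at `p` is carried to `(L_{p⁻¹})_* w`, which is
tangent at the identity. The inverse of `p` is `-p`. -/
def toLie (p : 𝔤) (w : 𝔤) : 𝔤 := fderiv ℝ (G.mul (-p)) p w

/-- The left-invariant Riemannian metric at `p`. -/
def metric (p : 𝔤) (v w : 𝔤) : ℝ := ⟪G.toLie p v, G.toLie p w⟫

/-- The bracket of the Lie algebra of the group: the value at the identity of the commutator of the
left-invariant vector fields. -/
def bracket (ξ η : 𝔤) : 𝔤 := VectorField.lieBracket ℝ (G.leftField ξ) (G.leftField η) 0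

/-- The derivative of `f` at `p` along the left-invariant vector field of `ξ`, that is along its
integral curve `t ↦ p · exp (t ξ)`. -/
def lieDeriv (ξ : 𝔤) (f : 𝔤 → ℝ) (p : 𝔤) : ℝ := deriv (fun t : ℝ => f (G.mul p (t • ξ))) 0

/-- Iterated derivatives `X_{i₁} X_{i₂} ⋯ X_{iₛ} u` along left-invariant vector fields. -/
def wordDeriv {m : ℕ} (X : Fin m → 𝔤) : List (Fin m) → (𝔤 → ℝ) → 𝔤 → ℝ
  | [], u => u
  | i :: w, u => G.lieDeriv (X i) (wordDeriv X w u)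

/-- The Folland-Stein class `Γ^k` on the closure of the open set `Ω`: all iterated derivatives of
`u` of order at most `k` along the `X i` exist in `Ω`, and they extend continuously to the closure
(for the order `0`, the extension is `u` itself). -/
def FollandStein {m : ℕ} (X : Fin m → 𝔤) (k : ℕ) (Ω : Set 𝔤) (u : 𝔤 → ℝ) : Prop :=
  ContinuousOn u (closure Ω) ∧
  (∀ (i : Fin m) (w : List (Fin m)), w.length + 1 ≤ k → ∀ p ∈ Ω,
    DifferentiableAt ℝ (fun t : ℝ => G.wordDeriv X w u (G.mul p (t • X i))) 0) ∧
  (∀ w : List (Fin m), w.length ≤ k →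
    ∃ v : 𝔤 → ℝ, ContinuousOn v (closure Ω) ∧ EqOn v (G.wordDeriv X w u) Ω)

/-- `∑ X_i X_i u`. -/
def hLaplacian {m : ℕ} (X : Fin m → 𝔤) (u : 𝔤 → ℝ) (p : 𝔤) : ℝ :=
  ∑ i, G.lieDeriv (X i) (G.lieDeriv (X i) u) p

/-- The symmetrized Hessian `(X_i X_j u + X_j X_i u) / 2`. -/
def hHessian {m : ℕ} (X : Fin m → 𝔤) (u : 𝔤 → ℝ) (p : 𝔤) : Matrix (Fin m) (Fin m) ℝ :=
  Matrix.of fun i j =>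
    (G.lieDeriv (X i) (G.lieDeriv (X j) u) p + G.lieDeriv (X j) (G.lieDeriv (X i) u) p) / 2

/-- The squared Hilbert-Schmidt norm of the symmetrized Hessian. -/
def hHessianNormSq {m : ℕ} (X : Fin m → 𝔤) (u : 𝔤 → ℝ) (p : 𝔤) : ℝ :=
  ∑ i, ∑ j, (G.hHessian X u p i j) ^ 2

/-- `[X, Y] u`, where `X`, `Y` are the left-invariant vector fields of `ξ`, `η`. -/
def comm₂ (ξ η : 𝔤) (u : 𝔤 → ℝ) (p : 𝔤) : ℝ :=
  fderiv ℝ u p (VectorField.lieBracket ℝ (G.leftField ξ) (G.leftField η) p)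

/-- `[[X, Y], Z] u`, where `X`, `Y`, `Z` are the left-invariant vector fields of `ξ`, `η`, `ζ`. -/
def comm₃ (ξ η ζ : 𝔤) (u : 𝔤 → ℝ) (p : 𝔤) : ℝ :=
  fderiv ℝ u p (VectorField.lieBracket ℝ
    (VectorField.lieBracket ℝ (G.leftField ξ) (G.leftField η)) (G.leftField ζ) p)

/-- `|∇^H u|²` on the closure of `Ω`, boundary points included, for `u` of class `C¹` up to the
boundary. -/
def hGradSq {m : ℕ} (X : Fin m → 𝔤) (Ω : Set 𝔤) (u : 𝔤 → ℝ) (p : 𝔤) : ℝ :=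
  ∑ i, (fderivWithin ℝ u (closure Ω) p (G.leftField (X i) p)) ^ 2

end ExpLieGroup

section Domain

variable {𝔤 : Type*} [NormedAddCommGroup 𝔤] [InnerProductSpace ℝ 𝔤]

/-- `φ` is a `C²` local defining function of `Ω` at its boundary point `p`. -/
def IsLocalDefiningFunction (Ω : Set 𝔤) (p : 𝔤) (φ : 𝔤 → ℝ) : Prop :=
  ContDiffAt ℝ 2 φ p ∧ φ p = 0 ∧ fderiv ℝ φ p ≠ 0 ∧ ∀ᶠ q in 𝓝 p, (q ∈ Ω ↔ φ q < 0)

/-- `Ω` is an open set of class `C²`. -/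
def IsC2Open (Ω : Set 𝔤) : Prop :=
  IsOpen Ω ∧ ∀ p ∈ frontier Ω, ∃ φ, IsLocalDefiningFunction Ω p φ

end Domain

namespace ExpLieGroup

variable {𝔤 : Type*} [NormedAddCommGroup 𝔤] [InnerProductSpace ℝ 𝔤] (G : ExpLieGroup 𝔤)

/-- `ν` is the Riemannian outer unit normal to the boundary of `Ω` at `p`, written in the
left-invariant trivialization: the Riemannian gradient at `p` of a local defining function is a
positive multiple of `ν`. -/
def IsOuterNormal (Ω : Set 𝔤) (p ν : 𝔤) : Prop :=
  ‖ν‖ = 1 ∧ ∃ φ, IsLocalDefiningFunction Ω p φ ∧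
    ∃ c : ℝ, 0 < c ∧ ∀ η : 𝔤, fderiv ℝ φ p (G.leftField η p) = c * ⟪ν, η⟫

open Classical in
/-- The Riemannian outer unit normal (in the left-invariant trivialization), and `0` off the
boundary. -/
def outerNormal (Ω : Set 𝔤) (p : 𝔤) : 𝔤 :=
  if h : ∃ ν, G.IsOuterNormal Ω p ν then h.choose else 0

/-- The zero-order part of the Levi-Civita connection of the left-invariant metric:
`∇_X Y` for left-invariant `X`, `Y`, by Koszul's formula. -/
def koszul [FiniteDimensional ℝ 𝔤] (ξ η : 𝔤) : 𝔤 :=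
  ∑ a, ((⟪G.bracket ξ η, stdOrthonormalBasis ℝ 𝔤 a⟫
      - ⟪G.bracket η (stdOrthonormalBasis ℝ 𝔤 a), ξ⟫
      + ⟪G.bracket (stdOrthonormalBasis ℝ 𝔤 a) ξ, η⟫) / 2) • stdOrthonormalBasis ℝ 𝔤 a

/-- The Levi-Civita connection: `∇_X Y` at `p`, where the vector field `Y` and the vector
`X = ξ` at `p` are written in the left-invariant trivialization. -/
def leviCivita [FiniteDimensional ℝ 𝔤] (p ξ : 𝔤) (Y : 𝔤 → 𝔤) : 𝔤 :=
  fderiv ℝ Y p (G.leftField ξ p) + G.koszul ξ (Y p)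

/-- A `C¹` parametrization, on an open set `U` of `ℝ^(N-1)`, of a piece of the boundary of `Ω`. -/
def IsBoundaryParam (Ω : Set 𝔤) (U : Set (EuclideanSpace ℝ (Fin (Module.finrank ℝ 𝔤 - 1))))
    (ψ : EuclideanSpace ℝ (Fin (Module.finrank ℝ 𝔤 - 1)) → 𝔤) : Prop :=
  IsOpen U ∧ ContDiffOn ℝ 1 ψ U ∧ InjOn ψ U ∧ MapsTo ψ U (frontier Ω) ∧
    ∀ x ∈ U, Function.Injective (fderiv ℝ ψ x)

/-- The Riemannian area density `√det (g(∂_a ψ, ∂_b ψ))` of a parametrization. -/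
def areaDensity (ψ : EuclideanSpace ℝ (Fin (Module.finrank ℝ 𝔤 - 1)) → 𝔤)
    (x : EuclideanSpace ℝ (Fin (Module.finrank ℝ 𝔤 - 1))) : ℝ :=
  √(Matrix.of fun a b => G.metric (ψ x)
    (fderiv ℝ ψ x (EuclideanSpace.single a 1)) (fderiv ℝ ψ x (EuclideanSpace.single b 1))).det

/-- The Riemannian surface measure on the boundary of `Ω`. Each parametrization `ψ` carries its area
measure to the boundary; these measures agree on overlaps, and the surface measure is the measure
glued from them, which is their supremum. -/
def surfaceMeasure [MeasurableSpace 𝔤] (Ω : Set 𝔤) : Measure 𝔤 :=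
  ⨆ (U : Set (EuclideanSpace ℝ (Fin (Module.finrank ℝ 𝔤 - 1))))
    (ψ : EuclideanSpace ℝ (Fin (Module.finrank ℝ 𝔤 - 1)) → 𝔤) (_ : IsBoundaryParam Ω U ψ),
    Measure.map ψ
      ((volume.restrict U).withDensity fun x => ENNReal.ofReal (G.areaDensity ψ x))

end ExpLieGroup

/-- A Carnot group (in exponential coordinates) of step `step`: its Lie algebra is the orthogonal
direct sum of the layers `V_1, …, V_step` (with `V_j = 0` for the other indices), and
`[V_1, V_j] = V_{j+1}` for all `j ≥ 1`; in particular `[V_1, V_step] = 0`. -/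
structure CarnotGroup (𝔤 : Type*) [NormedAddCommGroup 𝔤] [InnerProductSpace ℝ 𝔤] extends
    ExpLieGroup 𝔤 where
  step : ℕ
  layer : ℕ → Submodule ℝ 𝔤
  layer_zero : layer 0 = ⊥
  layer_of_step_lt : ∀ j, step < j → layer j = ⊥
  layer_ortho : ∀ i j, i ≠ j → layer i ⟂ layer j
  iSup_layer : ⨆ j, layer j = ⊤
  bracket_layer : ∀ j, 1 ≤ j →
    Submodule.span ℝ {ζ | ∃ ξ ∈ layer 1, ∃ η ∈ layer j, ζ = toExpLieGroup.bracket ξ η}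
      = layer (j + 1)

namespace CarnotGroup

variable {𝔤 : Type*} [NormedAddCommGroup 𝔤] [InnerProductSpace ℝ 𝔤] [FiniteDimensional ℝ 𝔤]
  (G : CarnotGroup 𝔤)

/-- The outer horizontal normal `N^H`: the projection of the normal onto the horizontal layer. -/
def hNormal (Ω : Set 𝔤) (p : 𝔤) : 𝔤 := (G.layer 1).starProjection (G.outerNormal Ω p)

/-- The angle function `W = |N^H|`. -/
def angle (Ω : Set 𝔤) (p : 𝔤) : ℝ := ‖G.hNormal Ω p‖

/-- The characteristic set of the boundary of `Ω`. -/
def charSet (Ω : Set 𝔤) : Set 𝔤 := {p ∈ frontier Ω | G.angle Ω p = 0}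

/-- The horizontal Gauss map `ν^H = N^H / |N^H|`. -/
def hGauss (Ω : Set 𝔤) (p : 𝔤) : 𝔤 := (G.angle Ω p)⁻¹ • G.hNormal Ω p

/-- The horizontal Levi-Civita connection: the horizontal part of the Levi-Civita connection. -/
def hConnection (p ξ : 𝔤) (Y : 𝔤 → 𝔤) : 𝔤 :=
  (G.layer 1).starProjection (G.leviCivita p ξ Y)

/-- `c` is the horizontal mean curvature of the boundary of `Ω` at the non-characteristic point `p`,
computed with a `C¹` orthonormal frame `E_1, …, E_{m-1}` of the horizontal tangent bundle
`T_H ∂Ω` near `p` as `-∑ ⟨∇^H_{E_i} E_i, ν^H⟩`. The sign is the one for which, with the outer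
normal, round balls of Euclidean space have positive curvature. -/
def IsHMeanCurvature (Ω : Set 𝔤) (p : 𝔤) (c : ℝ) : Prop :=
  ∃ E : Fin (Module.finrank ℝ (G.layer 1) - 1) → 𝔤 → 𝔤,
    (∀ i, ContDiffAt ℝ 1 (E i) p) ∧
    (∀ᶠ q in 𝓝[frontier Ω] p, Orthonormal ℝ (fun i => E i q) ∧
      ∀ i, E i q ∈ G.layer 1 ∧ ⟪G.outerNormal Ω q, E i q⟫ = 0) ∧
    c = -∑ i, ⟪G.hConnection p (E i p) (E i), G.hGauss Ω p⟫

open Classical in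
/-- The horizontal mean curvature off the characteristic set (`0` elsewhere). -/
def hMeanCurvatureAux (Ω : Set 𝔤) (p : 𝔤) : ℝ :=
  if h : p ∈ frontier Ω \ G.charSet Ω ∧ ∃ c, G.IsHMeanCurvature Ω p c then h.2.choose else 0

open Classical in
/-- The horizontal mean curvature of the boundary of `Ω`; at a characteristic point it is the limit
of the values at non-characteristic points, if that limit exists. -/
def hMeanCurvature (Ω : Set 𝔤) (p : 𝔤) : ℝ :=
  if p ∈ G.charSet Ω then Filter.limUnder (𝓝[frontier Ω \ G.charSet Ω] p) (G.hMeanCurvatureAux Ω)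
  else G.hMeanCurvatureAux Ω p

/-- The `H`-perimeter measure `dσ_H = W dσ`. -/
def perimeterMeasure [MeasurableSpace 𝔤] (Ω : Set 𝔤) : Measure 𝔤 :=
  (G.surfaceMeasure Ω).withDensity fun p => ENNReal.ofReal (G.angle Ω p)

end CarnotGroup

end

noncomputable section

/-! Put A_ij = X_iX_j u, and consider the horizontal field with components F_j = Σ_i (X_j u · A_ii −
X_i u · (2 A_ij − A_ji)), which is `hFlux`. The weights 2 and −1 are chosen so that in Σ_j X_j F_j
the third-order terms assemble into Σ X_i u [[X_i,X_j],X_j]u. The quadratic terms are (Δ_H u)² −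
‖S‖² + 3‖K‖², with S and K the symmetric and antisymmetric parts of A. Since K_ij = ½[X_i,X_j]u,
this is exactly the integrand on the left (`sum_lieDeriv_hFlux`), and the divergence theorem
`setIntegral_lieDeriv` turns its integral into a boundary flux.

On the boundary u = 0 forces X_i u = c N_i with N = N^H, so the flux is c (W² tr A − A(N,N)), that
is, cW² times the trace of A over the horizontal tangent space. Differentiating E u = 0 along a
horizontal tangent field E gives A(E,E) = −c⟨∇_E E, N⟩, so this trace is cW𝓗 and the flux equals W 𝓗
|∇^H u|² (`sum_lieDerivWithin_lieDerivWithin_eq`, `sum_hFluxWithin_mul_inner`). At characteristic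
points both sides vanish together with W. A compactly supported u has no boundary term, and in step
two the double commutators lie in V_3 = 0.

Three things need real work. First, left-invariant fields must be divergence free for Lebesgue
measure in exponential coordinates: they generate right translations, whose Jacobian is 1 because
every ad x is nilpotent (`det_fderiv_mul_right`, `measurePreserving_mul_right`).

Second, u is only C², and its third derivatives exist only along horizontal words. The commutator
formula needed at third order is therefore proved in the weak sense against test functions and
upgraded by continuity (`lieDeriv_comm`). Likewise the divergence theorem asks F_j only to be
continuous up to the boundary and to have an integrable, interior-continuous derivative along X_j.

Third, the surface measure is a supremum over parametrizations. It is computed in boxes where Ω is a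
C² subgraph (`GraphChart`): there the graph parametrization attains the supremum, its area density
is the norm of the left-invariant gradient of t − h(y), and the boundary term arises as the limit of
a cutoff concentrating on an inner collar. -/

theorem two_le_contDiff_infty : (2 : ℕ∞ω) ≤ ∞ :=
  WithTop.coe_le_coe.2 (le_top : (2 : ℕ∞) ≤ ⊤)

/-! ### Left-invariant vector fields and the Lie bracket -/

namespace ExpLieGroup

section Basic

variable {𝔤 : Type*} [NormedAddCommGroup 𝔤] [InnerProductSpace ℝ 𝔤] (G : ExpLieGroup 𝔤)

theorem mul_neg_self (x : 𝔤) : G.mul x (-x) = 0 := by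
  simpa using G.mul_smul_smul 1 (-1) x

theorem neg_mul_self (x : 𝔤) : G.mul (-x) x = 0 := by
  simpa using G.mul_smul_smul (-1) 1 x

theorem mul_neg_cancel_left (x y : 𝔤) : G.mul x (G.mul (-x) y) = y := by
  rw [← G.mul_assoc, mul_neg_self, G.zero_mul]

theorem neg_mul_cancel_left (x y : 𝔤) : G.mul (-x) (G.mul x y) = y := by
  rw [← G.mul_assoc, neg_mul_self, G.zero_mul]

theorem mul_neg_cancel_right (x y : 𝔤) : G.mul (G.mul y x) (-x) = y := by
  rw [G.mul_assoc, mul_neg_self, G.mul_zero]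

theorem neg_mul_cancel_right (x y : 𝔤) : G.mul (G.mul y (-x)) x = y := by
  rw [G.mul_assoc, neg_mul_self, G.mul_zero]

theorem contDiff_mul_comp {F : Type*} [NormedAddCommGroup F] [NormedSpace ℝ F] {f g : F → 𝔤}
    {n : ℕ∞ω} (hn : n ≤ ∞) (hf : ContDiff ℝ n f) (hg : ContDiff ℝ n g) :
    ContDiff ℝ n (fun z => G.mul (f z) (g z)) :=
  (G.contDiff_mul.of_le hn).comp (hf.prodMk hg)

theorem contDiff_mul_left (p : 𝔤) : ContDiff ℝ ∞ (G.mul p) :=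
  G.contDiff_mul_comp le_rfl contDiff_const contDiff_id

theorem contDiff_mul_right (q : 𝔤) : ContDiff ℝ ∞ (fun p => G.mul p q) :=
  G.contDiff_mul_comp le_rfl contDiff_id contDiff_const

theorem differentiable_mul_left (p : 𝔤) : Differentiable ℝ (G.mul p) :=
  (G.contDiff_mul_left p).differentiable (by simp)

theorem differentiable_mul_right (q : 𝔤) : Differentiable ℝ (fun p => G.mul p q) :=
  (G.contDiff_mul_right q).differentiable (by simp)

theorem differentiable_mul : Differentiable ℝ (fun p : 𝔤 × 𝔤 => G.mul p.1 p.2) :=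
  G.contDiff_mul.differentiable (by simp)

theorem continuous_mul : Continuous (fun p : 𝔤 × 𝔤 => G.mul p.1 p.2) :=
  G.contDiff_mul.continuous

theorem contDiff_fderiv_mul_left : ContDiff ℝ ∞ (fun p => fderiv ℝ (G.mul p) 0) :=
  ContDiff.fderiv (m := ∞) (f := fun p q => G.mul p q) G.contDiff_mul contDiff_const (by simp)

theorem contDiff_toLie : ContDiff ℝ ∞ (fun p => fderiv ℝ (G.mul (-p)) p) :=
  ContDiff.fderiv (m := ∞) (f := fun p q => G.mul (-p) q)
    (G.contDiff_mul_comp le_rfl contDiff_fst.neg contDiff_snd) contDiff_id (by simp)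

theorem contDiff_leftField (ξ : 𝔤) : ContDiff ℝ ∞ (G.leftField ξ) :=
  G.contDiff_fderiv_mul_left.clm_apply contDiff_const

theorem leftField_add (ξ η p : 𝔤) :
    G.leftField (ξ + η) p = G.leftField ξ p + G.leftField η p := by simp [leftField]

theorem leftField_smul (c : ℝ) (ξ p : 𝔤) : G.leftField (c • ξ) p = c • G.leftField ξ p := by
  simp [leftField]

theorem leftField_zero_left (p : 𝔤) : G.leftField 0 p = 0 := by simp [leftField]

theorem fderiv_mul_zero_left : fderiv ℝ (G.mul 0) 0 = ContinuousLinearMap.id ℝ 𝔤 := by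
  have : G.mul 0 = id := funext G.zero_mul
  rw [this, fderiv_id]

theorem leftField_zero (ξ : 𝔤) : G.leftField ξ 0 = ξ := by
  simp [leftField, fderiv_mul_zero_left]

theorem toLie_comp_fderiv_mul (p : 𝔤) :
    (fderiv ℝ (G.mul (-p)) p).comp (fderiv ℝ (G.mul p) 0) = ContinuousLinearMap.id ℝ 𝔤 := by
  have h := fderiv_comp (0 : 𝔤) (g := G.mul (-p)) (f := G.mul p)
    (G.differentiable_mul_left _ _) (G.differentiable_mul_left _ _)
  have h2 : G.mul (-p) ∘ G.mul p = id := funext (G.neg_mul_cancel_left p)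
  rw [h2, fderiv_id, G.mul_zero] at h
  exact h.symm

theorem fderiv_mul_comp_toLie (p : 𝔤) :
    (fderiv ℝ (G.mul p) 0).comp (fderiv ℝ (G.mul (-p)) p) = ContinuousLinearMap.id ℝ 𝔤 := by
  have h := fderiv_comp p (g := G.mul p) (f := G.mul (-p))
    (G.differentiable_mul_left _ _) (G.differentiable_mul_left _ _)
  have h2 : G.mul p ∘ G.mul (-p) = id := funext (G.mul_neg_cancel_left p)
  rw [h2, fderiv_id, G.neg_mul_self] at h
  exact h.symm

theorem toLie_leftField (p ξ : 𝔤) : G.toLie p (G.leftField ξ p) = ξ :=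
  DFunLike.congr_fun (G.toLie_comp_fderiv_mul p) ξ

theorem leftField_toLie (p w : 𝔤) : G.leftField (G.toLie p w) p = w :=
  DFunLike.congr_fun (G.fderiv_mul_comp_toLie p) w

/-- The differential at the identity of a left translation, as an equivalence. -/
def fderivMulEquiv (p : 𝔤) : 𝔤 ≃L[ℝ] 𝔤 :=
  ContinuousLinearEquiv.equivOfInverse (fderiv ℝ (G.mul p) 0) (fderiv ℝ (G.mul (-p)) p)
    (G.toLie_leftField p) (G.leftField_toLie p)

theorem fderiv_mul_left_leftField (p q ξ : 𝔤) :
    fderiv ℝ (G.mul p) q (G.leftField ξ q) = G.leftField ξ (G.mul p q) := by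
  have h := fderiv_comp (0 : 𝔤) (g := G.mul p) (f := G.mul q)
    (G.differentiable_mul_left _ _) (G.differentiable_mul_left _ _)
  have h2 : G.mul p ∘ G.mul q = G.mul (G.mul p q) := funext fun z => (G.mul_assoc p q z).symm
  rw [h2, G.mul_zero] at h
  exact (DFunLike.congr_fun h ξ).symm

theorem hasDerivAt_mul_smul (p ξ : 𝔤) :
    HasDerivAt (fun t : ℝ => G.mul p (t • ξ)) (G.leftField ξ p) 0 := by
  have h1 : HasDerivAt (fun t : ℝ => t • ξ) ξ 0 := by
    simpa using (hasDerivAt_id (0 : ℝ)).smul_const ξ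
  have h2 : HasFDerivAt (G.mul p) (fderiv ℝ (G.mul p) 0) ((0 : ℝ) • ξ) := by
    rw [zero_smul]; exact (G.differentiable_mul_left p 0).hasFDerivAt
  exact h2.comp_hasDerivAt 0 h1

theorem _root_.HasFDerivAt.hasDerivAt_mul_smul {f : 𝔤 → ℝ} {f' : 𝔤 →L[ℝ] ℝ} {p : 𝔤}
    (hf : HasFDerivAt f f' p) (ξ : 𝔤) :
    HasDerivAt (fun t : ℝ => f (G.mul p (t • ξ))) (f' (G.leftField ξ p)) 0 := by
  refine HasFDerivAt.comp_hasDerivAt 0 ?_ (G.hasDerivAt_mul_smul p ξ)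
  simpa [G.mul_zero] using hf

theorem lieDeriv_eq_fderiv {f : 𝔤 → ℝ} {p : 𝔤} (hf : DifferentiableAt ℝ f p) (ξ : 𝔤) :
    G.lieDeriv ξ f p = fderiv ℝ f p (G.leftField ξ p) :=
  (hf.hasFDerivAt.hasDerivAt_mul_smul G ξ).deriv

theorem tendsto_mul_smul (p ξ : 𝔤) :
    Filter.Tendsto (fun t : ℝ => G.mul p (t • ξ)) (𝓝 0) (𝓝 p) := by
  have := (G.hasDerivAt_mul_smul p ξ).continuousAt.tendsto
  simpa [G.mul_zero] using this

theorem lieDeriv_congr {f g : 𝔤 → ℝ} {p : 𝔤} (h : f =ᶠ[𝓝 p] g) (ξ : 𝔤) :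
    G.lieDeriv ξ f p = G.lieDeriv ξ g p :=
  Filter.EventuallyEq.deriv_eq ((G.tendsto_mul_smul p ξ).eventually h)

theorem differentiableAt_mul_smul_congr {f g : 𝔤 → ℝ} {p ξ : 𝔤} (h : f =ᶠ[𝓝 p] g)
    (hf : DifferentiableAt ℝ (fun t : ℝ => f (G.mul p (t • ξ))) 0) :
    DifferentiableAt ℝ (fun t : ℝ => g (G.mul p (t • ξ))) 0 :=
  hf.congr_of_eventuallyEq ((G.tendsto_mul_smul p ξ).eventually h.symm)

/-- A differential at the origin is determined by its restrictions to the two factors, and on each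
of them multiplication by the identity is the identity map. -/
theorem hasFDerivAt_mul_zero :
    HasFDerivAt (fun p : 𝔤 × 𝔤 => G.mul p.1 p.2)
      (ContinuousLinearMap.fst ℝ 𝔤 𝔤 + ContinuousLinearMap.snd ℝ 𝔤 𝔤) 0 := by
  have h := (G.differentiable_mul 0).hasFDerivAt
  convert h using 1
  set L := fderiv ℝ (fun p : 𝔤 × 𝔤 => G.mul p.1 p.2) 0
  have h1 : HasFDerivAt (fun p : 𝔤 => G.mul p 0) (L.comp (ContinuousLinearMap.inl ℝ 𝔤 𝔤)) 0 :=
    HasFDerivAt.comp (g := fun p : 𝔤 × 𝔤 => G.mul p.1 p.2) (f := fun p : 𝔤 => (p, (0 : 𝔤))) 0 h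
      (hasFDerivAt_prodMk_left 0 0)
  have h2 : HasFDerivAt (fun p : 𝔤 => G.mul 0 p) (L.comp (ContinuousLinearMap.inr ℝ 𝔤 𝔤)) 0 :=
    HasFDerivAt.comp (g := fun p : 𝔤 × 𝔤 => G.mul p.1 p.2) (f := fun p : 𝔤 => ((0 : 𝔤), p)) 0 h
      (hasFDerivAt_prodMk_right 0 0)
  simp only [G.mul_zero, G.zero_mul] at h1 h2
  have h1' := h1.unique (hasFDerivAt_id 0)
  have h2' := h2.unique (hasFDerivAt_id 0)
  ext x
  · simpa using (DFunLike.congr_fun h1' x).symm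
  · simpa using (DFunLike.congr_fun h2' x).symm

theorem differentiable_leftField (ξ : 𝔤) : Differentiable ℝ (G.leftField ξ) :=
  (G.contDiff_leftField ξ).differentiable (by simp)

theorem pullback_mul_leftField (p ξ : 𝔤) :
    VectorField.pullback ℝ (G.mul p) (G.leftField ξ) = G.leftField ξ := by
  ext q
  rw [VectorField.pullback, ← G.fderiv_mul_left_leftField p q ξ]
  have : (fderiv ℝ (G.mul p) q).IsInvertible := by
    have h := fderiv_comp (0 : 𝔤) (g := G.mul p) (f := G.mul q)
      (G.differentiable_mul_left _ _) (G.differentiable_mul_left _ _)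
    have h2 : G.mul p ∘ G.mul q = G.mul (G.mul p q) := funext fun z => (G.mul_assoc p q z).symm
    rw [h2, G.mul_zero] at h
    refine ⟨(G.fderivMulEquiv q).symm.trans (G.fderivMulEquiv (G.mul p q)), ?_⟩
    ext v
    have := DFunLike.congr_fun h ((G.fderivMulEquiv q).symm v)
    have h3 : fderiv ℝ (G.mul q) 0 ((G.fderivMulEquiv q).symm v) = v :=
      (G.fderivMulEquiv q).apply_symm_apply v
    rw [ContinuousLinearMap.comp_apply, h3] at this
    exact this
  obtain ⟨M, hM⟩ := this
  rw [← hM, ContinuousLinearMap.inverse_equiv]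
  simp

theorem bracket_swap (ξ η : 𝔤) : G.bracket ξ η = - G.bracket η ξ :=
  VectorField.lieBracket_swap

theorem bracket_self (ξ : 𝔤) : G.bracket ξ ξ = 0 := by
  simp [bracket]

theorem bracket_add_right (ξ η ζ : 𝔤) :
    G.bracket ξ (η + ζ) = G.bracket ξ η + G.bracket ξ ζ := by
  have : G.leftField (η + ζ) = G.leftField η + G.leftField ζ := funext fun p => G.leftField_add η ζ p
  rw [bracket, this]
  exact VectorField.lieBracket_add_right (G.differentiable_leftField η _)
    (G.differentiable_leftField ζ _)

theorem bracket_smul_right (c : ℝ) (ξ η : 𝔤) : G.bracket ξ (c • η) = c • G.bracket ξ η := by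
  have : G.leftField (c • η) = c • G.leftField η := funext fun p => G.leftField_smul c η p
  rw [bracket, this]
  exact VectorField.lieBracket_const_smul_right (G.differentiable_leftField η _)

theorem bracket_add_left (ξ η ζ : 𝔤) :
    G.bracket (ξ + η) ζ = G.bracket ξ ζ + G.bracket η ζ := by
  rw [bracket_swap, bracket_add_right, bracket_swap _ ζ ξ, bracket_swap _ ζ η]; abel

theorem bracket_smul_left (c : ℝ) (ξ η : 𝔤) : G.bracket (c • ξ) η = c • G.bracket ξ η := by
  rw [bracket_swap, bracket_smul_right, bracket_swap _ η ξ]; simp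

/-- `bracket` as a bilinear map. -/
def bracketₗ : 𝔤 →ₗ[ℝ] 𝔤 →ₗ[ℝ] 𝔤 :=
  LinearMap.mk₂ ℝ G.bracket G.bracket_add_left G.bracket_smul_left G.bracket_add_right
    G.bracket_smul_right

@[simp] theorem bracketₗ_apply (ξ η : 𝔤) : G.bracketₗ ξ η = G.bracket ξ η := rfl

end Basic

section Bracket

variable {𝔤 : Type*} [NormedAddCommGroup 𝔤] [InnerProductSpace ℝ 𝔤] [FiniteDimensional ℝ 𝔤]
  (G : ExpLieGroup 𝔤)

/-- Pullback by a left translation commutes with Lie brackets and fixes left-invariant fields. Hence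
the bracket is again left-invariant and is determined by its value at the identity. -/
theorem lieBracket_leftField (ξ η : 𝔤) :
    VectorField.lieBracket ℝ (G.leftField ξ) (G.leftField η) = G.leftField (G.bracket ξ η) := by
  ext p
  have h := VectorField.pullback_lieBracket (𝕜 := ℝ) (n := 2) (by simp) (f := G.mul p)
    (V := G.leftField ξ) (W := G.leftField η) (x := 0)
    ((G.contDiff_mul_left p).contDiffAt.of_le two_le_contDiff_infty)
    (G.differentiable_leftField ξ _) (G.differentiable_leftField η _)
  rw [pullback_mul_leftField, pullback_mul_leftField] at h
  rw [bracket, ← h, VectorField.pullback, G.mul_zero, leftField]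
  change _ = (G.fderivMulEquiv p : 𝔤 →L[ℝ] 𝔤)
    ((G.fderivMulEquiv p : 𝔤 →L[ℝ] 𝔤).inverse _)
  rw [ContinuousLinearMap.inverse_equiv]
  simp

theorem bracket_jacobi (ξ η ζ : 𝔤) :
    G.bracket ξ (G.bracket η ζ) = G.bracket (G.bracket ξ η) ζ + G.bracket η (G.bracket ξ ζ) := by
  have h := VectorField.leibniz_identity_lieBracket (𝕜 := ℝ) (n := 2) (by simp) (x := 0)
    ((G.contDiff_leftField ξ).contDiffAt.of_le two_le_contDiff_infty)
    ((G.contDiff_leftField η).contDiffAt.of_le two_le_contDiff_infty)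
    ((G.contDiff_leftField ζ).contDiffAt.of_le two_le_contDiff_infty)
  simpa only [lieBracket_leftField, leftField_zero] using h

end Bracket

end ExpLieGroup

/-! ### The adjoint representation and unipotent Jacobians -/

/-- The characteristic polynomial of a nilpotent map is X^d; evaluate it at 1. -/
theorem LinearMap.det_one_sub_of_isNilpotent {V : Type*} [AddCommGroup V] [Module ℝ V]
    [FiniteDimensional ℝ V] {n : Module.End ℝ V} (hn : IsNilpotent n) :
    LinearMap.det (1 - n) = 1 := by
  have h := LinearMap.eval_charpoly n (1 : ℝ)
  rw [hn.charpoly_eq_X_pow_finrank] at h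
  simpa using h.symm

theorem ContinuousLinearMap.det_one_sub_of_isNilpotent {V : Type*} [NormedAddCommGroup V]
    [NormedSpace ℝ V] [FiniteDimensional ℝ V] {n : V →L[ℝ] V} (hn : IsNilpotent n) :
    (1 - n).det = 1 := by
  have : IsNilpotent (n : V →ₗ[ℝ] V) := by
    obtain ⟨k, hk⟩ := hn
    refine ⟨k, ?_⟩
    have := congrArg (fun f : V →L[ℝ] V => (f : V →ₗ[ℝ] V)) hk
    simpa using this
  exact LinearMap.det_one_sub_of_isNilpotent this

namespace ExpLieGroup

section Adjoint

variable {𝔤 : Type*} [NormedAddCommGroup 𝔤] [InnerProductSpace ℝ 𝔤] (G : ExpLieGroup 𝔤)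

/-- Conjugation by `x`. -/
def conj (x q : 𝔤) : 𝔤 := G.mul (G.mul x q) (-x)

/-- The adjoint representation. -/
def Ad (x : 𝔤) : 𝔤 →L[ℝ] 𝔤 := fderiv ℝ (G.conj x) 0

theorem conj_zero (x : 𝔤) : G.conj x 0 = 0 := by
  rw [conj, G.mul_zero, mul_neg_self]

theorem contDiff_conj : ContDiff ℝ ∞ (fun p : 𝔤 × 𝔤 => G.conj p.1 p.2) :=
  G.contDiff_mul_comp le_rfl (G.contDiff_mul_comp le_rfl contDiff_fst contDiff_snd)
    contDiff_fst.neg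

theorem differentiable_conj (x : 𝔤) : Differentiable ℝ (G.conj x) :=
  (G.contDiff_conj.comp (contDiff_const.prodMk contDiff_id)).differentiable (by simp)

theorem contDiff_Ad : ContDiff ℝ ∞ G.Ad :=
  ContDiff.fderiv (m := ∞) (f := fun p q => G.conj p q) G.contDiff_conj contDiff_const (by simp)

theorem Ad_zero : G.Ad 0 = 1 := by
  have : G.conj 0 = id := by
    ext q; simp [conj, G.zero_mul, G.mul_zero]
  rw [Ad, this, fderiv_id]; rfl

theorem conj_add_smul (s t : ℝ) (x q : 𝔤) :
    G.conj ((s + t) • x) q = G.conj (s • x) (G.conj (t • x) q) := by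
  have h1 : -((s + t) • x) = G.mul (-(t • x)) (-(s • x)) := by
    rw [← neg_smul, ← neg_smul, ← neg_smul, G.mul_smul_smul]; congr 1; ring
  rw [conj, h1, ← G.mul_smul_smul]
  simp only [conj, G.mul_assoc]

theorem Ad_add_smul (s t : ℝ) (x : 𝔤) :
    G.Ad ((s + t) • x) = G.Ad (s • x) * G.Ad (t • x) := by
  have h := fderiv_comp (0 : 𝔤) (g := G.conj (s • x)) (f := G.conj (t • x))
    (G.differentiable_conj _ _) (G.differentiable_conj _ _)
  have h2 : G.conj (s • x) ∘ G.conj (t • x) = G.conj ((s + t) • x) :=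
    funext fun q => (G.conj_add_smul s t x q).symm
  rw [h2, conj_zero] at h
  exact h

/-- The derivative of `t ↦ Ad (t x)` at `0`. -/
def ad (x : 𝔤) : 𝔤 →L[ℝ] 𝔤 := deriv (fun t : ℝ => G.Ad (t • x)) 0

theorem hasDerivAt_Ad_zero (x : 𝔤) : HasDerivAt (fun t : ℝ => G.Ad (t • x)) (G.ad x) 0 := by
  have : ContDiff ℝ ∞ (fun t : ℝ => G.Ad (t • x)) :=
    G.contDiff_Ad.comp (contDiff_id.smul contDiff_const)
  exact (this.differentiable (by simp) 0).hasDerivAt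

theorem hasDerivAt_Ad (x : 𝔤) (t : ℝ) :
    HasDerivAt (fun t : ℝ => G.Ad (t • x)) (G.ad x * G.Ad (t • x)) t := by
  have h1 : HasDerivAt (fun s : ℝ => G.Ad ((s - t) • x) * G.Ad (t • x))
      (G.ad x * G.Ad (t • x)) t := by
    have h2 : HasDerivAt (fun s : ℝ => G.Ad ((s - t) • x)) (G.ad x) t := by
      have := G.hasDerivAt_Ad_zero x
      rw [← sub_self t] at this
      exact HasDerivAt.comp_sub_const t t this
    exact h2.mul_const _
  refine h1.congr_of_eventuallyEq (Filter.Eventually.of_forall fun s => ?_)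
  simp only [← G.Ad_add_smul]
  congr 2; ring

theorem ad_commute_Ad (x : 𝔤) (t : ℝ) : Commute (G.ad x) (G.Ad (t • x)) := by
  have h1 := (G.hasDerivAt_Ad_zero x).mul_const (G.Ad (t • x))
  have h2 := (G.hasDerivAt_Ad_zero x).const_mul (G.Ad (t • x))
  refine h1.unique (h2.congr_of_eventuallyEq (Filter.Eventually.of_forall fun s => ?_))
  simp only [← G.Ad_add_smul, add_comm]

/-- The translate to the identity of the differential of `z ↦ exp (t z)` at `x`. -/
def expDiff (x : 𝔤) (t : ℝ) : 𝔤 →L[ℝ] 𝔤 := t • fderiv ℝ (G.mul (-(t • x))) (t • x)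

theorem expDiff_one (x : 𝔤) : G.expDiff x 1 = fderiv ℝ (G.mul (-x)) x := by
  simp [expDiff]

theorem hasFDerivAt_expDiff (x : 𝔤) (t : ℝ) :
    HasFDerivAt (fun z => G.mul (-(t • x)) (t • z)) (G.expDiff x t) x := by
  have h1 : HasFDerivAt (fun z : 𝔤 => t • z) (t • ContinuousLinearMap.id ℝ 𝔤) x :=
    (hasFDerivAt_id x).const_smul t
  have h2 := (G.differentiable_mul_left (-(t • x)) (t • x)).hasFDerivAt
  refine (h2.comp x h1).congr_fderiv ?_
  ext v; simp [expDiff]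

/-- A cocycle identity. The element exp(−(t+τ)x) exp((t+τ)z) is the conjugate of exp(−tx) exp(tz) by
exp(−τx), times exp(−τx) exp(τz). At z = x both factors are the identity, where the differential of
multiplication is addition. -/
theorem expDiff_add (x : 𝔤) (t τ : ℝ) :
    G.expDiff x (t + τ) = G.Ad (-(τ • x)) * G.expDiff x t + G.expDiff x τ := by
  have key : ∀ z, G.mul (-((t + τ) • x)) ((t + τ) • z)
      = G.mul (G.conj (-(τ • x)) (G.mul (-(t • x)) (t • z))) (G.mul (-(τ • x)) (τ • z)) := by
    intro z
    have h1 : -((t + τ) • x) = G.mul (-(τ • x)) (-(t • x)) := by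
      rw [← neg_smul, ← neg_smul, ← neg_smul, G.mul_smul_smul]; congr 1; ring
    rw [h1, ← G.mul_smul_smul, conj, neg_neg]
    simp only [G.mul_assoc]
    rw [G.mul_neg_cancel_left]
  have h0 : G.mul (-(t • x)) (t • x) = 0 := G.neg_mul_self _
  have h0' : G.mul (-(τ • x)) (τ • x) = 0 := G.neg_mul_self _
  have hc : HasFDerivAt (G.conj (-(τ • x))) (G.Ad (-(τ • x)))
      ((fun z => G.mul (-(t • x)) (t • z)) x) := by
    simp only [h0]
    exact (G.differentiable_conj _ _).hasFDerivAt
  have h1 := hc.comp x (G.hasFDerivAt_expDiff x t)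
  have h2 := h1.prodMk (G.hasFDerivAt_expDiff x τ)
  have hm := G.hasFDerivAt_mul_zero
  have h3 := HasFDerivAt.comp (g := fun p : 𝔤 × 𝔤 => G.mul p.1 p.2) x (by
    simp only [Function.comp_apply, h0, h0', conj_zero]
    exact hm) h2
  refine (G.hasFDerivAt_expDiff x (t + τ)).unique ?_
  refine (h3.congr_of_eventuallyEq (Filter.Eventually.of_forall fun z => ?_)).congr_fderiv ?_
  · exact key z
  · ext v; simp

theorem expDiff_zero (x : 𝔤) : G.expDiff x 0 = 0 := by simp [expDiff]

theorem hasDerivAt_expDiff_zero (x : 𝔤) : HasDerivAt (G.expDiff x) 1 0 := by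
  have hM : ContDiff ℝ ∞ (fun t : ℝ => fderiv ℝ (G.mul (-(t • x))) (t • x)) :=
    G.contDiff_toLie.comp (f := fun t : ℝ => t • x) (contDiff_id.smul contDiff_const)
  have h := (hasDerivAt_id (0 : ℝ)).smul (hM.differentiable (by simp) 0).hasDerivAt
  refine h.congr_deriv ?_
  have : G.mul 0 = id := funext G.zero_mul
  simp [this, fderiv_id]; rfl

/-- The cocycle identity reduces the derivative at τ to the one at 0. With the value 0 at t = 0 this
is the classical formula expDiff(t) = ∫₀ᵗ Ad(−sx) ds. -/
theorem hasDerivAt_expDiff (x : 𝔤) (τ : ℝ) :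
    HasDerivAt (G.expDiff x) (G.Ad (-(τ • x))) τ := by
  have h1 : HasDerivAt (fun s : ℝ => G.Ad (-(τ • x)) * G.expDiff x (s - τ) + G.expDiff x τ)
      (G.Ad (-(τ • x)) * 1) τ := by
    have h2 : HasDerivAt (fun s : ℝ => G.expDiff x (s - τ)) 1 τ := by
      have := G.hasDerivAt_expDiff_zero x
      rw [← sub_self τ] at this
      exact HasDerivAt.comp_sub_const τ τ this
    exact (h2.const_mul _).add_const _
  rw [mul_one] at h1
  refine h1.congr_of_eventuallyEq (Filter.Eventually.of_forall fun s => ?_)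
  simp only [← G.expDiff_add, sub_add_cancel]

/-- The commutator a f − f a has zero derivative and vanishes at 0. -/
theorem commute_of_hasDerivAt {R : Type*} [NormedRing R] [NormedAlgebra ℝ R] {f f' : ℝ → R}
    {a : R} (hf : ∀ t, HasDerivAt f (f' t) t) (hf' : ∀ t, Commute a (f' t))
    (h0 : Commute a (f 0)) (t : ℝ) : Commute a (f t) := by
  have hd : ∀ t, HasDerivAt (fun t => a * f t - f t * a) 0 t := fun t => by
    have := ((hf t).const_mul a).sub ((hf t).mul_const a)
    rwa [(hf' t).eq, sub_self] at this
  have := is_const_of_deriv_eq_zero (fun t => (hd t).differentiableAt) (fun t => (hd t).deriv) t 0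
  rw [h0.eq, sub_self, sub_eq_zero] at this
  exact this

theorem ad_commute_expDiff (x : 𝔤) (t : ℝ) : Commute (G.ad x) (G.expDiff x t) :=
  commute_of_hasDerivAt (G.hasDerivAt_expDiff x)
    (fun t => by rw [← neg_smul]; exact G.ad_commute_Ad x (-t))
    (by rw [expDiff_zero]; exact Commute.zero_right _) t

/-- The function Ad(−tx) + ad x · expDiff(t) has zero derivative and equals 1 at t = 0. This plays
the role of the exponential series: it exhibits Ad as 1 minus a multiple of ad x. -/
theorem Ad_neg_eq (x : 𝔤) (t : ℝ) : G.Ad (-(t • x)) = 1 - G.ad x * G.expDiff x t := by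
  have hd : ∀ t, HasDerivAt (fun t : ℝ => G.Ad (-(t • x)) + G.ad x * G.expDiff x t) 0 t := by
    intro t
    have h1 : HasDerivAt (fun t : ℝ => G.Ad ((-t) • x)) (-(G.ad x * G.Ad ((-t) • x))) t := by
      refine ((G.hasDerivAt_Ad x (-t)).scomp t (hasDerivAt_neg t)).congr_deriv ?_
      simp
    simp only [neg_smul] at h1
    have := h1.add ((G.hasDerivAt_expDiff x t).const_mul (G.ad x))
    rwa [neg_add_cancel] at this
  have := is_const_of_deriv_eq_zero (fun t => (hd t).differentiableAt) (fun t => (hd t).deriv) t 0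
  rw [zero_smul, neg_zero, Ad_zero, expDiff_zero, MulZeroClass.mul_zero, add_zero] at this
  exact eq_sub_of_add_eq this

/-- Both sides are read off the second derivative Q of the multiplication at the origin.
Differentiate d(L_{tx}) w = d(R_{tx}) Ad(tx) w at t = 0: this gives Q(x,0)(0,w) = Q(0,x)(w,0) + ad x
w. By symmetry of Q the middle term is Q(w,0)(0,x), and the bracket is Q(x,0)(0,w) − Q(w,0)(0,x). -/
theorem ad_apply (x w : 𝔤) : G.ad x w = G.bracket x w := by
  set f : 𝔤 × 𝔤 → 𝔤 := fun p => G.mul p.1 p.2 with hf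
  have hfd : ContDiff ℝ 1 (fderiv ℝ f) := G.contDiff_mul.fderiv_right (m := 1)
    two_le_contDiff_infty
  have hsymm : IsSymmSndFDerivAt ℝ f 0 :=
    (G.contDiff_mul.contDiffAt.of_le two_le_contDiff_infty).isSymmSndFDerivAt (by simp)
  have hleft : ∀ p v, G.leftField v p = fderiv ℝ f (p, 0) (0, v) := fun p v => by
    have := HasFDerivAt.comp (g := f) (f := fun q : 𝔤 => (p, q)) 0
      (G.differentiable_mul (p, 0)).hasFDerivAt (hasFDerivAt_prodMk_right p 0)
    have h2 : fderiv ℝ (G.mul p) 0 = _ := this.fderiv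
    rw [leftField, h2]; simp [hf]
  have hright : ∀ p v, fderiv ℝ (fun z => G.mul z p) 0 v = fderiv ℝ f (0, p) (v, 0) := fun p v => by
    have := HasFDerivAt.comp (g := f) (f := fun q : 𝔤 => (q, p)) 0
      (G.differentiable_mul (0, p)).hasFDerivAt (hasFDerivAt_prodMk_left 0 p)
    have h2 : fderiv ℝ (fun z => G.mul z p) 0 = _ := this.fderiv
    rw [h2]; simp [hf]
  have hQ := (hfd.differentiable (by simp) 0).hasFDerivAt
  set Q := fderiv ℝ (fderiv ℝ f) 0 with hQdef
  have hdl : ∀ v y, fderiv ℝ (G.leftField v) 0 y = Q (y, 0) (0, v) := fun v y => by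
    have h0 : HasFDerivAt (fun p : 𝔤 => (p, (0 : 𝔤))) (ContinuousLinearMap.inl ℝ 𝔤 𝔤) 0 :=
      hasFDerivAt_prodMk_left 0 0
    have h1 := HasFDerivAt.comp (g := fderiv ℝ f) (0 : 𝔤) hQ h0
    have h2 := h1.clm_apply (hasFDerivAt_const ((0 : 𝔤), v) (0 : 𝔤))
    have h3 : G.leftField v = fun p => (fderiv ℝ f ∘ fun p : 𝔤 => (p, (0 : 𝔤))) p (0, v) :=
      funext fun p => hleft p v
    rw [h3, h2.fderiv]; simp
  have hL : HasDerivAt (fun t : ℝ => G.leftField w (t • x)) (Q (x, 0) (0, w)) 0 := by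
    rw [← hdl]
    have h1 : HasDerivAt (fun t : ℝ => t • x) x 0 := by
      simpa using (hasDerivAt_id (0 : ℝ)).smul_const x
    refine HasFDerivAt.comp_hasDerivAt (l := G.leftField w) 0 (f := fun t : ℝ => t • x) ?_ h1
    rw [zero_smul]; exact (G.differentiable_leftField w 0).hasFDerivAt
  have hR : HasDerivAt (fun t : ℝ => fderiv ℝ f (0, t • x) (G.Ad (t • x) w, 0))
      (Q (0, x) (w, 0) + G.ad x w) 0 := by
    have h1 : HasDerivAt (fun t : ℝ => ((0 : 𝔤), t • x)) ((0 : 𝔤), x) 0 :=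
      (hasDerivAt_const _ _).prodMk (by simpa using (hasDerivAt_id (0 : ℝ)).smul_const x)
    have h2 : HasDerivAt (fun t : ℝ => fderiv ℝ f (0, t • x)) (Q (0, x)) 0 := by
      refine HasFDerivAt.comp_hasDerivAt (l := fderiv ℝ f) 0 (f := fun t : ℝ => ((0 : 𝔤), t • x)) ?_ h1
      rw [zero_smul]; exact hQ
    have h3 : HasDerivAt (fun t : ℝ => (G.Ad (t • x) w, (0 : 𝔤))) (G.ad x w, (0 : 𝔤)) 0 := by
      refine HasDerivAt.prodMk ?_ (hasDerivAt_const _ _)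
      have := (G.hasDerivAt_Ad_zero x).clm_apply (hasDerivAt_const 0 w)
      simpa using this
    have h4 := h2.clm_apply h3
    have h5 : fderiv ℝ f (0, (0 : 𝔤)) = _ := G.hasFDerivAt_mul_zero.fderiv
    rw [zero_smul, Ad_zero, h5] at h4
    simpa using h4
  have hEq : ∀ t : ℝ, G.leftField w (t • x) = fderiv ℝ f (0, t • x) (G.Ad (t • x) w, 0) := by
    intro t
    rw [← hright]
    have h := fderiv_comp (0 : 𝔤) (g := fun z => G.mul z (t • x)) (f := G.conj (t • x))
      (G.differentiable_mul_right _ _) (G.differentiable_conj _ _)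
    have h2 : (fun z => G.mul z (t • x)) ∘ G.conj (t • x) = G.mul (t • x) :=
      funext fun q => by simp [conj, neg_mul_cancel_right]
    rw [h2, conj_zero] at h
    exact DFunLike.congr_fun h w
  have h6 := hL.unique (hR.congr_of_eventuallyEq (Filter.Eventually.of_forall hEq))
  rw [bracket, VectorField.lieBracket, leftField_zero, leftField_zero, hdl, hdl, h6,
    hsymm.eq (0, x) (w, 0)]
  abel

end Adjoint

section Unipotent

variable {𝔤 : Type*} [NormedAddCommGroup 𝔤] [InnerProductSpace ℝ 𝔤] [FiniteDimensional ℝ 𝔤]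
  (G : ExpLieGroup 𝔤)

theorem det_Ad_of_isNilpotent {x : 𝔤} (h : IsNilpotent (G.ad x)) : (G.Ad (-x)).det = 1 := by
  have := G.Ad_neg_eq x 1
  rw [one_smul] at this
  rw [this]
  exact ContinuousLinearMap.det_one_sub_of_isNilpotent
    ((G.ad_commute_expDiff x 1).isNilpotent_mul_right h)

/-- Integrating the formula for Ad gives expDiff(1) = 1 − ad x · J with J = ∫₀¹ expDiff. Since J
commutes with ad x, the product is nilpotent. -/
theorem det_toLie_of_isNilpotent {x : 𝔤} (h : IsNilpotent (G.ad x)) :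
    (fderiv ℝ (G.mul (-x)) x).det = 1 := by
  have hc : Continuous (G.expDiff x) :=
    continuous_iff_continuousAt.2 fun t => (G.hasDerivAt_expDiff x t).continuousAt
  set J : ℝ → 𝔤 →L[ℝ] 𝔤 := fun t => ∫ s in (0 : ℝ)..t, G.expDiff x s with hJ
  have hJd : ∀ t, HasDerivAt J (G.expDiff x t) t := fun t =>
    intervalIntegral.integral_hasDerivAt_right (hc.intervalIntegrable _ _)
      (hc.stronglyMeasurableAtFilter _ _) hc.continuousAt
  have hJc : Commute (G.ad x) (J 1) :=
    commute_of_hasDerivAt hJd (G.ad_commute_expDiff x) (by simp [hJ]) 1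
  have hd : ∀ t, HasDerivAt (fun t : ℝ => G.expDiff x t - (t • 1 - G.ad x * J t)) 0 t := by
    intro t
    have h1 := (G.hasDerivAt_expDiff x t).sub
      (((hasDerivAt_id t).smul_const (1 : 𝔤 →L[ℝ] 𝔤)).sub ((hJd t).const_mul (G.ad x)))
    rwa [one_smul, ← Ad_neg_eq, sub_self] at h1
  have := is_const_of_deriv_eq_zero (fun t => (hd t).differentiableAt) (fun t => (hd t).deriv) 1 0
  simp only [expDiff_zero, expDiff_one, hJ, one_smul, zero_smul, intervalIntegral.integral_same,
    MulZeroClass.mul_zero, sub_zero] at this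
  rw [sub_eq_zero.1 this]
  exact ContinuousLinearMap.det_one_sub_of_isNilpotent (hJc.isNilpotent_mul_right h)

end Unipotent

end ExpLieGroup

namespace ExpLieGroup

variable {𝔤 : Type*} [NormedAddCommGroup 𝔤] [InnerProductSpace ℝ 𝔤] (G : ExpLieGroup 𝔤)

/-- The flow property p·(sξ) = (p·tξ)·((s−t)ξ) moves a derivative at time t to a derivative at time
0 with a new base point. -/
theorem hasDerivAt_mul_smul_of_forall {h : 𝔤 → ℝ} {ξ : 𝔤} {p : 𝔤} {t : ℝ}
    (hd : DifferentiableAt ℝ (fun s : ℝ => h (G.mul (G.mul p (t • ξ)) (s • ξ))) 0) :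
    HasDerivAt (fun s : ℝ => h (G.mul p (s • ξ))) (G.lieDeriv ξ h (G.mul p (t • ξ))) t := by
  have h1 := hd.hasDerivAt
  rw [← sub_self t] at h1
  have h2 := HasDerivAt.comp_sub_const t t h1
  rw [sub_self] at h2
  refine h2.congr_of_eventuallyEq (Filter.Eventually.of_forall fun s => ?_)
  simp only [G.mul_assoc, G.mul_smul_smul, add_sub_cancel]

theorem lieDeriv_mul {f g : 𝔤 → ℝ} {p ξ : 𝔤}
    (hf : DifferentiableAt ℝ (fun t : ℝ => f (G.mul p (t • ξ))) 0)
    (hg : DifferentiableAt ℝ (fun t : ℝ => g (G.mul p (t • ξ))) 0) :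
    G.lieDeriv ξ (fun q => f q * g q) p = G.lieDeriv ξ f p * g p + f p * G.lieDeriv ξ g p := by
  have := deriv_mul hf hg
  simp only [zero_smul, G.mul_zero] at this
  exact this

end ExpLieGroup

/-! ### The grading and unimodularity -/

namespace CarnotGroup

section Layers

variable {𝔤 : Type*} [NormedAddCommGroup 𝔤] [InnerProductSpace ℝ 𝔤] (G : CarnotGroup 𝔤)

theorem bracket_zero_left (η : 𝔤) : G.bracket 0 η = 0 := by
  simpa using G.bracket_smul_left 0 0 η

theorem bracket_zero_right (η : 𝔤) : G.bracket η 0 = 0 := by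
  simpa using G.bracket_smul_right 0 η 0

theorem bracket_mem_layer_one_add {j : ℕ} {ξ η : 𝔤} (hξ : ξ ∈ G.layer 1) (hη : η ∈ G.layer j) :
    G.bracket ξ η ∈ G.layer (j + 1) := by
  rcases Nat.eq_zero_or_pos j with rfl | hj
  · rw [G.layer_zero, Submodule.mem_bot] at hη
    rw [hη, bracket_zero_right]; exact zero_mem _
  · rw [← G.bracket_layer j hj]
    exact Submodule.subset_span ⟨ξ, hξ, η, hη, rfl⟩

/-- The sum of the layers of index at least `k`. -/
def tailLayers (k : ℕ) : Submodule ℝ 𝔤 := ⨆ j, ⨆ (_ : k ≤ j), G.layer j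

theorem layer_le_tailLayers {k j : ℕ} (h : k ≤ j) : G.layer j ≤ G.tailLayers k :=
  le_iSup₂_of_le j h le_rfl

end Layers

section Grading

variable {𝔤 : Type*} [NormedAddCommGroup 𝔤] [InnerProductSpace ℝ 𝔤] [FiniteDimensional ℝ 𝔤]
  (G : CarnotGroup 𝔤)

/-- Induction on i. As V_{i+1} is spanned by brackets [a,b] with a ∈ V_1 and b ∈ V_i, Jacobi
rewrites [[a,b],η] as [a,[b,η]] − [b,[a,η]], and both terms fall under the induction hypothesis or
the defining relation for V_1. -/
theorem bracket_mem_layer {i j : ℕ} {ξ η : 𝔤} (hξ : ξ ∈ G.layer i) (hη : η ∈ G.layer j) :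
    G.bracket ξ η ∈ G.layer (i + j) := by
  induction i generalizing ξ η j with
  | zero =>
    rw [G.layer_zero, Submodule.mem_bot] at hξ
    rw [hξ, bracket_zero_left]; exact zero_mem _
  | succ i ih =>
    rcases Nat.eq_zero_or_pos i with rfl | hi
    · rw [add_comm]; exact G.bracket_mem_layer_one_add (by simpa using hξ) hη
    · rw [← G.bracket_layer i hi] at hξ
      induction hξ using Submodule.span_induction with
      | mem x hx =>
        obtain ⟨a, ha, b, hb, rfl⟩ := hx
        have hj := G.bracket_jacobi a b η
        rw [eq_sub_of_add_eq hj.symm]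
        refine Submodule.sub_mem _ ?_ ?_
        · have := G.bracket_mem_layer_one_add ha (ih hb hη)
          rwa [add_right_comm] at this
        · have := ih hb (G.bracket_mem_layer_one_add ha hη)
          rwa [← add_assoc, add_right_comm] at this
      | zero => rw [bracket_zero_left]; exact zero_mem _
      | add x y _ _ hx hy => rw [G.bracket_add_left]; exact add_mem hx hy
      | smul c x _ hx => rw [G.bracket_smul_left]; exact Submodule.smul_mem _ _ hx

theorem bracket_mem_tailLayers {k : ℕ} (ξ : 𝔤) {η : 𝔤} (hη : η ∈ G.tailLayers k) :
    G.bracket ξ η ∈ G.tailLayers (k + 1) := by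
  have hle : G.tailLayers k ≤ (G.tailLayers (k + 1)).comap (G.bracketₗ ξ) := by
    refine iSup₂_le fun j hj η hη => ?_
    have hξ : ξ ∈ (⨆ j, G.layer j) := by rw [G.iSup_layer]; trivial
    have hle' : (⨆ i, G.layer i) ≤ (G.tailLayers (k + 1)).comap (G.bracketₗ.flip η) := by
      refine iSup_le fun i ξ hξ => ?_
      rcases Nat.eq_zero_or_pos i with rfl | hi
      · rw [G.layer_zero, Submodule.mem_bot] at hξ
        rw [hξ]; exact zero_mem _
      · exact G.layer_le_tailLayers (by omega) (G.bracket_mem_layer hξ hη)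
    exact hle' hξ
  exact hle hη

/-- Each application of ad x raises the least layer index by at least one, and no layers remain
beyond the step. -/
theorem isNilpotent_ad (x : 𝔤) : IsNilpotent (G.ad x) := by
  refine ⟨G.step + 1, ?_⟩
  have h : ∀ n v, (G.ad x ^ n) v ∈ G.tailLayers n := by
    intro n
    induction n with
    | zero =>
      intro v
      have : v ∈ (⨆ j, G.layer j) := by rw [G.iSup_layer]; trivial
      exact (iSup_le fun j => G.layer_le_tailLayers (Nat.zero_le j)) this
    | succ n ih =>
      intro v
      rw [pow_succ', mul_apply_eq_comp, G.ad_apply]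
      exact G.bracket_mem_tailLayers x (ih v)
  have hbot : G.tailLayers (G.step + 1) = ⊥ := by
    rw [eq_bot_iff]
    exact iSup₂_le fun j hj => (G.layer_of_step_lt j hj).le
  ext v
  have := h (G.step + 1) v
  rw [hbot, Submodule.mem_bot] at this
  simpa using this

theorem det_toLie (p : 𝔤) : (fderiv ℝ (G.mul (-p)) p).det = 1 :=
  G.det_toLie_of_isNilpotent (G.isNilpotent_ad p)

theorem det_fderiv_mul (p : 𝔤) : (fderiv ℝ (G.mul p) 0).det = 1 := by
  have h := congrArg ContinuousLinearMap.det (G.toLie_comp_fderiv_mul p)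
  rw [ContinuousLinearMap.det, ContinuousLinearMap.toLinearMap_comp, LinearMap.det_comp] at h
  have h1 := G.det_toLie p
  rw [ContinuousLinearMap.det] at h1
  rw [h1, one_mul] at h
  rw [ContinuousLinearMap.det, h]
  exact LinearMap.det_id

/-- Left and right translations commute, so left translations carry the differential of R_q at p
back to the identity; there R_q = L_q ∘ conj(−q). All factors that occur have determinant 1. -/
theorem det_fderiv_mul_right (p q : 𝔤) : (fderiv ℝ (fun z => G.mul z q) p).det = 1 := by
  have e1 : (fderiv ℝ (fun z => G.mul z q) p).comp (fderiv ℝ (G.mul p) 0)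
      = (fderiv ℝ (G.mul p) q).comp (fderiv ℝ (fun z => G.mul z q) 0) := by
    have h1 := fderiv_comp (0 : 𝔤) (g := fun z => G.mul z q) (f := G.mul p)
      (G.differentiable_mul_right _ _) (G.differentiable_mul_left _ _)
    have h2 := fderiv_comp (0 : 𝔤) (g := G.mul p) (f := fun z => G.mul z q)
      (G.differentiable_mul_left _ _) (G.differentiable_mul_right _ _)
    have h3 : (fun z => G.mul z q) ∘ G.mul p = G.mul p ∘ fun z => G.mul z q :=
      funext fun z => G.mul_assoc p z q
    rw [G.mul_zero] at h1
    rw [G.zero_mul] at h2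
    rw [← h1, ← h2, h3]
  have e2 : fderiv ℝ (fun z => G.mul z q) 0 = (fderiv ℝ (G.mul q) 0).comp (G.Ad (-q)) := by
    have h1 := fderiv_comp (0 : 𝔤) (g := G.mul q) (f := G.conj (-q))
      (G.differentiable_mul_left _ _) (G.differentiable_conj _ _)
    have h2 : G.mul q ∘ G.conj (-q) = fun z => G.mul z q := by
      ext z
      simp only [Function.comp_apply, ExpLieGroup.conj, neg_neg, G.mul_assoc,
        G.mul_neg_cancel_left]
    rw [h2, G.conj_zero] at h1
    exact h1
  have e3 : (fderiv ℝ (G.mul p) q).comp (fderiv ℝ (G.mul q) 0)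
      = fderiv ℝ (G.mul (G.mul p q)) 0 :=
    ContinuousLinearMap.ext fun ξ => G.fderiv_mul_left_leftField p q ξ
  rw [e2, ← ContinuousLinearMap.comp_assoc, e3] at e1
  have h := congrArg (fun L : 𝔤 →L[ℝ] 𝔤 => LinearMap.det (L : 𝔤 →ₗ[ℝ] 𝔤)) e1
  simp only [ContinuousLinearMap.toLinearMap_comp, LinearMap.det_comp] at h
  have d1 := G.det_fderiv_mul p
  have d2 := G.det_fderiv_mul (G.mul p q)
  have d3 := G.det_Ad_of_isNilpotent (G.isNilpotent_ad q)
  rw [ContinuousLinearMap.det] at d1 d2 d3 ⊢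
  rw [d1, d2, d3] at h
  simpa using h

end Grading

/-! ### Right invariance of Lebesgue measure and integration by parts -/

section Integration

variable {𝔤 : Type*} [NormedAddCommGroup 𝔤] [InnerProductSpace ℝ 𝔤] [FiniteDimensional ℝ 𝔤]
  [MeasurableSpace 𝔤] [BorelSpace 𝔤] (G : CarnotGroup 𝔤)

theorem measurePreserving_mul_right (q : 𝔤) :
    MeasurePreserving (fun p => G.mul p q) (volume : Measure 𝔤) volume := by
  have hc : Continuous fun p => G.mul p q := (G.contDiff_mul_right q).continuous
  refine ⟨hc.measurable, ?_⟩
  have hinj : InjOn (fun p => G.mul p q) univ := fun a _ b _ hab => by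
    have := congrArg (fun z => G.mul z (-q)) hab
    simpa [G.mul_neg_cancel_right] using this
  have h := map_withDensity_abs_det_fderiv_eq_addHaar (volume : Measure 𝔤) nullMeasurableSet_univ
    (f' := fun p => fderiv ℝ (fun z => G.mul z q) p)
    (fun p _ => (G.differentiable_mul_right q p).hasFDerivAt.hasFDerivWithinAt) hinj
  have hsurj : (fun p => G.mul p q) '' univ = univ :=
    eq_univ_of_forall fun z => ⟨G.mul z (-q), trivial, G.neg_mul_cancel_right q z⟩
  rw [hsurj, Measure.restrict_univ] at h
  simpa [G.det_fderiv_mul_right] using h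

/-- By right invariance ∫ h(p·tξ) dp does not depend on t; differentiate at t = 0 under the integral
sign. -/
theorem integral_lieDeriv_eq_zero {ξ : 𝔤} {h : 𝔤 → ℝ} (hc : Continuous h)
    (hs : HasCompactSupport h)
    (hd : ∀ p, DifferentiableAt ℝ (fun t : ℝ => h (G.mul p (t • ξ))) 0)
    (hk : Continuous (G.lieDeriv ξ h)) : ∫ p, G.lieDeriv ξ h p = 0 := by
  have hks : ∀ p, p ∉ tsupport h → G.lieDeriv ξ h p = 0 := fun p hp => by
    rw [G.lieDeriv_congr (notMem_tsupport_iff_eventuallyEq.1 hp) ξ]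
    simp [ExpLieGroup.lieDeriv]
  have hksupp : HasCompactSupport (G.lieDeriv ξ h) := HasCompactSupport.intro hs hks
  obtain ⟨M, hM⟩ := hksupp.exists_bound_of_continuous hk
  -- A compact set containing every p whose orbit p·tξ meets the support for some |t| < 1. The
  -- dominating function is a constant on it.
  set K : Set 𝔤 := (fun z : 𝔤 × ℝ => G.mul z.1 ((-z.2) • ξ)) '' (tsupport h ×ˢ Icc (-1) 1) with hKdef
  have hK : IsCompact K := by
    refine (hs.isCompact.prod isCompact_Icc).image ?_
    exact G.continuous_mul.comp (continuous_fst.prodMk (continuous_snd.neg.smul continuous_const))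
  have hmem : ∀ p, ∀ t ∈ Metric.ball (0 : ℝ) 1, G.mul p (t • ξ) ∈ tsupport h → p ∈ K := by
    intro p t ht hp
    refine ⟨(G.mul p (t • ξ), t), ⟨hp, ?_⟩, ?_⟩
    · rw [Metric.mem_ball, dist_zero_right, Real.norm_eq_abs, abs_lt] at ht
      exact ⟨ht.1.le, ht.2.le⟩
    · simp only [neg_smul]; exact G.mul_neg_cancel_right _ _
  have hconst : ∀ t : ℝ, ∫ p, h (G.mul p (t • ξ)) = ∫ p, h p := fun t => by
    have hmp := G.measurePreserving_mul_right (t • ξ)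
    rw [← integral_map hmp.measurable.aemeasurable
      (by rw [hmp.map_eq]; exact hc.aestronglyMeasurable), hmp.map_eq]
  have hcomp : ∀ t : ℝ, Continuous fun p => h (G.mul p (t • ξ)) := fun t =>
    hc.comp (G.contDiff_mul_right _).continuous
  have hD := hasDerivAt_integral_of_dominated_loc_of_deriv_le (μ := (volume : Measure 𝔤))
    (F := fun (t : ℝ) p => h (G.mul p (t • ξ)))
    (F' := fun (t : ℝ) p => G.lieDeriv ξ h (G.mul p (t • ξ))) (x₀ := (0 : ℝ))
    (s := Metric.ball 0 1) (bound := K.indicator fun _ => M)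
    (Metric.ball_mem_nhds 0 one_pos)
    (Filter.Eventually.of_forall fun t => (hcomp t).aestronglyMeasurable)
    (by simpa [G.mul_zero] using hc.integrable_of_hasCompactSupport hs)
    (by simpa [G.mul_zero] using hk.aestronglyMeasurable)
    (Filter.Eventually.of_forall fun p t ht => by
      by_cases hp : G.mul p (t • ξ) ∈ tsupport h
      · rw [indicator_of_mem (hmem p t ht hp)]; exact hM _
      · rw [hks _ hp, norm_zero]
        exact indicator_nonneg (fun _ _ => (norm_nonneg _).trans (hM 0)) _)
    ((integrable_indicator_iff hK.measurableSet).2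
      (integrableOn_const hK.measure_lt_top.ne))
    (Filter.Eventually.of_forall fun p t _ => G.hasDerivAt_mul_smul_of_forall (hd _))
  have h2 := hD.2
  simp only [hconst, zero_smul, G.mul_zero] at h2
  exact h2.unique (hasDerivAt_const _ _)

/-- Integration by parts along a left-invariant vector field. -/
theorem integral_lieDeriv_mul_add {ξ : 𝔤} {Ω : Set 𝔤} (hΩ : IsOpen Ω) {F χ : 𝔤 → ℝ}
    (hF : ContinuousOn F Ω)
    (hd : ∀ p ∈ Ω, DifferentiableAt ℝ (fun t : ℝ => F (G.mul p (t • ξ))) 0)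
    (hXF : ContinuousOn (G.lieDeriv ξ F) Ω) (hχ : ContDiff ℝ 1 χ) (hs : HasCompactSupport χ)
    (hsΩ : tsupport χ ⊆ Ω) :
    ∫ p in Ω, (G.lieDeriv ξ F p * χ p + F p * fderiv ℝ χ p (G.leftField ξ p)) = 0 := by
  set k : 𝔤 → ℝ := fun p => G.lieDeriv ξ F p * χ p + F p * fderiv ℝ χ p (G.leftField ξ p) with hk
  have hχd : Differentiable ℝ χ := hχ.differentiable (by simp)
  have hχt : ∀ p, DifferentiableAt ℝ (fun t : ℝ => χ (G.mul p (t • ξ))) 0 := fun p =>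
    ((hχd p).hasFDerivAt.hasDerivAt_mul_smul G.toExpLieGroup ξ).differentiableAt
  have hoff : ∀ p, p ∉ tsupport χ → (fun q => F q * χ q) =ᶠ[𝓝 p] fun _ => 0 := fun p hp => by
    filter_upwards [notMem_tsupport_iff_eventuallyEq.1 hp] with q hq
    simp [hq]
  have hon : ∀ p ∈ Ω, G.lieDeriv ξ (fun q => F q * χ q) p = k p := fun p hp => by
    rw [G.lieDeriv_mul (hd p hp) (hχt p), G.lieDeriv_eq_fderiv (hχd p)]
  have hkoff : ∀ p, p ∉ tsupport χ → k =ᶠ[𝓝 p] fun _ => 0 := fun p hp => by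
    have h1 := notMem_tsupport_iff_eventuallyEq.1 hp
    filter_upwards [h1, h1.eventuallyEq_nhds] with q hq hq'
    have h3 : fderiv ℝ χ q = 0 := by
      rw [Filter.EventuallyEq.fderiv_eq hq']; simp
    simp only [hk, hq, h3]
    simp
  have hkeq : G.lieDeriv ξ (fun q => F q * χ q) = k := by
    ext p
    by_cases hp : p ∈ tsupport χ
    · exact hon p (hsΩ hp)
    · rw [G.lieDeriv_congr (hoff p hp) ξ, (hkoff p hp).eq_of_nhds]
      simp [ExpLieGroup.lieDeriv]
  have hfc : Continuous fun p => fderiv ℝ χ p (G.leftField ξ p) :=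
    (hχ.continuous_fderiv (by simp)).clm_apply (G.contDiff_leftField ξ).continuous
  have hkc : Continuous k := by
    rw [continuous_iff_continuousAt]
    intro p
    by_cases hp : p ∈ tsupport χ
    · have hN := hΩ.mem_nhds (hsΩ hp)
      exact ((hXF.continuousAt hN).mul hχ.continuous.continuousAt).add
        ((hF.continuousAt hN).mul hfc.continuousAt)
    · exact continuousAt_const.congr (hkoff p hp).symm
  have hFc : Continuous fun q => F q * χ q := by
    rw [continuous_iff_continuousAt]
    intro p
    by_cases hp : p ∈ tsupport χ
    · exact (hF.continuousAt (hΩ.mem_nhds (hsΩ hp))).mul hχ.continuous.continuousAt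
    · exact continuousAt_const.congr (hoff p hp).symm
  have h0 := G.integral_lieDeriv_eq_zero (ξ := ξ) hFc hs.mul_left (fun p => by
      by_cases hp : p ∈ tsupport χ
      · exact (hd p (hsΩ hp)).mul (hχt p)
      · exact G.differentiableAt_mul_smul_congr (hoff p hp).symm (differentiableAt_const _))
    (by rw [hkeq]; exact hkc)
  rw [hkeq] at h0
  rw [setIntegral_eq_integral_of_forall_compl_eq_zero, h0]
  intro p hp
  exact (hkoff p fun h => hp (hsΩ h)).eq_of_nhds

end Integration

end CarnotGroup

theorem ContinuousOn.continuous_mul_of_tsupport_subset {E : Type*} [TopologicalSpace E]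
    {Ω : Set E} (hΩ : IsOpen Ω) {g χ : E → ℝ} (hg : ContinuousOn g Ω) (hχ : Continuous χ)
    (hs : tsupport χ ⊆ Ω) : Continuous fun p => g p * χ p := by
  rw [continuous_iff_continuousAt]
  intro p
  by_cases hp : p ∈ tsupport χ
  · exact (hg.continuousAt (hΩ.mem_nhds (hs hp))).mul hχ.continuousAt
  · refine continuousAt_const (y := (0 : ℝ)) |>.congr ?_
    filter_upwards [notMem_tsupport_iff_eventuallyEq.1 hp] with q hq
    simp [hq]

/-! ### Commutators of left-invariant derivatives -/

namespace ExpLieGroup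

section Calculus

variable {𝔤 : Type*} [NormedAddCommGroup 𝔤] [InnerProductSpace ℝ 𝔤] (G : ExpLieGroup 𝔤)

theorem lieDeriv_eqOn {Ω : Set 𝔤} (hΩ : IsOpen Ω) {u : 𝔤 → ℝ} (hu : DifferentiableOn ℝ u Ω)
    (ξ : 𝔤) : EqOn (G.lieDeriv ξ u) (fun p => fderiv ℝ u p (G.leftField ξ p)) Ω := fun _ hp =>
  G.lieDeriv_eq_fderiv (hu.differentiableAt (hΩ.mem_nhds hp)) ξ

theorem contDiffOn_fderiv_leftField {Ω : Set 𝔤} (hΩ : IsOpen Ω) {u : 𝔤 → ℝ} {n k : ℕ∞ω}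
    (hn : n ≤ ∞) (hu : ContDiffOn ℝ k u Ω) (hk : n + 1 ≤ k) (ξ : 𝔤) :
    ContDiffOn ℝ n (fun p => fderiv ℝ u p (G.leftField ξ p)) Ω :=
  (hu.fderiv_of_isOpen hΩ hk).clm_apply ((G.contDiff_leftField ξ).of_le hn).contDiffOn

theorem contDiffOn_lieDeriv {Ω : Set 𝔤} (hΩ : IsOpen Ω) {u : 𝔤 → ℝ} {n k : ℕ∞ω}
    (hn : n ≤ ∞) (hu : ContDiffOn ℝ k u Ω) (hk : n + 1 ≤ k) (ξ : 𝔤) :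
    ContDiffOn ℝ n (G.lieDeriv ξ u) Ω := by
  have h1 : k ≠ 0 := by
    rintro rfl
    simp at hk
  exact (G.contDiffOn_fderiv_leftField hΩ hn hu hk ξ).congr
    (G.lieDeriv_eqOn hΩ (hu.differentiableOn h1) ξ)

theorem continuousOn_lieDeriv {Ω : Set 𝔤} (hΩ : IsOpen Ω) {u : 𝔤 → ℝ}
    (hu : ContDiffOn ℝ 1 u Ω) (ξ : 𝔤) : ContinuousOn (G.lieDeriv ξ u) Ω :=
  (G.contDiffOn_lieDeriv (n := 0) hΩ (by simp) hu (by simp) ξ).continuousOn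

theorem differentiableAt_mul_smul {Ω : Set 𝔤} (hΩ : IsOpen Ω) {u : 𝔤 → ℝ}
    (hu : DifferentiableOn ℝ u Ω) (ξ : 𝔤) {p : 𝔤} (hp : p ∈ Ω) :
    DifferentiableAt ℝ (fun t : ℝ => u (G.mul p (t • ξ))) 0 :=
  ((hu.differentiableAt (hΩ.mem_nhds hp)).hasFDerivAt.hasDerivAt_mul_smul G ξ).differentiableAt

theorem tsupport_fderiv_leftField_subset (χ : 𝔤 → ℝ) (ξ : 𝔤) :
    tsupport (fun p => fderiv ℝ χ p (G.leftField ξ p)) ⊆ tsupport χ := by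
  refine closure_minimal (fun p hp => ?_) (isClosed_tsupport _)
  refine (support_fderiv_subset ℝ) (fun h => hp ?_)
  simp [h]

end Calculus

section Commutator

variable {𝔤 : Type*} [NormedAddCommGroup 𝔤] [InnerProductSpace ℝ 𝔤] [FiniteDimensional ℝ 𝔤]
  (G : ExpLieGroup 𝔤)

theorem fderiv_leftField_bracket {Ω : Set 𝔤} (hΩ : IsOpen Ω) {u : 𝔤 → ℝ}
    (hu : ContDiffOn ℝ 2 u Ω) (ξ η : 𝔤) {p : 𝔤} (hp : p ∈ Ω) :
    fderiv ℝ u p (G.leftField (G.bracket ξ η) p)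
      = G.lieDeriv ξ (G.lieDeriv η u) p - G.lieDeriv η (G.lieDeriv ξ u) p := by
  have hN := hΩ.mem_nhds hp
  have hd : DifferentiableOn ℝ u Ω := hu.differentiableOn (by simp)
  have key : ∀ a b, G.lieDeriv a (G.lieDeriv b u) p
      = fderiv ℝ (fun q => fderiv ℝ u q (G.leftField b q)) p (G.leftField a p) := fun a b => by
    rw [G.lieDeriv_congr ((G.lieDeriv_eqOn hΩ hd b).eventuallyEq_of_mem hN) a]
    exact G.lieDeriv_eq_fderiv (((G.contDiffOn_fderiv_leftField (n := 1) hΩ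
      (by simp) hu (by norm_num) b).differentiableOn (by simp)).differentiableAt hN) a
  rw [key, key, ← lieBracket_leftField]
  exact VectorField.fderiv_apply_lieBracket (hu.contDiffAt hN) (by simp)
    (G.differentiable_leftField η p) (G.differentiable_leftField ξ p)

theorem comm₂_eq {Ω : Set 𝔤} (hΩ : IsOpen Ω) {u : 𝔤 → ℝ}
    (hu : ContDiffOn ℝ 2 u Ω) (ξ η : 𝔤) {p : 𝔤} (hp : p ∈ Ω) :
    G.comm₂ ξ η u p = G.lieDeriv ξ (G.lieDeriv η u) p - G.lieDeriv η (G.lieDeriv ξ u) p := by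
  rw [comm₂, lieBracket_leftField, G.fderiv_leftField_bracket hΩ hu ξ η hp]

theorem comm₃_eq_fderiv (ξ η ζ : 𝔤) (u : 𝔤 → ℝ) (p : 𝔤) :
    G.comm₃ ξ η ζ u p = fderiv ℝ u p (G.leftField (G.bracket (G.bracket ξ η) ζ) p) := by
  rw [comm₃, lieBracket_leftField, lieBracket_leftField]

end Commutator

/-- The `j`-th component of the horizontal vector field whose divergence is the integrand of the
Reilly formula. -/
def hFlux {𝔤 : Type*} [NormedAddCommGroup 𝔤] [InnerProductSpace ℝ 𝔤] (G : ExpLieGroup 𝔤) {m : ℕ}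
    (X : Fin m → 𝔤) (u : 𝔤 → ℝ) (j : Fin m) (p : 𝔤) : ℝ :=
  ∑ i, (G.lieDeriv (X j) u p * G.lieDeriv (X i) (G.lieDeriv (X i) u) p
    - G.lieDeriv (X i) u p * (2 * G.lieDeriv (X i) (G.lieDeriv (X j) u) p
      - G.lieDeriv (X j) (G.lieDeriv (X i) u) p))

section Flux

variable {𝔤 : Type*} [NormedAddCommGroup 𝔤] [InnerProductSpace ℝ 𝔤] (G : ExpLieGroup 𝔤)
  {m : ℕ} {X : Fin m → 𝔤} {Ω : Set 𝔤} {u : 𝔤 → ℝ}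

theorem hasDerivAt_hFlux (hΩ : IsOpen Ω) (hu : ContDiffOn ℝ 2 u Ω)
    (hd : ∀ k i j, ∀ p ∈ Ω, DifferentiableAt ℝ
      (fun t : ℝ => G.lieDeriv (X i) (G.lieDeriv (X j) u) (G.mul p (t • X k))) 0)
    (j : Fin m) {p : 𝔤} (hp : p ∈ Ω) :
    HasDerivAt (fun t : ℝ => G.hFlux X u j (G.mul p (t • X j)))
      (∑ i, (G.lieDeriv (X j) (G.lieDeriv (X j) u) p * G.lieDeriv (X i) (G.lieDeriv (X i) u) p
        + G.lieDeriv (X j) u p * G.lieDeriv (X j) (G.lieDeriv (X i) (G.lieDeriv (X i) u)) p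
        - (G.lieDeriv (X j) (G.lieDeriv (X i) u) p
            * (2 * G.lieDeriv (X i) (G.lieDeriv (X j) u) p
              - G.lieDeriv (X j) (G.lieDeriv (X i) u) p)
          + G.lieDeriv (X i) u p
            * (2 * G.lieDeriv (X j) (G.lieDeriv (X i) (G.lieDeriv (X j) u)) p
              - G.lieDeriv (X j) (G.lieDeriv (X j) (G.lieDeriv (X i) u)) p)))) 0 := by
  have h1 : ∀ i, HasDerivAt (fun t : ℝ => G.lieDeriv (X i) u (G.mul p (t • X j)))
      (G.lieDeriv (X j) (G.lieDeriv (X i) u) p) 0 := fun i =>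
    (G.differentiableAt_mul_smul hΩ ((G.contDiffOn_lieDeriv (n := 1) hΩ (by simp) hu
      (by norm_num) (X i)).differentiableOn (by simp)) (X j) hp).hasDerivAt
  have h2 : ∀ i k, HasDerivAt
      (fun t : ℝ => G.lieDeriv (X i) (G.lieDeriv (X k) u) (G.mul p (t • X j)))
      (G.lieDeriv (X j) (G.lieDeriv (X i) (G.lieDeriv (X k) u)) p) 0 := fun i k =>
    (hd j i k p hp).hasDerivAt
  have h3 := HasDerivAt.fun_sum (u := Finset.univ) (x := (0 : ℝ)) fun i (_ : i ∈ Finset.univ) =>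
    ((h1 j).fun_mul (h2 i i)).fun_sub ((h1 i).fun_mul (((h2 i j).const_mul 2).fun_sub (h2 j i)))
  simp only [zero_smul, G.mul_zero] at h3
  exact h3

end Flux

end ExpLieGroup

namespace CarnotGroup

variable {𝔤 : Type*} [NormedAddCommGroup 𝔤] [InnerProductSpace ℝ 𝔤] [FiniteDimensional ℝ 𝔤]
  [MeasurableSpace 𝔤] [BorelSpace 𝔤] (G : CarnotGroup 𝔤)

theorem integral_lieDeriv_mul {ξ : 𝔤} {Ω : Set 𝔤} (hΩ : IsOpen Ω) {F χ : 𝔤 → ℝ}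
    (hF : ContinuousOn F Ω)
    (hd : ∀ p ∈ Ω, DifferentiableAt ℝ (fun t : ℝ => F (G.mul p (t • ξ))) 0)
    (hXF : ContinuousOn (G.lieDeriv ξ F) Ω) (hχ : ContDiff ℝ 1 χ) (hs : HasCompactSupport χ)
    (hsΩ : tsupport χ ⊆ Ω) :
    ∫ p, G.lieDeriv ξ F p * χ p = -∫ p, F p * fderiv ℝ χ p (G.leftField ξ p) := by
  have h := G.integral_lieDeriv_mul_add hΩ hF hd hXF hχ hs hsΩ
  have hs' := G.tsupport_fderiv_leftField_subset χ ξ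
  have hsc' : HasCompactSupport (fun p => fderiv ℝ χ p (G.leftField ξ p)) :=
    hs.mono' ((subset_tsupport _).trans hs')
  have hfc : Continuous fun p => fderiv ℝ χ p (G.leftField ξ p) :=
    (hχ.continuous_fderiv (by simp)).clm_apply (G.contDiff_leftField ξ).continuous
  have i1 : Integrable fun p => G.lieDeriv ξ F p * χ p :=
    (hXF.continuous_mul_of_tsupport_subset hΩ hχ.continuous hsΩ).integrable_of_hasCompactSupport
      hs.mul_left
  have i2 : Integrable fun p => F p * fderiv ℝ χ p (G.leftField ξ p) :=
    (hF.continuous_mul_of_tsupport_subset hΩ hfc (hs'.trans hsΩ)).integrable_of_hasCompactSupport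
      hsc'.mul_left
  rw [setIntegral_eq_integral_of_forall_compl_eq_zero, integral_add i1 i2] at h
  · exact eq_neg_of_add_eq_zero_left h
  · intro p hp
    have h1 : χ p = 0 := image_eq_zero_of_notMem_tsupport fun h => hp (hsΩ h)
    have h2 : fderiv ℝ χ p (G.leftField ξ p) = 0 :=
      image_eq_zero_of_notMem_tsupport (f := fun p => fderiv ℝ χ p (G.leftField ξ p))
        fun h => hp (hsΩ (hs' h))
    rw [h1, h2]; ring


/-- The commutator formula `ξ (η v) - η (ξ v) = [ξ, η] v` for a `C¹` function `v` whose second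
derivatives `ξ (η v)` and `η (ξ v)` exist and are continuous. -/
theorem lieDeriv_comm {ξ η : 𝔤} {Ω : Set 𝔤} (hΩ : IsOpen Ω) {v : 𝔤 → ℝ}
    (hv : ContDiffOn ℝ 1 v Ω)
    (hd₁ : ∀ p ∈ Ω, DifferentiableAt ℝ (fun t : ℝ => G.lieDeriv η v (G.mul p (t • ξ))) 0)
    (hd₂ : ∀ p ∈ Ω, DifferentiableAt ℝ (fun t : ℝ => G.lieDeriv ξ v (G.mul p (t • η))) 0)
    (hc₁ : ContinuousOn (G.lieDeriv ξ (G.lieDeriv η v)) Ω)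
    (hc₂ : ContinuousOn (G.lieDeriv η (G.lieDeriv ξ v)) Ω) {p : 𝔤} (hp : p ∈ Ω) :
    G.lieDeriv ξ (G.lieDeriv η v) p - G.lieDeriv η (G.lieDeriv ξ v) p
      = fderiv ℝ v p (G.leftField (G.bracket ξ η) p) := by
  have hvd : DifferentiableOn ℝ v Ω := hv.differentiableOn (by simp)
  rw [← G.lieDeriv_eq_fderiv (hvd.differentiableAt (hΩ.mem_nhds hp))]
  have hcb := G.continuousOn_lieDeriv hΩ hv (G.bracket ξ η)
  set D : 𝔤 → ℝ := fun p => G.lieDeriv ξ (G.lieDeriv η v) p - G.lieDeriv η (G.lieDeriv ξ v) p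
    - G.lieDeriv (G.bracket ξ η) v p with hD
  have hDc : ContinuousOn D Ω := (hc₁.sub hc₂).sub hcb
  -- The defect D is tested against smooth χ. All derivatives are moved onto χ, for which the
  -- commutator formula is classical; the fundamental lemma then gives D = 0 almost everywhere, and
  -- continuity gives it everywhere.
  have hae : ∀ᵐ x ∂(volume : Measure 𝔤), x ∈ Ω → D x = 0 := by
    refine hΩ.ae_eq_zero_of_integral_contDiff_smul_eq_zero
      (hDc.locallyIntegrableOn hΩ.measurableSet) fun χ hχ hs hsΩ => ?_
    have hχ1 : ContDiff ℝ 1 χ := hχ.of_le (by simp)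
    -- Two integrations by parts: the signs cancel and the order of the two fields is reversed on
    -- the test function.
    have second : ∀ a b : 𝔤,
        (∀ p ∈ Ω, DifferentiableAt ℝ (fun t : ℝ => G.lieDeriv b v (G.mul p (t • a))) 0) →
        ContinuousOn (G.lieDeriv a (G.lieDeriv b v)) Ω →
        ∫ p, G.lieDeriv a (G.lieDeriv b v) p * χ p
          = ∫ p, v p * G.lieDeriv b (G.lieDeriv a χ) p := by
      intro a b hd hc
      have e : G.lieDeriv a χ = fun p => fderiv ℝ χ p (G.leftField a p) :=
        funext fun p => G.lieDeriv_eqOn isOpen_univ (hχ.differentiable (by simp)).differentiableOn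
          a (mem_univ p)
      have hχa : ContDiff ℝ 1 (G.lieDeriv a χ) := by
        rw [← contDiffOn_univ]
        exact G.contDiffOn_lieDeriv isOpen_univ (by simp) hχ.contDiffOn
          (by norm_num; exact two_le_contDiff_infty) a
      have hsa : tsupport (G.lieDeriv a χ) ⊆ tsupport χ := by
        rw [e]; exact G.tsupport_fderiv_leftField_subset χ a
      rw [G.integral_lieDeriv_mul hΩ (G.continuousOn_lieDeriv hΩ hv b) hd hc hχ1 hs hsΩ]
      simp only [← congrFun e]
      rw [G.integral_lieDeriv_mul hΩ hv.continuousOn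
          (fun p hp => G.differentiableAt_mul_smul hΩ hvd b hp) (G.continuousOn_lieDeriv hΩ hv b)
          hχa (hs.mono' ((subset_tsupport _).trans hsa)) (hsa.trans hsΩ), neg_neg]
      congr 1 with p
      rw [G.lieDeriv_eq_fderiv (hχa.differentiable (by simp) p)]
    have first := G.integral_lieDeriv_mul hΩ hv.continuousOn
      (fun p hp => G.differentiableAt_mul_smul hΩ hvd (G.bracket ξ η) hp) hcb hχ1 hs hsΩ
    have int : ∀ {g : 𝔤 → ℝ}, ContinuousOn g Ω → Integrable fun p => g p * χ p := fun hg =>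
      (hg.continuous_mul_of_tsupport_subset hΩ hχ.continuous hsΩ).integrable_of_hasCompactSupport
        hs.mul_left
    have int' : ∀ a b : 𝔤, Integrable fun p => v p * G.lieDeriv a (G.lieDeriv b χ) p := by
      intro a b
      have e : ∀ (c : 𝔤) {f : 𝔤 → ℝ}, ContDiff ℝ 1 f →
          tsupport (G.lieDeriv c f) ⊆ tsupport f := fun c f hf => by
        have : G.lieDeriv c f = fun p => fderiv ℝ f p (G.leftField c p) :=
          funext fun p => G.lieDeriv_eq_fderiv (hf.differentiable (by simp) p) c
        rw [this]; exact G.tsupport_fderiv_leftField_subset f c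
      have hχb : ContDiff ℝ 1 (G.lieDeriv b χ) := by
        rw [← contDiffOn_univ]
        exact G.contDiffOn_lieDeriv isOpen_univ (by simp) hχ.contDiffOn
          (by norm_num; exact two_le_contDiff_infty) b
      have hsub := (e a hχb).trans (e b hχ1)
      refine (hv.continuousOn.continuous_mul_of_tsupport_subset hΩ ?_
        (hsub.trans hsΩ)).integrable_of_hasCompactSupport
        (hs.mono' ((subset_tsupport _).trans hsub)).mul_left
      rw [← continuousOn_univ]
      exact G.continuousOn_lieDeriv isOpen_univ hχb.contDiffOn a
    have hcomb : ∫ p, D p * χ p = (∫ p, G.lieDeriv ξ (G.lieDeriv η v) p * χ p)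
        - (∫ p, G.lieDeriv η (G.lieDeriv ξ v) p * χ p)
        - ∫ p, G.lieDeriv (G.bracket ξ η) v p * χ p := by
      rw [← integral_sub (int hc₁) (int hc₂)]
      refine Eq.trans ?_ (integral_sub ((int hc₁).sub (int hc₂)) (int hcb))
      congr 1 with p
      simp only [hD]; ring
    have hsw : ∀ x, χ x • D x = D x * χ x := fun x => by rw [smul_eq_mul, mul_comm]
    simp only [hsw]
    rw [hcomb, second ξ η hd₁ hc₁, second η ξ hd₂ hc₂, first, sub_neg_eq_add,
      ← integral_sub (int' _ _) (int' _ _)]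
    have e3 : ∀ p, v p * fderiv ℝ χ p (G.leftField (G.bracket ξ η) p)
        = v p * G.lieDeriv ξ (G.lieDeriv η χ) p - v p * G.lieDeriv η (G.lieDeriv ξ χ) p := fun p => by
      rw [G.fderiv_leftField_bracket isOpen_univ
        (hχ.of_le two_le_contDiff_infty).contDiffOn ξ η (mem_univ p)]
      ring
    simp only [e3]
    rw [integral_sub (int' _ _) (int' _ _), integral_sub (int' _ _) (int' _ _)]
    ring
  have h0 : EqOn D (fun _ => 0) Ω :=
    Measure.eqOn_open_of_ae_eq (μ := (volume : Measure 𝔤))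
      ((ae_restrict_iff' hΩ.measurableSet).2 hae) hΩ hDc continuousOn_const
  exact sub_eq_zero.1 (h0 hp)

/-! ### The divergence of the flux -/

section Divergence

variable {m : ℕ} {X : Fin m → 𝔤} {Ω : Set 𝔤} {u : 𝔤 → ℝ}

/-- The outer commutator is first expanded for u itself, which is C². The term [X_i,X_j](X_j u) then
needs `lieDeriv_comm`, because X_j u is only C¹; in the term X_j([X_i,X_j]u) one differentiates
along X_j the identity for [X_i,X_j]u on Ω. -/
theorem comm₃_eq (hΩ : IsOpen Ω) (hu : ContDiffOn ℝ 2 u Ω)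
    (hd : ∀ k i j, ∀ p ∈ Ω, DifferentiableAt ℝ
      (fun t : ℝ => G.lieDeriv (X i) (G.lieDeriv (X j) u) (G.mul p (t • X k))) 0)
    (hc : ∀ k i j, ContinuousOn (G.lieDeriv (X k) (G.lieDeriv (X i) (G.lieDeriv (X j) u))) Ω)
    (i j : Fin m) {p : 𝔤} (hp : p ∈ Ω) :
    G.comm₃ (X i) (X j) (X j) u p
      = G.lieDeriv (X i) (G.lieDeriv (X j) (G.lieDeriv (X j) u)) p
        - 2 * G.lieDeriv (X j) (G.lieDeriv (X i) (G.lieDeriv (X j) u)) p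
        + G.lieDeriv (X j) (G.lieDeriv (X j) (G.lieDeriv (X i) u)) p := by
  have hud : DifferentiableOn ℝ u Ω := hu.differentiableOn (by simp)
  have hu1 : ContDiffOn ℝ 1 (G.lieDeriv (X j) u) Ω :=
    G.contDiffOn_lieDeriv hΩ (by simp) hu (by norm_num) (X j)
  rw [G.comm₃_eq_fderiv, G.fderiv_leftField_bracket hΩ hu _ _ hp]
  have h1 : G.lieDeriv (G.bracket (X i) (X j)) (G.lieDeriv (X j) u) p
      = G.lieDeriv (X i) (G.lieDeriv (X j) (G.lieDeriv (X j) u)) p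
        - G.lieDeriv (X j) (G.lieDeriv (X i) (G.lieDeriv (X j) u)) p := by
    rw [G.lieDeriv_comm hΩ hu1 (hd i j j) (hd j i j) (hc i j j) (hc j i j) hp]
    exact G.lieDeriv_eqOn hΩ (hu1.differentiableOn (by simp)) _ hp
  have h2 : G.lieDeriv (X j) (G.lieDeriv (G.bracket (X i) (X j)) u) p
      = G.lieDeriv (X j) (G.lieDeriv (X i) (G.lieDeriv (X j) u)) p
        - G.lieDeriv (X j) (G.lieDeriv (X j) (G.lieDeriv (X i) u)) p := by
    have he : EqOn (G.lieDeriv (G.bracket (X i) (X j)) u) (fun q =>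
        G.lieDeriv (X i) (G.lieDeriv (X j) u) q - G.lieDeriv (X j) (G.lieDeriv (X i) u) q) Ω :=
      fun q hq => by
        rw [G.lieDeriv_eqOn hΩ hud _ hq]
        exact G.fderiv_leftField_bracket hΩ hu _ _ hq
    rw [G.lieDeriv_congr (he.eventuallyEq_of_mem (hΩ.mem_nhds hp)) (X j)]
    exact deriv_sub (hd j i j p hp) (hd j j i p hp)
  rw [h1, h2]; ring

/-- With A = S + K split into symmetric and antisymmetric parts, Σ (2 A_ij A_ji − A_ji²) = 2(‖S‖² −
‖K‖²) − (‖S‖² + ‖K‖²) = ‖S‖² − 3‖K‖². Since K_ij = ½[X_i,X_j]u, the last term is ¾ Σ ([X_i,X_j]u)².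
After exchanging summation indices the third-order terms match the expansion in `comm₃_eq`. -/
theorem sum_lieDeriv_hFlux (hΩ : IsOpen Ω) (hu : ContDiffOn ℝ 2 u Ω)
    (hd : ∀ k i j, ∀ p ∈ Ω, DifferentiableAt ℝ
      (fun t : ℝ => G.lieDeriv (X i) (G.lieDeriv (X j) u) (G.mul p (t • X k))) 0)
    (hc : ∀ k i j, ContinuousOn (G.lieDeriv (X k) (G.lieDeriv (X i) (G.lieDeriv (X j) u))) Ω)
    {p : 𝔤} (hp : p ∈ Ω) :
    ∑ j, G.lieDeriv (X j) (G.hFlux X u j) p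
      = (G.hLaplacian X u p ^ 2 - G.hHessianNormSq X u p)
        + 3 / 4 * (∑ i, ∑ j, G.comm₂ (X i) (X j) u p ^ 2)
        + ∑ i, ∑ j, G.lieDeriv (X i) u p * G.comm₃ (X i) (X j) (X j) u p := by
  have e1 : ∀ j, G.lieDeriv (X j) (G.hFlux X u j) p = _ := fun j =>
    (G.hasDerivAt_hFlux hΩ hu hd j hp).deriv
  simp only [e1, G.comm₃_eq hΩ hu hd hc _ _ hp, G.comm₂_eq hΩ hu _ _ hp,
    ExpLieGroup.hLaplacian, ExpLieGroup.hHessianNormSq, ExpLieGroup.hHessian, Matrix.of_apply]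
  set A : Fin m → Fin m → ℝ := fun i j => G.lieDeriv (X i) (G.lieDeriv (X j) u) p with hA
  set B : Fin m → ℝ := fun i => G.lieDeriv (X i) u p with hB
  set T : Fin m → Fin m → Fin m → ℝ := fun k i j =>
    G.lieDeriv (X k) (G.lieDeriv (X i) (G.lieDeriv (X j) u)) p with hT
  change ∑ j, ∑ i, (A j j * A i i + B j * T j i i
      - (A j i * (2 * A i j - A j i) + B i * (2 * T j i j - T j j i)))
    = (∑ i, A i i) ^ 2 - (∑ i, ∑ j, ((A i j + A j i) / 2) ^ 2)
      + 3 / 4 * (∑ i, ∑ j, (A i j - A j i) ^ 2)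
      + ∑ i, ∑ j, B i * (T i j j - 2 * T j i j + T j j i)
  have s0 : ∑ j, ∑ i, A j i ^ 2 = ∑ j, ∑ i, A i j ^ 2 := Finset.sum_comm
  have s1 : ∑ j, ∑ i, B i * T j i j = ∑ j, ∑ i, B j * T i j i := Finset.sum_comm
  have s2 : ∑ j, ∑ i, B i * T j j i = ∑ j, ∑ i, B j * T i i j := Finset.sum_comm
  have l : ∑ j, ∑ i, (A j j * A i i + B j * T j i i
      - (A j i * (2 * A i j - A j i) + B i * (2 * T j i j - T j j i)))
    = (∑ j, ∑ i, A j j * A i i) + (∑ j, ∑ i, B j * T j i i) - 2 * (∑ j, ∑ i, A j i * A i j)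
      + (∑ j, ∑ i, A j i ^ 2) - 2 * (∑ j, ∑ i, B i * T j i j) + ∑ j, ∑ i, B i * T j j i := by
    simp only [Finset.mul_sum, ← Finset.sum_add_distrib, ← Finset.sum_sub_distrib]
    refine Finset.sum_congr rfl fun j _ => Finset.sum_congr rfl fun i _ => ?_
    ring
  have r : (∑ i, A i i) ^ 2 - (∑ i, ∑ j, ((A i j + A j i) / 2) ^ 2)
      + 3 / 4 * (∑ i, ∑ j, (A i j - A j i) ^ 2)
      + ∑ i, ∑ j, B i * (T i j j - 2 * T j i j + T j j i)
    = (∑ j, ∑ i, A j j * A i i) + (∑ j, ∑ i, B j * T j i i) - 2 * (∑ j, ∑ i, A j i * A i j)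
      + 1 / 2 * (∑ j, ∑ i, A j i ^ 2) + 1 / 2 * (∑ j, ∑ i, A i j ^ 2)
      - 2 * (∑ j, ∑ i, B j * T i j i) + ∑ j, ∑ i, B j * T i i j := by
    rw [pow_two (∑ i, A i i), Finset.sum_mul_sum]
    simp only [Finset.mul_sum, ← Finset.sum_add_distrib, ← Finset.sum_sub_distrib]
    refine Finset.sum_congr rfl fun j _ => Finset.sum_congr rfl fun i _ => ?_
    ring
  rw [l, r, s1, s2, ← s0]
  ring

end Divergence

end CarnotGroup

/-! ### Defining functions and the outer normal -/

theorem eq_zero_of_mem_frontier {𝔤 : Type*} [TopologicalSpace 𝔤] {Ω : Set 𝔤} {p : 𝔤}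
    {φ : 𝔤 → ℝ} (hΩ : IsOpen Ω) (hp : p ∈ frontier Ω) (hφ : ContinuousAt φ p)
    (h : ∀ᶠ q in 𝓝 p, (q ∈ Ω ↔ φ q < 0)) : φ p = 0 := by
  rw [hΩ.frontier_eq] at hp
  refine le_antisymm ?_ (not_lt.1 fun hlt => hp.2 (h.self_of_nhds.2 hlt))
  by_contra! hpos
  have h1 : ∃ᶠ q in 𝓝 p, q ∈ Ω := mem_closure_iff_frequently.1 hp.1
  obtain ⟨q, hq, hq1, hq2⟩ := (h1.and_eventually (h.and (hφ.eventually_const_lt hpos))).exists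
  exact absurd (hq1.1 hq) (not_lt.2 hq2.le)

section DefiningFunction

variable {𝔤 : Type*} [NormedAddCommGroup 𝔤] [InnerProductSpace ℝ 𝔤] {Ω : Set 𝔤} {p : 𝔤}
  {φ : 𝔤 → ℝ}

theorem IsLocalDefiningFunction.differentiableAt (h : IsLocalDefiningFunction Ω p φ) :
    DifferentiableAt ℝ φ p := h.1.differentiableAt (by simp)

/-- One defining function serves at all nearby boundary points. This is what makes the pointwise
chosen normal depend continuously on the point. -/
theorem IsLocalDefiningFunction.eventually (hΩ : IsOpen Ω) (h : IsLocalDefiningFunction Ω p φ) :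
    ∀ᶠ q in 𝓝[frontier Ω] p, IsLocalDefiningFunction Ω q φ := by
  have h1 : ∀ᶠ q in 𝓝 p, ContDiffAt ℝ 2 φ q := h.1.eventually (by simp)
  have h2 : ∀ᶠ q in 𝓝 p, fderiv ℝ φ q ≠ 0 :=
    (h.1.fderiv_right (m := 1) (by norm_num)).continuousAt.eventually_ne h.2.2.1
  have h3 := h.2.2.2.eventually_nhds
  filter_upwards [self_mem_nhdsWithin, mem_nhdsWithin_of_mem_nhds h1,
    mem_nhdsWithin_of_mem_nhds h2, mem_nhdsWithin_of_mem_nhds h3] with q hq hq1 hq2 hq3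
  exact ⟨hq1, eq_zero_of_mem_frontier hΩ hq hq1.continuousAt hq3, hq2, hq3⟩

theorem IsLocalDefiningFunction.eventually_add_smul_mem (h : IsLocalDefiningFunction Ω p φ) {v : 𝔤}
    (hv : fderiv ℝ φ p v < 0) : ∀ᶠ t : ℝ in 𝓝[>] 0, p + t • v ∈ Ω := by
  have hl : HasDerivAt (fun t : ℝ => p + t • v) v 0 := by
    simpa using ((hasDerivAt_id (0 : ℝ)).smul_const v).const_add p
  have hd : HasDerivAt (fun t : ℝ => φ (p + t • v)) (fderiv ℝ φ p v) 0 := by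
    refine HasFDerivAt.comp_hasDerivAt (l := φ) 0 (f := fun t : ℝ => p + t • v) ?_ hl
    simpa using h.differentiableAt.hasFDerivAt
  have hlim : Filter.Tendsto (fun t : ℝ => p + t • v) (𝓝 0) (𝓝 p) := by
    simpa using hl.continuousAt.tendsto
  have hs := (hasDerivAt_iff_tendsto_slope.1 hd).eventually_lt_const hv
  have hs' : ∀ᶠ t : ℝ in 𝓝[>] 0, slope (fun t : ℝ => φ (p + t • v)) 0 t < 0 :=
    hs.filter_mono (nhdsWithin_mono _ fun t (ht : 0 < t) => ht.ne')
  filter_upwards [hs', self_mem_nhdsWithin,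
    mem_nhdsWithin_of_mem_nhds (hlim.eventually h.2.2.2)] with t ht htpos hmem
  rw [hmem]
  have htpos' : (0 : ℝ) < t := htpos
  rw [slope_def_field, sub_zero, zero_smul, add_zero, h.2.1, sub_zero] at ht
  by_contra! hge
  exact absurd ht (not_lt.2 (div_nonneg hge htpos'.le))

theorem IsLocalDefiningFunction.mem_closure (h : IsLocalDefiningFunction Ω p φ) :
    p ∈ closure Ω := by
  obtain ⟨v, hv⟩ : ∃ v, fderiv ℝ φ p v < 0 := by
    obtain ⟨v, hv⟩ := DFunLike.ne_iff.1 h.2.2.1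
    rcases lt_or_gt_of_ne hv with hv | hv
    · exact ⟨v, hv⟩
    · exact ⟨-v, by simpa using hv⟩
  have hl : Filter.Tendsto (fun t : ℝ => p + t • v) (𝓝[>] 0) (𝓝 p) := by
    have : Continuous (fun t : ℝ => p + t • v) := by fun_prop
    simpa using (this.tendsto 0).mono_left nhdsWithin_le_nhds
  exact mem_closure_of_tendsto hl (h.eventually_add_smul_mem hv)

theorem IsLocalDefiningFunction.mem_frontier (hΩ : IsOpen Ω) (h : IsLocalDefiningFunction Ω p φ) :
    p ∈ frontier Ω := by
  rw [hΩ.frontier_eq]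
  exact ⟨h.mem_closure, fun hp => absurd (h.2.2.2.self_of_nhds.1 hp) (by rw [h.2.1]; simp)⟩

theorem ContinuousLinearMap.exists_pos_smul_eq_of_neg_imp_nonpos {L₁ L₂ : 𝔤 →L[ℝ] ℝ}
    (h₁ : L₁ ≠ 0) (h₂ : L₂ ≠ 0)
    (h : ∀ v, L₁ v < 0 → L₂ v ≤ 0) : ∃ c : ℝ, 0 < c ∧ L₂ = c • L₁ := by
  obtain ⟨w, hw⟩ : ∃ w, L₁ w = -1 := by
    obtain ⟨v, hv⟩ := DFunLike.ne_iff.1 h₁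
    refine ⟨(-(L₁ v)⁻¹) • v, ?_⟩
    have hv' : L₁ v ≠ 0 := hv
    simp [hv']
  have hker : ∀ v, L₁ v = 0 → L₂ v = 0 := by
    intro v hv
    by_contra hne
    -- The multiple of v is chosen so that L₂ takes the value 1 while L₁ stays at −1.
    have := h (w + ((1 - L₂ w) / L₂ v) • v) (by simp [hw, hv])
    rw [map_add, map_smul, smul_eq_mul, div_mul_cancel₀ _ hne] at this
    linarith
  have heq : ∀ v, L₂ v = -(L₂ w) * L₁ v := by
    intro v
    have := hker (v + L₁ v • w) (by simp [hw])
    rw [map_add, map_smul, smul_eq_mul] at this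
    linarith
  refine ⟨-(L₂ w), ?_, ContinuousLinearMap.ext heq⟩
  refine lt_of_le_of_ne (by linarith [h w (by rw [hw]; norm_num)]) fun h0 => h₂ ?_
  ext v
  rw [heq, ← h0]; simp

/-- A vector with dφ(v) < 0 points into Ω, which forces dφ'(v) ≤ 0. Two functionals related in this
way are positive multiples of each other, so the normal direction does not depend on the defining
function. -/
theorem IsLocalDefiningFunction.exists_fderiv_eq_smul {φ' : 𝔤 → ℝ}
    (h : IsLocalDefiningFunction Ω p φ) (h' : IsLocalDefiningFunction Ω p φ') :
    ∃ c : ℝ, 0 < c ∧ fderiv ℝ φ' p = c • fderiv ℝ φ p := by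
  refine ContinuousLinearMap.exists_pos_smul_eq_of_neg_imp_nonpos h.2.2.1 h'.2.2.1 fun v hv => ?_
  by_contra! hpos
  have h1 := h.eventually_add_smul_mem hv
  have hl : HasDerivAt (fun t : ℝ => p + t • v) v 0 := by
    simpa using ((hasDerivAt_id (0 : ℝ)).smul_const v).const_add p
  have hlim : Filter.Tendsto (fun t : ℝ => p + t • v) (𝓝 0) (𝓝 p) := by
    simpa using hl.continuousAt.tendsto
  have hd : HasDerivAt (fun t : ℝ => φ' (p + t • v)) (fderiv ℝ φ' p v) 0 := by
    refine HasFDerivAt.comp_hasDerivAt (l := φ') 0 (f := fun t : ℝ => p + t • v) ?_ hl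
    simpa using h'.differentiableAt.hasFDerivAt
  have hs := (hasDerivAt_iff_tendsto_slope.1 hd).eventually_const_lt hpos
  have hs' : ∀ᶠ t : ℝ in 𝓝[>] 0, 0 < slope (fun t : ℝ => φ' (p + t • v)) 0 t :=
    hs.filter_mono (nhdsWithin_mono _ fun t (ht : 0 < t) => ht.ne')
  have hmem : ∀ᶠ t : ℝ in 𝓝[>] 0, p + t • v ∈ Ω ↔ φ' (p + t • v) < 0 :=
    (hlim.eventually h'.2.2.2).filter_mono nhdsWithin_le_nhds
  have hpos' : ∀ᶠ t : ℝ in 𝓝[>] 0, 0 < t := eventually_mem_nhdsWithin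
  obtain ⟨t, ht, ht1, ht2, ht3⟩ := (h1.and (hs'.and (hpos'.and hmem))).exists
  have htpos : (0 : ℝ) < t := ht2
  rw [slope_def_field, sub_zero, zero_smul, add_zero, h'.2.1, sub_zero] at ht1
  have : φ' (p + t • v) < 0 := ht3.1 ht
  exact absurd ht1 (not_lt.2 (div_nonpos_of_nonpos_of_nonneg this.le htpos.le))

/-- At a boundary point the tangent cone contains the open half-space dφ < 0, which spans.
Derivatives within the closure are therefore well determined up to the boundary. -/
theorem IsC2Open.uniqueDiffOn_closure (hΩ : IsC2Open Ω) : UniqueDiffOn ℝ (closure Ω) := by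
  intro p hp
  by_cases hpΩ : p ∈ Ω
  · exact uniqueDiffWithinAt_of_mem_nhds
      (Filter.mem_of_superset (hΩ.1.mem_nhds hpΩ) subset_closure)
  obtain ⟨φ, hφ⟩ := hΩ.2 p (by rw [hΩ.1.frontier_eq]; exact ⟨hp, hpΩ⟩)
  refine UniqueDiffWithinAt.mono ?_ subset_closure
  refine ⟨?_, hp⟩
  have hsub : {v | fderiv ℝ φ p v < 0} ⊆ tangentConeAt ℝ Ω p := fun v hv => by
    refine mem_tangentConeAt_of_add_smul_mem (l := 𝓝[>] (0 : ℝ)) (c := id) ?_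
      (hφ.eventually_add_smul_mem hv)
    exact tendsto_nhdsWithin_mono_left (fun t (ht : 0 < t) => ht.ne') Filter.tendsto_id
  have hopen : IsOpen {v | fderiv ℝ φ p v < 0} :=
    isOpen_lt (fderiv ℝ φ p).continuous continuous_const
  obtain ⟨v, hv⟩ : ∃ v, fderiv ℝ φ p v < 0 := by
    obtain ⟨v, hv⟩ := DFunLike.ne_iff.1 hφ.2.2.1
    rcases lt_or_gt_of_ne hv with hv | hv
    · exact ⟨v, hv⟩
    · exact ⟨-v, by simpa using hv⟩
  have htop : Submodule.span ℝ (tangentConeAt ℝ Ω p) = ⊤ :=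
    Submodule.eq_top_of_nonempty_interior' _
      ⟨v, interior_maximal (hsub.trans Submodule.subset_span) hopen hv⟩
  rw [htop]
  exact dense_univ

end DefiningFunction

section Normal

namespace ExpLieGroup

variable {𝔤 : Type*} [NormedAddCommGroup 𝔤] [InnerProductSpace ℝ 𝔤] [FiniteDimensional ℝ 𝔤]
  (G : ExpLieGroup 𝔤) {Ω : Set 𝔤} {p : 𝔤} {φ : 𝔤 → ℝ}

/-- The Riemannian gradient, in the left-invariant trivialization. -/
def lieGrad (φ : 𝔤 → ℝ) (p : 𝔤) : 𝔤 :=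
  (InnerProductSpace.toDual ℝ 𝔤).symm ((fderiv ℝ φ p).comp (fderiv ℝ (G.mul p) 0))

theorem inner_lieGrad (φ : 𝔤 → ℝ) (p η : 𝔤) :
    ⟪G.lieGrad φ p, η⟫ = fderiv ℝ φ p (G.leftField η p) := by
  rw [lieGrad, InnerProductSpace.toDual_symm_apply]; rfl

theorem lieGrad_ne_zero (h : fderiv ℝ φ p ≠ 0) : G.lieGrad φ p ≠ 0 := by
  intro h0
  refine h (ContinuousLinearMap.ext fun w => ?_)
  have := G.inner_lieGrad φ p (G.toLie p w)
  rw [h0, inner_zero_left, leftField_toLie] at this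
  simpa using this.symm

theorem contDiffAt_lieGrad (h : ContDiffAt ℝ 2 φ p) : ContDiffAt ℝ 1 (G.lieGrad φ) p := by
  have h1 : ContDiffAt ℝ 1 (fun p => (fderiv ℝ φ p).comp (fderiv ℝ (G.mul p) 0)) p :=
    (h.fderiv_right (m := 1) (by norm_num)).clm_comp
      ((G.contDiff_fderiv_mul_left.of_le (by simp)).contDiffAt)
  exact ((InnerProductSpace.toDual ℝ 𝔤).symm.contDiff.contDiffAt).comp p h1

theorem isOuterNormal_lieGrad (h : IsLocalDefiningFunction Ω p φ) :
    G.IsOuterNormal Ω p (‖G.lieGrad φ p‖⁻¹ • G.lieGrad φ p) := by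
  have hn := norm_pos_iff.2 (G.lieGrad_ne_zero h.2.2.1)
  refine ⟨?_, φ, h, ‖G.lieGrad φ p‖, hn, fun η => ?_⟩
  · rw [norm_smul, norm_inv, norm_norm, inv_mul_cancel₀ hn.ne']
  · rw [inner_smul_left, inner_lieGrad]
    simp [hn.ne']

theorem IsOuterNormal.eq_lieGrad {ν : 𝔤} (hν : G.IsOuterNormal Ω p ν)
    (h : IsLocalDefiningFunction Ω p φ) : ν = ‖G.lieGrad φ p‖⁻¹ • G.lieGrad φ p := by
  obtain ⟨hν1, φ', hφ', c, hc, hcν⟩ := hν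
  obtain ⟨d, hd, hdφ⟩ := hφ'.exists_fderiv_eq_smul h
  have e : G.lieGrad φ p = (d * c) • ν := by
    refine ext_inner_right ℝ fun η => ?_
    rw [inner_lieGrad, hdφ, inner_smul_left]
    simp [hcν]
    ring
  have hdc : 0 < d * c := mul_pos hd hc
  rw [e, norm_smul, hν1, mul_one, Real.norm_of_nonneg hdc.le, smul_smul, inv_mul_cancel₀ hdc.ne',
    one_smul]

theorem outerNormal_eq (h : IsLocalDefiningFunction Ω p φ) :
    G.outerNormal Ω p = ‖G.lieGrad φ p‖⁻¹ • G.lieGrad φ p := by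
  have hex : ∃ ν, G.IsOuterNormal Ω p ν := ⟨_, G.isOuterNormal_lieGrad h⟩
  rw [outerNormal, dif_pos hex]
  exact hex.choose_spec.eq_lieGrad G h

theorem fderiv_leftField_eq_norm_mul (h : IsLocalDefiningFunction Ω p φ) (η : 𝔤) :
    fderiv ℝ φ p (G.leftField η p) = ‖G.lieGrad φ p‖ * ⟪G.outerNormal Ω p, η⟫ := by
  have hn := norm_pos_iff.2 (G.lieGrad_ne_zero h.2.2.1)
  rw [G.outerNormal_eq h, inner_smul_left, ← inner_lieGrad]
  simp [hn.ne']

theorem norm_outerNormal (h : IsLocalDefiningFunction Ω p φ) : ‖G.outerNormal Ω p‖ = 1 := by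
  have hn := norm_pos_iff.2 (G.lieGrad_ne_zero h.2.2.1)
  rw [G.outerNormal_eq h, norm_smul, norm_inv, norm_norm, inv_mul_cancel₀ hn.ne']

theorem continuousOn_outerNormal (hΩ : IsC2Open Ω) :
    ContinuousOn (G.outerNormal Ω) (frontier Ω) := by
  intro p hp
  obtain ⟨φ, hφ⟩ := hΩ.2 p hp
  have hc := (G.contDiffAt_lieGrad hφ.1).continuousAt
  have hn := norm_pos_iff.2 (G.lieGrad_ne_zero hφ.2.2.1)
  have : ContinuousAt (fun q => ‖G.lieGrad φ q‖⁻¹ • G.lieGrad φ q) p :=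
    (hc.norm.inv₀ hn.ne').smul hc
  refine this.continuousWithinAt.congr_of_eventuallyEq ?_ (G.outerNormal_eq hφ)
  filter_upwards [hφ.eventually hΩ.1] with q hq using G.outerNormal_eq hq

end ExpLieGroup

end Normal

/-! ### Graph charts of a C² boundary -/

section GraphCoord

variable {𝔤 : Type*} [NormedAddCommGroup 𝔤] [InnerProductSpace ℝ 𝔤]

/-- The linear coordinates given by an orthonormal basis, with the last coordinate set apart. -/
def OrthonormalBasis.splitLast [FiniteDimensional ℝ 𝔤] {n : ℕ}
    (b : OrthonormalBasis (Fin n ⊕ Unit) ℝ 𝔤) : (EuclideanSpace ℝ (Fin n) × ℝ) ≃L[ℝ] 𝔤 :=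
  LinearEquiv.toContinuousLinearEquiv
    { toFun := fun z => b.repr.symm (WithLp.toLp 2 (Sum.elim z.1 fun _ => z.2))
      map_add' := fun z w => by
        rw [← map_add]; congr 1; ext i; rcases i with i | i <;> simp
      map_smul' := fun c z => by
        rw [← map_smul]; congr 1; ext i; rcases i with i | i <;> simp
      invFun := fun q => (WithLp.toLp 2 fun i => b.repr q (Sum.inl i), b.repr q (Sum.inr ()))
      left_inv := fun z => by simp
      right_inv := fun q => by
        rw [LinearIsometryEquiv.symm_apply_eq]; ext i; rcases i with i | i <;> simp }

variable [FiniteDimensional ℝ 𝔤] {n : ℕ} (b : OrthonormalBasis (Fin n ⊕ Unit) ℝ 𝔤)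

theorem OrthonormalBasis.splitLast_apply (z : EuclideanSpace ℝ (Fin n) × ℝ) :
    b.splitLast z = b.repr.symm (WithLp.toLp 2 (Sum.elim z.1 fun _ => z.2)) := rfl

theorem OrthonormalBasis.splitLast_zero_one : b.splitLast (0, 1) = b (Sum.inr ()) := by
  rw [splitLast_apply, LinearIsometryEquiv.symm_apply_eq, b.repr_self]
  ext i; rcases i with i | i <;> simp

theorem OrthonormalBasis.splitLast_single (i : Fin n) :
    b.splitLast (EuclideanSpace.single i 1, 0) = b (Sum.inl i) := by
  rw [splitLast_apply, LinearIsometryEquiv.symm_apply_eq, b.repr_self]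
  ext j; rcases j with j | j <;> simp [Pi.single_apply]

theorem OrthonormalBasis.measurePreserving_splitLast [MeasurableSpace 𝔤] [BorelSpace 𝔤] :
    MeasurePreserving b.splitLast (volume : Measure (EuclideanSpace ℝ (Fin n) × ℝ)) volume := by
  have h1 : MeasurePreserving (Prod.map (@WithLp.ofLp 2 (Fin n → ℝ))
      (MeasurableEquiv.funUnique Unit ℝ).symm)
      (volume : Measure (EuclideanSpace ℝ (Fin n) × ℝ)) volume :=
    (PiLp.volume_preserving_ofLp (Fin n)).prod (volume_preserving_funUnique Unit ℝ).symm
  have h2 := (volume_measurePreserving_sumPiEquivProdPi_symm (fun _ : Fin n ⊕ Unit => ℝ)).comp h1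
  have h3 := (PiLp.volume_preserving_toLp (Fin n ⊕ Unit)).comp h2
  have h4 := b.measurePreserving_repr_symm.comp h3
  convert h4 using 1
  ext z
  simp only [Function.comp_apply, splitLast_apply]
  congr 2

end GraphCoord

/-- A box in orthonormal coordinates in which `Ω` is the subgraph of a `C²` function. -/
structure GraphChart {𝔤 : Type*} [NormedAddCommGroup 𝔤] [InnerProductSpace ℝ 𝔤]
    [FiniteDimensional ℝ 𝔤] (Ω : Set 𝔤) where
  basis : OrthonormalBasis (Fin (Module.finrank ℝ 𝔤 - 1) ⊕ Unit) ℝ 𝔤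
  base : Set (EuclideanSpace ℝ (Fin (Module.finrank ℝ 𝔤 - 1)))
  lower : ℝ
  upper : ℝ
  height : EuclideanSpace ℝ (Fin (Module.finrank ℝ 𝔤 - 1)) → ℝ
  isOpen_base : IsOpen base
  contDiffOn_height : ContDiffOn ℝ 2 height base
  height_mem : ∀ y ∈ base, height y ∈ Ioo lower upper
  mem_iff : ∀ y ∈ base, ∀ t ∈ Ioo lower upper, (basis.splitLast (y, t) ∈ Ω ↔ t < height y)

namespace GraphChart

variable {𝔤 : Type*} [NormedAddCommGroup 𝔤] [InnerProductSpace ℝ 𝔤] [FiniteDimensional ℝ 𝔤]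
  {Ω : Set 𝔤} (c : GraphChart Ω)

/-- The linear coordinates of a graph chart. -/
abbrev lin : (EuclideanSpace ℝ (Fin (Module.finrank ℝ 𝔤 - 1)) × ℝ) ≃L[ℝ] 𝔤 := c.basis.splitLast

/-- The open box on which `Ω` is a subgraph. -/
def box : Set 𝔤 := c.lin.symm ⁻¹' (c.base ×ˢ Ioo c.lower c.upper)

/-- The defining function `t - h (y)`. -/
def defFun (q : 𝔤) : ℝ := (c.lin.symm q).2 - c.height (c.lin.symm q).1

/-- The parametrization of the boundary as a graph. -/
def param (y : EuclideanSpace ℝ (Fin (Module.finrank ℝ 𝔤 - 1))) : 𝔤 := c.lin (y, c.height y)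

theorem isOpen_box : IsOpen c.box :=
  (c.isOpen_base.prod isOpen_Ioo).preimage c.lin.symm.continuous

theorem contDiffAt_defFun {q : 𝔤} (hq : (c.lin.symm q).1 ∈ c.base) : ContDiffAt ℝ 2 c.defFun q := by
  have h1 : ContDiffAt ℝ 2 c.height (c.lin.symm q).1 :=
    c.contDiffOn_height.contDiffAt (c.isOpen_base.mem_nhds hq)
  have h2 : ContDiffAt ℝ 2 (fun q => (c.lin.symm q).1) q :=
    (contDiff_fst.comp c.lin.symm.contDiff).contDiffAt
  have h3 : ContDiffAt ℝ 2 (fun q => (c.lin.symm q).2) q :=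
    (contDiff_snd.comp c.lin.symm.contDiff).contDiffAt
  exact h3.sub (ContDiffAt.comp q h1 h2)

theorem defFun_lin (y : EuclideanSpace ℝ (Fin (Module.finrank ℝ 𝔤 - 1))) (t : ℝ) :
    c.defFun (c.lin (y, t)) = t - c.height y := by
  simp [defFun]

theorem mem_iff_defFun_neg {q : 𝔤} (hq : q ∈ c.box) : q ∈ Ω ↔ c.defFun q < 0 := by
  have := c.mem_iff _ hq.1 _ hq.2
  rw [Prod.mk.eta, ContinuousLinearEquiv.apply_symm_apply] at this
  rw [this, defFun, sub_neg]

theorem fderiv_defFun_last {q : 𝔤} (hq : (c.lin.symm q).1 ∈ c.base) :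
    fderiv ℝ c.defFun q (c.basis (Sum.inr ())) = 1 := by
  have hd : DifferentiableAt ℝ c.defFun q := (c.contDiffAt_defFun hq).differentiableAt (by simp)
  have h1 : HasDerivAt (fun t : ℝ => q + t • c.basis (Sum.inr ())) (c.basis (Sum.inr ())) 0 := by
    simpa using ((hasDerivAt_id (0 : ℝ)).smul_const (c.basis (Sum.inr ()))).const_add q
  have h2 := HasFDerivAt.comp_hasDerivAt (l := c.defFun) 0 (f := fun t : ℝ =>
    q + t • c.basis (Sum.inr ())) (by simpa using hd.hasFDerivAt) h1
  refine h2.unique ?_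
  have h3 : c.defFun ∘ (fun t : ℝ => q + t • c.basis (Sum.inr ()))
      = fun t => t + c.defFun q := by
    ext t
    rw [← c.basis.splitLast_zero_one]
    simp only [Function.comp_apply, defFun, map_add, map_smul,
      ContinuousLinearEquiv.symm_apply_apply]
    simp
    ring
  rw [h3]
  exact (hasDerivAt_id (0 : ℝ)).add_const _

theorem isLocalDefiningFunction {q : 𝔤} (hq : q ∈ c.box) (h0 : c.defFun q = 0) :
    IsLocalDefiningFunction Ω q c.defFun := by
  refine ⟨c.contDiffAt_defFun hq.1, h0, fun h => ?_, ?_⟩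
  · have := c.fderiv_defFun_last hq.1
    rw [h] at this
    simp at this
  · filter_upwards [c.isOpen_box.mem_nhds hq] with z hz using c.mem_iff_defFun_neg hz

theorem mem_frontier_iff (hΩ : IsOpen Ω) {q : 𝔤} (hq : q ∈ c.box) :
    q ∈ frontier Ω ↔ c.defFun q = 0 := by
  refine ⟨fun h => ?_, fun h => (c.isLocalDefiningFunction hq h).mem_frontier hΩ⟩
  refine eq_zero_of_mem_frontier hΩ h (c.contDiffAt_defFun hq.1).continuousAt ?_
  filter_upwards [c.isOpen_box.mem_nhds hq] with z hz using c.mem_iff_defFun_neg hz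

theorem param_mem_box {y : EuclideanSpace ℝ (Fin (Module.finrank ℝ 𝔤 - 1))} (hy : y ∈ c.base) :
    c.param y ∈ c.box := by
  simp only [box, param, mem_preimage, ContinuousLinearEquiv.symm_apply_apply]
  exact ⟨hy, c.height_mem y hy⟩

theorem defFun_param (y : EuclideanSpace ℝ (Fin (Module.finrank ℝ 𝔤 - 1))) :
    c.defFun (c.param y) = 0 := by
  rw [param, defFun_lin, sub_self]

theorem param_mem_frontier (hΩ : IsOpen Ω) {y : EuclideanSpace ℝ (Fin (Module.finrank ℝ 𝔤 - 1))}
    (hy : y ∈ c.base) : c.param y ∈ frontier Ω :=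
  (c.mem_frontier_iff hΩ (c.param_mem_box hy)).2 (c.defFun_param y)

theorem symm_param_fst (y : EuclideanSpace ℝ (Fin (Module.finrank ℝ 𝔤 - 1))) :
    (c.lin.symm (c.param y)).1 = y := by simp [param]

theorem param_fst_of_defFun_eq_zero {q : 𝔤} (h : c.defFun q = 0) :
    c.param (c.lin.symm q).1 = q := by
  rw [param, ← c.lin.symm.injective.eq_iff, ContinuousLinearEquiv.symm_apply_apply]
  exact Prod.ext rfl (sub_eq_zero.1 h).symm

theorem contDiffOn_param : ContDiffOn ℝ 2 c.param c.base :=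
  c.lin.contDiff.comp_contDiffOn (contDiffOn_id.prodMk c.contDiffOn_height)

theorem hasFDerivAt_param {y : EuclideanSpace ℝ (Fin (Module.finrank ℝ 𝔤 - 1))} (hy : y ∈ c.base) :
    HasFDerivAt c.param ((c.lin : _ →L[ℝ] 𝔤).comp
      ((ContinuousLinearMap.id ℝ _).prod (fderiv ℝ c.height y))) y := by
  have hh : DifferentiableAt ℝ c.height y :=
    (c.contDiffOn_height.contDiffAt (c.isOpen_base.mem_nhds hy)).differentiableAt (by simp)
  exact c.lin.hasFDerivAt.comp y ((hasFDerivAt_id y).prodMk hh.hasFDerivAt)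

theorem fderiv_param {y : EuclideanSpace ℝ (Fin (Module.finrank ℝ 𝔤 - 1))} (hy : y ∈ c.base)
    (v : EuclideanSpace ℝ (Fin (Module.finrank ℝ 𝔤 - 1))) :
    fderiv ℝ c.param y v = c.lin (v, fderiv ℝ c.height y v) := by
  rw [(c.hasFDerivAt_param hy).fderiv]; rfl

theorem isBoundaryParam (hΩ : IsOpen Ω) :
    ExpLieGroup.IsBoundaryParam Ω c.base c.param := by
  refine ⟨c.isOpen_base, c.contDiffOn_param.of_le (by norm_num), fun y _ z _ h => ?_,
    fun y hy => c.param_mem_frontier hΩ hy, fun y hy v w h => ?_⟩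
  · rw [← c.symm_param_fst y, h, c.symm_param_fst]
  · rw [c.fderiv_param hy, c.fderiv_param hy] at h
    exact congrArg Prod.fst (c.lin.injective h)

theorem fderiv_defFun_fderiv_param
    {y : EuclideanSpace ℝ (Fin (Module.finrank ℝ 𝔤 - 1))} (hy : y ∈ c.base)
    (v : EuclideanSpace ℝ (Fin (Module.finrank ℝ 𝔤 - 1))) :
    fderiv ℝ c.defFun (c.param y) (fderiv ℝ c.param y v) = 0 := by
  have h1 : DifferentiableAt ℝ c.defFun (c.param y) :=
    (c.contDiffAt_defFun (c.param_mem_box hy).1).differentiableAt (by simp)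
  have h2 := h1.hasFDerivAt.comp y (c.hasFDerivAt_param hy).differentiableAt.hasFDerivAt
  have h3 : c.defFun ∘ c.param = fun _ => 0 := funext c.defFun_param
  rw [h3] at h2
  exact DFunLike.congr_fun (h2.unique (hasFDerivAt_const _ _)) v

/-- Tangent vectors at a boundary point are in the range of the differential of the
parametrization. -/
theorem exists_fderiv_param_eq {y : EuclideanSpace ℝ (Fin (Module.finrank ℝ 𝔤 - 1))}
    (hy : y ∈ c.base) {w : 𝔤} (hw : fderiv ℝ c.defFun (c.param y) w = 0) :
    ∃ v, fderiv ℝ c.param y v = w := by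
  refine ⟨(c.lin.symm w).1, ?_⟩
  set v := (c.lin.symm w).1
  have e : w = fderiv ℝ c.param y v
      + ((c.lin.symm w).2 - fderiv ℝ c.height y v) • c.basis (Sum.inr ()) := by
    rw [c.fderiv_param hy, ← c.basis.splitLast_zero_one, ← map_smul, ← map_add,
      ← ContinuousLinearEquiv.symm_apply_eq]
    refine Prod.ext ?_ ?_
    · simp [v]
    · simp
  have h := hw
  rw [e, map_add, c.fderiv_defFun_fderiv_param hy, map_smul,
    c.fderiv_defFun_last (c.param_mem_box hy).1, zero_add, smul_eq_mul, mul_one] at h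
  rw [h, zero_smul, add_zero] at e
  exact e.symm

end GraphChart

/-- Take the normalized Euclidean gradient of a defining function as last basis vector. The implicit
function theorem solves φ = 0 for the last coordinate, and the box is shrunk until φ is strictly
increasing in that coordinate. -/
theorem IsC2Open.exists_graphChart {𝔤 : Type*} [NormedAddCommGroup 𝔤] [InnerProductSpace ℝ 𝔤]
    [FiniteDimensional ℝ 𝔤] {Ω : Set 𝔤} (hΩ : IsC2Open Ω) {p : 𝔤} (hp : p ∈ frontier Ω) :
    ∃ c : GraphChart Ω, p ∈ c.box := by
  obtain ⟨φ, hφ⟩ := hΩ.2 p hp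
  set g : 𝔤 := (InnerProductSpace.toDual ℝ 𝔤).symm (fderiv ℝ φ p) with hg
  have hgi : ∀ v, ⟪g, v⟫ = fderiv ℝ φ p v := fun v => by
    rw [hg, InnerProductSpace.toDual_symm_apply]
  have hg0 : g ≠ 0 := fun h => hφ.2.2.1 (ContinuousLinearMap.ext fun v => by
    rw [← hgi, h, inner_zero_left]; rfl)
  have hgn : 0 < ‖g‖ := norm_pos_iff.2 hg0
  have hnt : Nontrivial 𝔤 := ⟨g, 0, hg0⟩
  have hdim : 0 < Module.finrank ℝ 𝔤 := Module.finrank_pos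
  obtain ⟨b, hb⟩ := Orthonormal.exists_orthonormalBasis_extension_of_card_eq (𝕜 := ℝ) (E := 𝔤)
    (ι := Fin (Module.finrank ℝ 𝔤 - 1) ⊕ Unit) (by simp; omega)
    (v := fun _ => ‖g‖⁻¹ • g) (s := {Sum.inr ()}) (by
      refine ⟨fun i => ?_, fun i j hij => absurd (Subsingleton.elim i j) hij⟩
      simp only [domRestrict_apply]
      rw [norm_smul, norm_inv, norm_norm, inv_mul_cancel₀ hgn.ne'])
  have hb' : b (Sum.inr ()) = ‖g‖⁻¹ • g := hb _ rfl
  have hbpos : 0 < fderiv ℝ φ p (b (Sum.inr ())) := by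
    rw [hb', ← hgi, inner_smul_right, real_inner_self_eq_norm_sq]
    positivity
  set L := b.splitLast with hL
  set f : EuclideanSpace ℝ (Fin (Module.finrank ℝ 𝔤 - 1)) × ℝ → ℝ := fun z => φ (L z) with hf
  set z₀ := L.symm p with hz₀
  have hLz : L z₀ = p := L.apply_symm_apply p
  have hfc : ContDiffAt ℝ 2 f z₀ :=
    ContDiffAt.comp z₀ (by rw [hLz]; exact hφ.1) L.contDiff.contDiffAt
  have hfz : f z₀ = 0 := by simp only [hf, hLz]; exact hφ.2.1
  have hfd : fderiv ℝ f z₀ (0, 1) = fderiv ℝ φ p (b (Sum.inr ())) := by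
    have h1 : HasFDerivAt f ((fderiv ℝ φ p).comp (L : _ →L[ℝ] 𝔤)) z₀ :=
      HasFDerivAt.comp z₀ (by rw [hLz]; exact hφ.differentiableAt.hasFDerivAt) L.hasFDerivAt
    rw [h1.fderiv, ← b.splitLast_zero_one]; rfl
  have hinv : (fderiv ℝ f z₀ ∘L
      .inr ℝ (EuclideanSpace ℝ (Fin (Module.finrank ℝ 𝔤 - 1))) ℝ).IsInvertible := by
    refine ⟨ContinuousLinearEquiv.unitsEquivAut ℝ (Units.mk0 (fderiv ℝ f z₀ (0, 1)) ?_), ?_⟩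
    · rw [hfd]; exact hbpos.ne'
    · ext; simp
  set h := hfc.implicitFunction (by simp) hinv with hh
  have hh0 : h z₀.1 = z₀.2 := hfc.implicitFunction_apply_self _ hinv
  have hhc : ContDiffAt ℝ 2 h z₀.1 := hfc.contDiffAt_implicitFunction _ hinv
  have hhz : ∀ᶠ y in 𝓝 z₀.1, f (y, h y) = 0 := by
    have := hfc.eventually_apply_implicitFunction (by simp) hinv
    rwa [hfz] at this
  have e1 : ∀ᶠ z in 𝓝 z₀, DifferentiableAt ℝ f z :=
    (hfc.eventually (by simp)).mono fun z hz => hz.differentiableAt (by simp)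
  have e2 : ∀ᶠ z in 𝓝 z₀, 0 < fderiv ℝ f z (0, 1) := by
    have hc : ContinuousAt (fun z => fderiv ℝ f z (0, 1)) z₀ :=
      (hfc.fderiv_right (m := 1) (by norm_num)).continuousAt.clm_apply continuousAt_const
    exact hc.eventually_const_lt (hbpos.trans_eq hfd.symm)
  have e3 : ∀ᶠ z in 𝓝 z₀, (L z ∈ Ω ↔ f z < 0) := by
    have : Filter.Tendsto L (𝓝 z₀) (𝓝 p) := by
      rw [← hLz]; exact L.continuous.continuousAt
    exact this.eventually hφ.2.2.2
  have e := e1.and (e2.and e3)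
  rw [show z₀ = (z₀.1, z₀.2) from rfl, nhds_prod_eq, Filter.eventually_prod_iff] at e
  obtain ⟨P, hP, Q, hQ, hPQ⟩ := e
  obtain ⟨δ, hδ, hball⟩ := Metric.eventually_nhds_iff_ball.1 hQ
  have hI : ∀ t ∈ Ioo (z₀.2 - δ) (z₀.2 + δ), Q t := fun t ht => hball t (by
    rw [Real.ball_eq_Ioo]; exact ht)
  have hhI : ∀ᶠ y in 𝓝 z₀.1, h y ∈ Ioo (z₀.2 - δ) (z₀.2 + δ) :=
    hhc.continuousAt.eventually_mem (by
      rw [hh0]; exact Ioo_mem_nhds (by linarith) (by linarith))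
  obtain ⟨U, hU, hUo, hzU⟩ := eventually_nhds_iff.1
    (hP.and (hhI.and (hhz.and (hhc.eventually (by simp)))))
  refine ⟨⟨b, U, z₀.2 - δ, z₀.2 + δ, h, hUo, fun y hy => (hU y hy).2.2.2.contDiffWithinAt,
    fun y hy => (hU y hy).2.1, fun y hy t ht => ?_⟩, ?_⟩
  · obtain ⟨hy1, hy2, hy3, -⟩ := hU y hy
    rw [(hPQ hy1 (hI t ht)).2.2, ← hy3]
    have hder : ∀ s ∈ Ioo (z₀.2 - δ) (z₀.2 + δ),
        HasDerivAt (fun s => f (y, s)) (fderiv ℝ f (y, s) (0, 1)) s := fun s hs =>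
      HasFDerivAt.comp_hasDerivAt (l := f) s (f := fun s => (y, s))
        (hPQ hy1 (hI s hs)).1.hasFDerivAt ((hasDerivAt_const s y).prodMk (hasDerivAt_id s))
    -- Monotonicity turns the sign condition f(y,t) < 0 = f(y,h(y)) into t < h(y).
    have hmono : StrictMonoOn (fun s => f (y, s)) (Ioo (z₀.2 - δ) (z₀.2 + δ)) := by
      refine strictMonoOn_of_deriv_pos (convex_Ioo _ _)
        (fun s hs => (hder s hs).continuousAt.continuousWithinAt) fun s hs => ?_
      rw [interior_Ioo] at hs
      rw [(hder s hs).deriv]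
      exact (hPQ hy1 (hI s hs)).2.1
    exact hmono.lt_iff_lt ht hy2
  · exact ⟨hzU, by simp only [mem_Ioo]; constructor <;> linarith⟩

/-- A tangent vector is the image of some w under the differential of the graph parametrization. The
function f composed with the parametrization vanishes nearby, so the chain rule gives zero. Only
one-sided differentiability of f is required, because the graph stays in the closure. -/
theorem fderivWithin_eq_zero_of_tangent {𝔤 : Type*} [NormedAddCommGroup 𝔤] [InnerProductSpace ℝ 𝔤]
    [FiniteDimensional ℝ 𝔤] {Ω : Set 𝔤} (hΩ : IsC2Open Ω) {p : 𝔤} {φ f : 𝔤 → ℝ}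
    (hφ : IsLocalDefiningFunction Ω p φ) (hf : DifferentiableWithinAt ℝ f (closure Ω) p)
    (h0 : ∀ᶠ q in 𝓝[frontier Ω] p, f q = 0) {v : 𝔤} (hv : fderiv ℝ φ p v = 0) :
    fderivWithin ℝ f (closure Ω) p v = 0 := by
  have hp := hφ.mem_frontier hΩ.1
  obtain ⟨c, hc⟩ := hΩ.exists_graphChart hp
  have hcp : c.defFun p = 0 := (c.mem_frontier_iff hΩ.1 hc).1 hp
  set y := (c.lin.symm p).1 with hy
  have hyb : y ∈ c.base := hc.1
  have hyp : c.param y = p := c.param_fst_of_defFun_eq_zero hcp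
  obtain ⟨d, hd, hdφ⟩ := hφ.exists_fderiv_eq_smul (c.isLocalDefiningFunction hc hcp)
  obtain ⟨w, hw⟩ := c.exists_fderiv_param_eq hyb (w := v) (by rw [hyp, hdφ]; simp [hv])
  have hmaps : MapsTo c.param c.base (closure Ω) := fun z hz =>
    frontier_subset_closure (c.param_mem_frontier hΩ.1 hz)
  have hpd := (c.hasFDerivAt_param hyb).differentiableAt.hasFDerivAt
  have hcomp : HasFDerivWithinAt (f ∘ c.param)
      ((fderivWithin ℝ f (closure Ω) p).comp (fderiv ℝ c.param y)) c.base y := by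
    refine HasFDerivWithinAt.comp (t := closure Ω) y ?_ hpd.hasFDerivWithinAt hmaps
    rw [hyp]; exact hf.hasFDerivWithinAt
  have hcomp' := hcomp.hasFDerivAt (c.isOpen_base.mem_nhds hyb)
  have hzero : f ∘ c.param =ᶠ[𝓝 y] fun _ => 0 := by
    have ht : Filter.Tendsto c.param (𝓝 y) (𝓝[frontier Ω] p) := by
      refine tendsto_nhdsWithin_iff.2 ⟨by rw [← hyp]; exact hpd.continuousAt, ?_⟩
      filter_upwards [c.isOpen_base.mem_nhds hyb] with z hz using c.param_mem_frontier hΩ.1 hz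
    exact ht.eventually h0
  have := hcomp'.unique ((hasFDerivAt_const (0 : ℝ) y).congr_of_eventuallyEq hzero)
  have h2 := DFunLike.congr_fun this w
  rw [ContinuousLinearMap.comp_apply, hw] at h2
  simpa using h2

/-! ### Area density and surface measure -/

section Gram

variable {𝔤 : Type*} [NormedAddCommGroup 𝔤] [InnerProductSpace ℝ 𝔤]

theorem OrthonormalBasis.of_inner_mul_transpose {ι κ κ' : Type*} [Fintype ι]
    (b : OrthonormalBasis ι ℝ 𝔤) (v : κ → 𝔤) (w : κ' → 𝔤) :
    (Matrix.of fun i k => ⟪b k, v i⟫) * (Matrix.of fun i k => ⟪b k, w i⟫).transpose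
      = Matrix.of fun i j => ⟪v i, w j⟫ := by
  ext i j
  simp only [Matrix.mul_apply, Matrix.of_apply, Matrix.transpose_apply]
  rw [← b.sum_inner_mul_inner (v i) (w j)]
  refine Finset.sum_congr rfl fun k _ => ?_
  rw [real_inner_comm]

/-- The area of a face of a parallelepiped of volume one is the inverse of its height. -/
theorem OrthonormalBasis.sqrt_det_gram_eq {n : ℕ} (b : OrthonormalBasis (Fin n ⊕ Unit) ℝ 𝔤)
    (v : Fin n ⊕ Unit → 𝔤) (hdet : (Matrix.of fun i k => ⟪b k, v i⟫).det = 1) {ν : 𝔤}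
    (hν : ‖ν‖ = 1) {c : ℝ} (hc : 0 < c) (h0 : ∀ a, ⟪ν, v (Sum.inl a)⟫ = 0)
    (h1 : c * ⟪ν, v (Sum.inr ())⟫ = 1) :
    √(Matrix.of fun a a' => ⟪v (Sum.inl a), v (Sum.inl a')⟫).det = c := by
  set g := Matrix.of fun a a' => ⟪v (Sum.inl a), v (Sum.inl a')⟫ with hg
  set w : Fin n ⊕ Unit → 𝔤 := Sum.elim (fun a => v (Sum.inl a)) fun _ => ν with hw
  set M : Matrix (Fin n ⊕ Unit) (Fin n ⊕ Unit) ℝ := Matrix.of fun i k => ⟪b k, v i⟫ with hM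
  set N : Matrix (Fin n ⊕ Unit) (Fin n ⊕ Unit) ℝ := Matrix.of fun i k => ⟪b k, w i⟫ with hN
  have hc' : ⟪ν, v (Sum.inr ())⟫ = c⁻¹ := by
    field_simp; linarith
  -- N is M with its last vector replaced by the unit normal. Then N Nᵀ = diag(g, 1) gives (det N)²
  -- = det g, while the block triangular N Mᵀ gives det N = c⁻¹ det g. Hence det N = c and det g =
  -- c², provided det N ≠ 0.
  have e1 : N * N.transpose = Matrix.fromBlocks g 0 0 1 := by
    rw [hN, b.of_inner_mul_transpose]
    ext i j
    rcases i with i | i <;> rcases j with j | j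
    · simp [hw, hg]
    · simp [hw, real_inner_comm ν, h0]
    · simp [hw, h0]
    · simp [hw, hν]
  have e2 : N * M.transpose
      = Matrix.fromBlocks g (Matrix.of fun a _ => ⟪v (Sum.inl a), v (Sum.inr ())⟫) 0
        (Matrix.of fun _ _ => c⁻¹) := by
    rw [hN, hM, b.of_inner_mul_transpose]
    ext i j
    rcases i with i | i <;> rcases j with j | j
    · simp [hw, hg]
    · simp [hw]
    · simp [hw, h0]
    · simp [hw, hc']
  have d1 := congrArg Matrix.det e1
  have d2 := congrArg Matrix.det e2
  rw [Matrix.det_mul, Matrix.det_transpose, Matrix.det_fromBlocks_zero₂₁] at d1 d2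
  rw [hdet] at d2
  rw [Matrix.det_one, mul_one] at d1
  have hu : (Matrix.of fun (_ _ : Unit) => c⁻¹).det = c⁻¹ := by
    rw [Matrix.det_unique, Matrix.of_apply]
  rw [mul_one, hu] at d2
  -- If xN = 0, multiplying by Nᵀ shows that the coefficient of the normal in x is zero. Then x also
  -- annihilates M, whose determinant is 1.
  have hN0 : N.det ≠ 0 := by
    intro h
    obtain ⟨x, hx0, hx⟩ := Matrix.exists_vecMul_eq_zero_iff.2 h
    have hxi : x (Sum.inr ()) = 0 := by
      have := congrArg (fun y => Matrix.vecMul y N.transpose) hx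
      simp only [Matrix.vecMul_vecMul, e1, Matrix.zero_vecMul] at this
      have h2 := congrFun this (Sum.inr ())
      simpa [Matrix.vecMul, dotProduct] using h2
    have hxM : Matrix.vecMul x M = 0 := by
      rw [← hx]
      ext k
      simp only [Matrix.vecMul, dotProduct, Fintype.sum_sum_type, hM, hN, hw, Matrix.of_apply,
        Sum.elim_inl]
      simp [hxi]
    exact one_ne_zero (hdet.symm.trans (Matrix.exists_vecMul_eq_zero_iff.1 ⟨x, hx0, hxM⟩))
  have hNc : N.det = c := by
    rw [← d1] at d2
    field_simp at d2
    linarith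
  rw [← d1, hNc, Real.sqrt_mul_self hc.le]

theorem EuclideanSpace.eq_sum_single {n : ℕ} (x : EuclideanSpace ℝ (Fin n)) :
    x = ∑ k, x k • EuclideanSpace.single k (1 : ℝ) := by
  ext i
  simp [Finset.sum_apply, Pi.single_apply]

theorem ContinuousLinearMap.det_eq_det_of {n : ℕ}
    (T : EuclideanSpace ℝ (Fin n) →L[ℝ] EuclideanSpace ℝ (Fin n)) :
    T.det = (Matrix.of fun k a => T (EuclideanSpace.single a 1) k).det := by
  rw [ContinuousLinearMap.det, ← LinearMap.det_toMatrix (EuclideanSpace.basisFun (Fin n) ℝ).toBasis]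
  congr 1

theorem ContinuousLinearMap.det_gram_comp {n : ℕ} (Φ : EuclideanSpace ℝ (Fin n) →L[ℝ] 𝔤)
    (T : EuclideanSpace ℝ (Fin n) →L[ℝ] EuclideanSpace ℝ (Fin n)) :
    (Matrix.of fun a a' => ⟪Φ (T (EuclideanSpace.single a 1)),
        Φ (T (EuclideanSpace.single a' 1))⟫).det
      = T.det ^ 2 * (Matrix.of fun a a' => ⟪Φ (EuclideanSpace.single a 1),
        Φ (EuclideanSpace.single a' 1)⟫).det := by
  set M : Matrix (Fin n) (Fin n) ℝ := Matrix.of fun k a => T (EuclideanSpace.single a 1) k with hM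
  set g : Matrix (Fin n) (Fin n) ℝ := Matrix.of fun a a' => ⟪Φ (EuclideanSpace.single a 1),
        Φ (EuclideanSpace.single a' 1)⟫ with hg
  have e : (Matrix.of fun a a' => ⟪Φ (T (EuclideanSpace.single a 1)),
      Φ (T (EuclideanSpace.single a' 1))⟫) = M.transpose * (g * M) := by
    ext a a'
    simp only [Matrix.of_apply]
    conv_lhs => rw [EuclideanSpace.eq_sum_single (T (EuclideanSpace.single a 1)),
      EuclideanSpace.eq_sum_single (T (EuclideanSpace.single a' 1))]
    simp only [map_sum, map_smul, sum_inner, inner_sum, inner_smul_left, inner_smul_right,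
      Matrix.mul_apply, Matrix.transpose_apply, hM, hg, Matrix.of_apply, Finset.mul_sum]
    rw [Finset.sum_comm]
    refine Finset.sum_congr rfl fun k _ => Finset.sum_congr rfl fun l _ => ?_
    simp
    ring
  rw [e, Matrix.det_mul, Matrix.det_mul, Matrix.det_transpose, ContinuousLinearMap.det_eq_det_of]
  ring

end Gram

namespace GraphChart

variable {𝔤 : Type*} [NormedAddCommGroup 𝔤] [InnerProductSpace ℝ 𝔤] [FiniteDimensional ℝ 𝔤]
  {Ω : Set 𝔤} (c : GraphChart Ω) (G : CarnotGroup 𝔤)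

/-- Translated to the identity, the tangent vectors ∂_aψ and the last basis vector have as matrix a
shear times the matrix of the left translation, and both have determinant 1. Since dφ kills the ∂_aψ
and is 1 on the last basis vector, the height of the parallelepiped over its tangential face is
1/‖∇φ‖, so that face has area ‖∇φ‖. -/
theorem areaDensity_param {y : EuclideanSpace ℝ (Fin (Module.finrank ℝ 𝔤 - 1))} (hy : y ∈ c.base) :
    G.areaDensity c.param y = ‖G.lieGrad c.defFun (c.param y)‖ := by
  set p := c.param y with hp
  have hφ : IsLocalDefiningFunction Ω p c.defFun :=
    c.isLocalDefiningFunction (c.param_mem_box hy) (c.defFun_param y)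
  set v : Fin (Module.finrank ℝ 𝔤 - 1) ⊕ Unit → 𝔤 := Sum.elim
    (fun a => G.toLie p (fderiv ℝ c.param y (EuclideanSpace.single a 1)))
    (fun _ => G.toLie p (c.basis (Sum.inr ()))) with hv
  have hinner : ∀ w, ‖G.lieGrad c.defFun p‖ * ⟪G.outerNormal Ω p, G.toLie p w⟫
      = fderiv ℝ c.defFun p w := fun w => by
    rw [← G.fderiv_leftField_eq_norm_mul hφ, G.leftField_toLie]
  have hpos : 0 < ‖G.lieGrad c.defFun p‖ := norm_pos_iff.2 (G.lieGrad_ne_zero hφ.2.2.1)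
  refine c.basis.sqrt_det_gram_eq v ?_ (G.norm_outerNormal hφ) hpos (fun a => ?_) ?_
  · set T : 𝔤 →L[ℝ] 𝔤 := fderiv ℝ (G.mul (-p)) p with hT
    have e : (Matrix.of fun i k => ⟪c.basis k, v i⟫)
        = Matrix.fromBlocks 1 (Matrix.of fun a _ => fderiv ℝ c.height y (EuclideanSpace.single a 1))
          0 1 * (LinearMap.toMatrix c.basis.toBasis c.basis.toBasis (T : 𝔤 →ₗ[ℝ] 𝔤)).transpose := by
      have hN : ∀ i k, (LinearMap.toMatrix c.basis.toBasis c.basis.toBasis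
          (T : 𝔤 →ₗ[ℝ] 𝔤)).transpose i k = ⟪c.basis k, T (c.basis i)⟫ := fun i k => by
        rw [Matrix.transpose_apply, LinearMap.toMatrix_apply]
        simp [c.basis.repr_apply_apply]
      ext i k
      rw [Matrix.mul_apply, Fintype.sum_sum_type]
      simp only [hN, Matrix.of_apply]
      rcases i with a | i
      · have : v (Sum.inl a) = T (c.basis (Sum.inl a))
            + fderiv ℝ c.height y (EuclideanSpace.single a 1) • T (c.basis (Sum.inr ())) := by
          rw [hv, Sum.elim_inl, c.fderiv_param hy]
          have : (EuclideanSpace.single a (1 : ℝ),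
              fderiv ℝ c.height y (EuclideanSpace.single a 1))
              = (EuclideanSpace.single a (1 : ℝ), (0 : ℝ))
                + fderiv ℝ c.height y (EuclideanSpace.single a 1)
                  • ((0 : EuclideanSpace ℝ _), (1 : ℝ)) := by
            ext <;> simp
          rw [this, map_add, map_smul, c.basis.splitLast_single, c.basis.splitLast_zero_one]
          change T _ = _
          rw [map_add, map_smul]
        rw [this, inner_add_right, inner_smul_right]
        simp [Matrix.one_apply]
      · simp [hv]
        rfl
    rw [e, Matrix.det_mul, Matrix.det_fromBlocks_zero₂₁, Matrix.det_transpose,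
      LinearMap.det_toMatrix]
    have := G.det_toLie p
    rw [ContinuousLinearMap.det] at this
    rw [this]; simp
  · have := hinner (fderiv ℝ c.param y (EuclideanSpace.single a 1))
    rw [hp, c.fderiv_defFun_fderiv_param hy] at this
    exact (mul_eq_zero.1 this).resolve_left hpos.ne'
  · have := hinner (c.basis (Sum.inr ()))
    rwa [c.fderiv_defFun_last (c.param_mem_box hy).1] at this

theorem continuousOn_areaDensity_param : ContinuousOn (G.areaDensity c.param) c.base := by
  refine ContinuousOn.congr (f := fun y => ‖G.lieGrad c.defFun (c.param y)‖) ?_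
    fun y hy => c.areaDensity_param G hy
  intro y hy
  have h1 := (G.contDiffAt_lieGrad (c.contDiffAt_defFun (c.param_mem_box hy).1)).continuousAt
  exact (ContinuousAt.comp h1 (c.hasFDerivAt_param hy).continuousAt).norm.continuousWithinAt

end GraphChart

theorem ContinuousOn.measurableSet_inter_preimage {α β : Type*} [TopologicalSpace α]
    [MeasurableSpace α] [BorelSpace α] [TopologicalSpace β] [MeasurableSpace β] [BorelSpace β]
    {f : α → β} {U : Set α} (hf : ContinuousOn f U) (hU : MeasurableSet U) {A : Set β}
    (hA : MeasurableSet A) : MeasurableSet (U ∩ f ⁻¹' A) := by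
  have h1 : MeasurableSet ((U.domRestrict f) ⁻¹' A) := hf.domRestrict.measurable hA
  have h2 := hU.subtype_image h1
  convert h2 using 1
  ext x
  simp only [mem_inter_iff, mem_preimage, mem_image, Subtype.exists, exists_and_right,
    exists_eq_right, domRestrict_apply, exists_prop]

namespace ExpLieGroup

section

variable {𝔤 : Type*} [NormedAddCommGroup 𝔤] [InnerProductSpace ℝ 𝔤]
  [MeasurableSpace 𝔤] (G : ExpLieGroup 𝔤) {Ω : Set 𝔤}

/-- The image under a parametrization of its area measure. -/
def areaMeasure (U : Set (EuclideanSpace ℝ (Fin (Module.finrank ℝ 𝔤 - 1))))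
    (ψ : EuclideanSpace ℝ (Fin (Module.finrank ℝ 𝔤 - 1)) → 𝔤) : Measure 𝔤 :=
  Measure.map ψ ((volume.restrict U).withDensity fun x => ENNReal.ofReal (G.areaDensity ψ x))

variable {U : Set (EuclideanSpace ℝ (Fin (Module.finrank ℝ 𝔤 - 1)))}
  {ψ : EuclideanSpace ℝ (Fin (Module.finrank ℝ 𝔤 - 1)) → 𝔤}

theorem areaMeasure_le_surfaceMeasure (h : IsBoundaryParam Ω U ψ) :
    G.areaMeasure U ψ ≤ G.surfaceMeasure Ω :=
  le_iSup_of_le U (le_iSup_of_le ψ (le_iSup_of_le h le_rfl))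

theorem surfaceMeasure_le {μ : Measure 𝔤} (h : ∀ U ψ, IsBoundaryParam Ω U ψ →
    G.areaMeasure U ψ ≤ μ) : G.surfaceMeasure Ω ≤ μ :=
  iSup_le fun U => iSup_le fun ψ => iSup_le fun hψ => h U ψ hψ

variable [BorelSpace 𝔤]

theorem IsBoundaryParam.aemeasurable (h : IsBoundaryParam Ω U ψ) :
    AEMeasurable ψ (volume.restrict U) :=
  h.2.1.continuousOn.aemeasurable h.1.measurableSet

theorem IsBoundaryParam.aemeasurable_withDensity (h : IsBoundaryParam Ω U ψ) :
    AEMeasurable ψ ((volume.restrict U).withDensity fun x => ENNReal.ofReal (G.areaDensity ψ x)) :=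
  h.aemeasurable.mono_ac (withDensity_absolutelyContinuous _ _)

theorem areaMeasure_apply (h : IsBoundaryParam Ω U ψ) {A : Set 𝔤} (hA : MeasurableSet A) :
    G.areaMeasure U ψ A = ∫⁻ x in U ∩ ψ ⁻¹' A, ENNReal.ofReal (G.areaDensity ψ x) := by
  rw [areaMeasure, Measure.map_apply_of_aemeasurable (h.aemeasurable_withDensity G) hA,
    withDensity_apply', Measure.restrict_restrict' h.1.measurableSet, inter_comm]

theorem areaMeasure_compl_frontier (h : IsBoundaryParam Ω U ψ) :
    G.areaMeasure U ψ (frontier Ω)ᶜ = 0 := by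
  rw [G.areaMeasure_apply h isClosed_frontier.measurableSet.compl]
  have : U ∩ ψ ⁻¹' (frontier Ω)ᶜ = ∅ :=
    eq_empty_of_forall_notMem fun x hx => hx.2 (h.2.2.2.1 hx.1)
  rw [this]; simp

theorem restrict_surfaceMeasure_frontier :
    (G.surfaceMeasure Ω).restrict (frontier Ω) = G.surfaceMeasure Ω := by
  refine le_antisymm Measure.restrict_le_self (G.surfaceMeasure_le fun U ψ h => ?_)
  have : (G.areaMeasure U ψ).restrict (frontier Ω) = G.areaMeasure U ψ :=
    Measure.restrict_eq_self_of_ae_mem (by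
      rw [ae_iff]; exact G.areaMeasure_compl_frontier h)
  rw [← this]
  exact Measure.restrict_mono le_rfl (G.areaMeasure_le_surfaceMeasure h)

end

end ExpLieGroup

namespace GraphChart

variable {𝔤 : Type*} [NormedAddCommGroup 𝔤] [InnerProductSpace ℝ 𝔤] [FiniteDimensional ℝ 𝔤]
  [MeasurableSpace 𝔤] [BorelSpace 𝔤] {Ω : Set 𝔤} (c : GraphChart Ω)

/-- Inside the box ψ factors as the graph parametrization after τ, the base coordinates of ψ. Gram
determinants scale by (det dτ)², so the change of variables along the injective τ compares the two
areas. Only an inequality holds, because ψ need not cover all of A ∩ ∂Ω. -/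
theorem areaMeasure_le_of_subset_box (G : ExpLieGroup 𝔤) (hΩ : IsOpen Ω)
    {U : Set (EuclideanSpace ℝ (Fin (Module.finrank ℝ 𝔤 - 1)))}
    {ψ : EuclideanSpace ℝ (Fin (Module.finrank ℝ 𝔤 - 1)) → 𝔤}
    (h : ExpLieGroup.IsBoundaryParam Ω U ψ) {A : Set 𝔤} (hA : MeasurableSet A) (hAb : A ⊆ c.box) :
    G.areaMeasure U ψ A ≤ G.areaMeasure c.base c.param A := by
  rw [G.areaMeasure_apply h hA, G.areaMeasure_apply (c.isBoundaryParam hΩ) hA]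
  set S := U ∩ ψ ⁻¹' A with hS
  set τ : EuclideanSpace ℝ (Fin (Module.finrank ℝ 𝔤 - 1)) →
    EuclideanSpace ℝ (Fin (Module.finrank ℝ 𝔤 - 1)) := fun x => (c.lin.symm (ψ x)).1 with hτ
  have hSm : MeasurableSet S :=
    h.2.1.continuousOn.measurableSet_inter_preimage h.1.measurableSet hA
  have hpτ : ∀ x ∈ U, ψ x ∈ c.box → c.param (τ x) = ψ x := fun x hx hb =>
    c.param_fst_of_defFun_eq_zero ((c.mem_frontier_iff hΩ hb).1 (h.2.2.2.1 hx))
  have hψd : ∀ x ∈ U, DifferentiableAt ℝ ψ x := fun x hx =>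
    (h.2.1.contDiffAt (h.1.mem_nhds hx)).differentiableAt (by simp)
  have hτd : ∀ x ∈ U, DifferentiableAt ℝ τ x := fun x hx =>
    (differentiable_fst.comp c.lin.symm.differentiable).differentiableAt.comp x (hψd x hx)
  have hinj : InjOn τ S := fun x hx z hz hxz => h.2.2.1 hx.1 hz.1 (by
    rw [← hpτ x hx.1 (hAb hx.2), ← hpτ z hz.1 (hAb hz.2), hxz])
  have hchain : ∀ x ∈ S, fderiv ℝ ψ x = (fderiv ℝ c.param (τ x)).comp (fderiv ℝ τ x) := by
    intro x hx
    have hb : c.param (τ x) = ψ x := hpτ x hx.1 (hAb hx.2)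
    have hτb : τ x ∈ c.base := (hAb hx.2).1
    have h1 := (c.hasFDerivAt_param hτb).differentiableAt.hasFDerivAt.comp x
      (hτd x hx.1).hasFDerivAt
    refine HasFDerivAt.fderiv (h1.congr_of_eventuallyEq ?_)
    filter_upwards [h.1.mem_nhds hx.1, (hψd x hx.1).continuousAt.eventually_mem
      (c.isOpen_box.mem_nhds (hAb hx.2))] with z hz hzb using (hpτ z hz hzb).symm
  have hdens : ∀ x ∈ S, G.areaDensity ψ x
      = |(fderiv ℝ τ x).det| * G.areaDensity c.param (τ x) := by
    intro x hx
    have hb : c.param (τ x) = ψ x := hpτ x hx.1 (hAb hx.2)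
    rw [ExpLieGroup.areaDensity, ExpLieGroup.areaDensity, hchain x hx, hb]
    have := ContinuousLinearMap.det_gram_comp
      ((fderiv ℝ (G.mul (-(ψ x))) (ψ x)).comp (fderiv ℝ c.param (τ x))) (fderiv ℝ τ x)
    have h2 := congrArg Real.sqrt this
    rw [Real.sqrt_mul (sq_nonneg _), Real.sqrt_sq_eq_abs] at h2
    exact h2
  have hlint := lintegral_image_eq_lintegral_abs_det_fderiv_mul volume hSm
    (fun x hx => (hτd x hx.1).hasFDerivAt.hasFDerivWithinAt) hinj
    (fun y => ENNReal.ofReal (G.areaDensity c.param y))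
  have e : ∫⁻ x in S, ENNReal.ofReal (G.areaDensity ψ x)
      = ∫⁻ x in S, ENNReal.ofReal |(fderiv ℝ τ x).det|
        * ENNReal.ofReal (G.areaDensity c.param (τ x)) := by
    refine setLIntegral_congr_fun hSm fun x hx => ?_
    rw [hdens x hx, ENNReal.ofReal_mul (abs_nonneg _)]
  rw [e, ← hlint]
  refine lintegral_mono_set ?_
  rintro _ ⟨x, hx, rfl⟩
  refine ⟨(hAb hx.2).1, ?_⟩
  rw [mem_preimage, hpτ x hx.1 (hAb hx.2)]
  exact hx.2

/-- Inside the box the supremum over all parametrizations is attained by the graph. -/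
theorem restrict_surfaceMeasure_box (G : ExpLieGroup 𝔤) (hΩ : IsOpen Ω) :
    (G.surfaceMeasure Ω).restrict c.box = G.areaMeasure c.base c.param := by
  have hbox := c.isOpen_box.measurableSet
  have hself : (G.areaMeasure c.base c.param).restrict c.box = G.areaMeasure c.base c.param := by
    refine Measure.restrict_eq_self_of_ae_mem ?_
    rw [ae_iff]
    change G.areaMeasure c.base c.param c.boxᶜ = 0
    rw [G.areaMeasure_apply (c.isBoundaryParam hΩ) hbox.compl]
    have : c.base ∩ c.param ⁻¹' c.boxᶜ = ∅ :=
      eq_empty_of_forall_notMem fun x hx => hx.2 (c.param_mem_box hx.1)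
    rw [this]; simp
  refine le_antisymm ?_ ?_
  · have hle : G.surfaceMeasure Ω
        ≤ G.areaMeasure c.base c.param + (⊤ : Measure 𝔤).restrict c.boxᶜ := by
      refine G.surfaceMeasure_le fun U ψ h => Measure.le_iff.2 fun A hA => ?_
      rw [← measure_inter_add_sdiff A hbox, Measure.add_apply, Measure.restrict_apply hA]
      refine add_le_add ?_ (Measure.le_iff'.1 le_top _)
      exact (c.areaMeasure_le_of_subset_box G hΩ h (hA.inter hbox) inter_subset_right).trans
        (measure_mono inter_subset_left)
    have := Measure.restrict_mono (subset_refl c.box) hle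
    rwa [Measure.restrict_add, hself, Measure.restrict_restrict hbox, inter_compl_self,
      Measure.restrict_empty, add_zero] at this
  · rw [← hself]
    exact Measure.restrict_mono le_rfl (G.areaMeasure_le_surfaceMeasure (c.isBoundaryParam hΩ))

/-- Surface integrals of functions supported in the box of a graph chart. -/
theorem setIntegral_surfaceMeasure (G : ExpLieGroup 𝔤) (hΩ : IsOpen Ω) {g : 𝔤 → ℝ}
    (hg : ContinuousOn g (frontier Ω)) (hg0 : ∀ q ∈ frontier Ω, q ∉ c.box → g q = 0)
    (hdens : ContinuousOn (G.areaDensity c.param) c.base) :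
    ∫ q in frontier Ω, g q ∂(G.surfaceMeasure Ω)
      = ∫ y in c.base, G.areaDensity c.param y * g (c.param y) := by
  have hbox := c.isOpen_box.measurableSet
  have hP := c.isBoundaryParam hΩ
  have hfr : MeasurableSet (frontier Ω) := isClosed_frontier.measurableSet
  have h1 : ∫ q in frontier Ω, g q ∂(G.surfaceMeasure Ω)
      = ∫ q in frontier Ω ∩ c.box, g q ∂(G.surfaceMeasure Ω) :=
    setIntegral_eq_of_subset_of_forall_sdiff_eq_zero hfr inter_subset_left
      fun q hq => hg0 q hq.1 fun hb => hq.2 ⟨hq.1, hb⟩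
  have hself : (G.areaMeasure c.base c.param).restrict (frontier Ω)
      = G.areaMeasure c.base c.param :=
    Measure.restrict_eq_self_of_ae_mem (by rw [ae_iff]; exact G.areaMeasure_compl_frontier hP)
  rw [h1, ← Measure.restrict_restrict hfr, c.restrict_surfaceMeasure_box G hΩ]
  have hgm : AEStronglyMeasurable g (G.areaMeasure c.base c.param) := by
    rw [← hself]
    exact hg.aestronglyMeasurable hfr
  rw [hself, ExpLieGroup.areaMeasure, integral_map (hP.aemeasurable_withDensity G) hgm,
    integral_withDensity_eq_integral_toReal_smul₀]
  · refine setIntegral_congr_fun c.isOpen_base.measurableSet fun y _ => ?_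
    simp only [smul_eq_mul]
    rw [ENNReal.toReal_ofReal (show 0 ≤ G.areaDensity c.param y from Real.sqrt_nonneg _)]
  · exact (hdens.aemeasurable c.isOpen_base.measurableSet).ennreal_ofReal
  · exact Filter.Eventually.of_forall fun x => ENNReal.ofReal_lt_top

end GraphChart

namespace CarnotGroup

variable {𝔤 : Type*} [NormedAddCommGroup 𝔤] [InnerProductSpace ℝ 𝔤] [FiniteDimensional ℝ 𝔤]
  [MeasurableSpace 𝔤] [BorelSpace 𝔤] (G : CarnotGroup 𝔤) {Ω : Set 𝔤}

/-- The area density is continuous, hence bounded over closed balls of a chart base; compactness of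
the boundary does the rest. -/
theorem isFiniteMeasure_surfaceMeasure (hΩ : IsC2Open Ω) (hb : Bornology.IsBounded Ω) :
    IsFiniteMeasure (G.surfaceMeasure Ω) := by
  have hcpt : IsCompact (frontier Ω) :=
    Metric.isCompact_of_isClosed_isBounded isClosed_frontier
      (hb.closure.subset frontier_subset_closure)
  have hfin : G.surfaceMeasure Ω (frontier Ω) < ⊤ := by
    refine hcpt.measure_lt_top_of_nhdsWithin fun p hp => ?_
    obtain ⟨c, hc⟩ := hΩ.exists_graphChart hp
    obtain ⟨ε, hε, hball⟩ := Metric.nhds_basis_closedBall.mem_iff.1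
      (c.isOpen_base.mem_nhds hc.1)
    set B := Metric.closedBall (c.lin.symm p).1 ε with hB
    set N : Set 𝔤 := c.box ∩ (fun q => (c.lin.symm q).1) ⁻¹' Metric.ball (c.lin.symm p).1 ε with hN
    have hNo : IsOpen N := c.isOpen_box.inter
      (Metric.isOpen_ball.preimage (continuous_fst.comp c.lin.symm.continuous))
    refine ⟨N, mem_nhdsWithin_of_mem_nhds (hNo.mem_nhds ⟨hc, Metric.mem_ball_self hε⟩), ?_⟩
    have e : G.surfaceMeasure Ω N = G.areaMeasure c.base c.param N := by
      rw [← c.restrict_surfaceMeasure_box G.toExpLieGroup hΩ.1,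
        Measure.restrict_apply hNo.measurableSet, inter_eq_self_of_subset_left inter_subset_left]
    rw [e, G.areaMeasure_apply (c.isBoundaryParam hΩ.1) hNo.measurableSet]
    have hBc : IsCompact B := isCompact_closedBall _ _
    obtain ⟨M, hM⟩ := hBc.exists_bound_of_continuousOn
      ((c.continuousOn_areaDensity_param G).mono hball)
    calc ∫⁻ x in c.base ∩ c.param ⁻¹' N, ENNReal.ofReal (G.areaDensity c.param x)
        ≤ ∫⁻ x in B, ENNReal.ofReal (G.areaDensity c.param x) := by
          refine lintegral_mono_set fun y hy => ?_
          have := hy.2.2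
          rw [mem_preimage, c.symm_param_fst] at this
          exact Metric.ball_subset_closedBall this
      _ ≤ ∫⁻ x in B, ENNReal.ofReal M :=
          setLIntegral_mono' hBc.measurableSet fun y hy =>
            ENNReal.ofReal_le_ofReal ((le_abs_self _).trans (hM y hy))
      _ < ⊤ := by
          rw [setLIntegral_const]
          exact ENNReal.mul_lt_top ENNReal.ofReal_lt_top hBc.measure_lt_top
  refine ⟨?_⟩
  rw [← G.restrict_surfaceMeasure_frontier]
  simpa using hfin

end CarnotGroup

/-! ### The divergence theorem on a C² domain -/

/-- A smooth cutoff: `1` on `(-∞, -2]` and `0` on `[-1, ∞)`. -/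
def smoothCutoff (s : ℝ) : ℝ := Real.smoothTransition (-s - 1)

theorem contDiff_smoothCutoff : ContDiff ℝ ∞ smoothCutoff :=
  Real.smoothTransition.contDiff.comp (contDiff_neg.sub contDiff_const)

theorem smoothCutoff_of_neg_one_le {s : ℝ} (h : -1 ≤ s) : smoothCutoff s = 0 :=
  Real.smoothTransition.zero_of_nonpos (by linarith)

theorem smoothCutoff_of_le_neg_two {s : ℝ} (h : s ≤ -2) : smoothCutoff s = 1 :=
  Real.smoothTransition.one_of_one_le (by linarith)

theorem abs_smoothCutoff_le_one (s : ℝ) : |smoothCutoff s| ≤ 1 := by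
  rw [smoothCutoff, abs_of_nonneg (Real.smoothTransition.nonneg _)]
  exact Real.smoothTransition.le_one _

theorem hasDerivAt_smoothCutoff (s : ℝ) : HasDerivAt smoothCutoff (deriv smoothCutoff s) s :=
  (contDiff_smoothCutoff.differentiable (by simp) s).hasDerivAt

theorem continuous_deriv_smoothCutoff : Continuous (deriv smoothCutoff) :=
  contDiff_smoothCutoff.continuous_deriv (by simp)

theorem deriv_smoothCutoff_eq_zero_of_lt {s : ℝ} (h : -1 < s) : deriv smoothCutoff s = 0 := by
  have : smoothCutoff =ᶠ[𝓝 s] fun _ => 0 := by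
    filter_upwards [lt_mem_nhds h] with t ht using smoothCutoff_of_neg_one_le ht.le
  rw [this.deriv_eq, deriv_const]

theorem deriv_smoothCutoff_eq_zero_of_lt_neg_two {s : ℝ} (h : s < -2) :
    deriv smoothCutoff s = 0 := by
  have : smoothCutoff =ᶠ[𝓝 s] fun _ => 1 := by
    filter_upwards [gt_mem_nhds h] with t ht using smoothCutoff_of_le_neg_two ht.le
  rw [this.deriv_eq, deriv_const]

theorem integrable_deriv_smoothCutoff : Integrable (deriv smoothCutoff) := by
  refine continuous_deriv_smoothCutoff.integrable_of_hasCompactSupport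
    (HasCompactSupport.intro (isCompact_Icc (a := -2) (b := -1)) fun s hs => ?_)
  rcases lt_or_ge s (-2) with h | h
  · exact deriv_smoothCutoff_eq_zero_of_lt_neg_two h
  · exact deriv_smoothCutoff_eq_zero_of_lt (by
      by_contra h'
      exact hs ⟨h, not_lt.1 h'⟩)

theorem integral_deriv_smoothCutoff : ∫ s, deriv smoothCutoff s = -1 := by
  have h := integral_of_hasDerivAt_of_tendsto (f := smoothCutoff) hasDerivAt_smoothCutoff
    integrable_deriv_smoothCutoff (m := 1) (n := 0)
    (tendsto_const_nhds.congr' (by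
      filter_upwards [Filter.eventually_le_atBot (-2 : ℝ)] with s hs
        using (smoothCutoff_of_le_neg_two hs).symm))
    (tendsto_const_nhds.congr' (by
      filter_upwards [Filter.eventually_ge_atTop (-1 : ℝ)] with s hs
        using (smoothCutoff_of_neg_one_le hs).symm))
  rw [h]; norm_num

namespace GraphChart

variable {𝔤 : Type*} [NormedAddCommGroup 𝔤] [InnerProductSpace ℝ 𝔤] [FiniteDimensional ℝ 𝔤]
  {Ω : Set 𝔤} (c : GraphChart Ω)

/-- The height, extended by `0` off the base. -/
def extHeight : EuclideanSpace ℝ (Fin (Module.finrank ℝ 𝔤 - 1)) → ℝ := c.base.indicator c.height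

theorem extHeight_of_mem {y : EuclideanSpace ℝ (Fin (Module.finrank ℝ 𝔤 - 1))} (hy : y ∈ c.base) :
    c.extHeight y = c.height y := indicator_of_mem hy _

theorem measurable_extHeight : Measurable c.extHeight := by
  classical
  rw [extHeight, ← piecewise_eq_indicator]
  exact c.contDiffOn_height.continuousOn.measurable_piecewise continuousOn_const
    c.isOpen_base.measurableSet

theorem measurePreserving_shear : MeasurePreserving
    (fun z : EuclideanSpace ℝ (Fin (Module.finrank ℝ 𝔤 - 1)) × ℝ => (z.1, c.extHeight z.1 + z.2)) :=
  (MeasurePreserving.id volume).skew_product (g := fun y s => c.extHeight y + s)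
    ((c.measurable_extHeight.comp measurable_fst).add measurable_snd)
    (Filter.Eventually.of_forall fun _ => (measurePreserving_add_left volume _).map_eq)

variable [MeasurableSpace 𝔤] [BorelSpace 𝔤]

/-- A vertical shear flattens the boundary and orthonormal coordinates return to the group. Both
preserve volume, so no Jacobian appears. -/
theorem measurePreserving_graph : MeasurePreserving
    (fun z : EuclideanSpace ℝ (Fin (Module.finrank ℝ 𝔤 - 1)) × ℝ =>
      c.lin (z.1, c.extHeight z.1 + z.2)) :=
  c.basis.measurePreserving_splitLast.comp c.measurePreserving_shear

theorem integral_eq_integral_graph {f : 𝔤 → ℝ} (hf : Integrable f) :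
    ∫ q, f q = ∫ y, ∫ s, f (c.lin (y, c.extHeight y + s)) := by
  have hmp := c.measurePreserving_graph
  have h1 : ∫ q, f q = ∫ z : EuclideanSpace ℝ (Fin (Module.finrank ℝ 𝔤 - 1)) × ℝ,
      f (c.lin (z.1, c.extHeight z.1 + z.2)) := by
    rw [← integral_map hmp.measurable.aemeasurable
      (by rw [hmp.map_eq]; exact hf.aestronglyMeasurable), hmp.map_eq]
  rw [h1]
  exact integral_prod _ ((hmp.integrable_comp hf.aestronglyMeasurable).2 hf)

/-- Weights concentrating on the inner side of the boundary. -/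
theorem tendsto_integral_collar {g : 𝔤 → ℝ} {k : ℝ → ℝ} {K : Set 𝔤} {M : ℝ} (hK : IsCompact K)
    (hKb : K ⊆ c.box) (hk : Integrable k) (hk0 : ∀ s, 0 ≤ s → k s = 0)
    (hcont : ∀ ε, 0 < ε → Continuous fun q => g q * (ε⁻¹ * k (c.defFun q / ε)))
    (hg0 : ∀ q, q ∉ K → g q = 0) (hM0 : 0 ≤ M) (hM : ∀ q ∈ K, q ∈ Ω → |g q| ≤ M)
    (hlim : ∀ y ∈ c.base, Filter.Tendsto (fun s => g (c.lin (y, c.height y + s))) (𝓝[<] 0)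
      (𝓝 (g (c.param y)))) :
    Filter.Tendsto (fun ε => ∫ q, g q * (ε⁻¹ * k (c.defFun q / ε))) (𝓝[>] 0)
      (𝓝 ((∫ y in c.base, g (c.param y)) * ∫ s, k s)) := by
  set f : ℝ → 𝔤 → ℝ := fun ε q => g q * (ε⁻¹ * k (c.defFun q / ε)) with hf
  set B : Set (EuclideanSpace ℝ (Fin (Module.finrank ℝ 𝔤 - 1))) :=
    (fun q => (c.lin.symm q).1) '' K with hB
  have hBc : IsCompact B := hK.image (continuous_fst.comp c.lin.symm.continuous)
  have hnB : ∀ y ∉ B, ∀ t, g (c.lin (y, t)) = 0 := fun y hy t => hg0 _ fun h =>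
    hy ⟨_, h, by simp⟩
  have hBb : B ⊆ c.base := by
    rintro _ ⟨q, hq, rfl⟩
    exact (hKb hq).1
  -- The integrand in the variable s defined by t = h(y) + εs. The factor ε from the substitution
  -- cancels the ε⁻¹ of the weight, so F has a pointwise limit and a bound independent of ε.
  set F : ℝ → EuclideanSpace ℝ (Fin (Module.finrank ℝ 𝔤 - 1)) × ℝ → ℝ := fun ε z =>
    ε * f ε (c.lin (z.1, c.extHeight z.1 + ε * z.2)) with hF
  have hFe : ∀ ε, 0 < ε → ∀ y ∈ c.base, ∀ s,
      F ε (y, s) = g (c.lin (y, c.height y + ε * s)) * k s := by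
    intro ε hε y hy s
    simp only [hF, hf, c.extHeight_of_mem hy, c.defFun_lin, add_sub_cancel_left]
    rw [mul_div_cancel_left₀ _ hε.ne']
    field_simp
  have hF0 : ∀ ε y, y ∉ B → ∀ s, F ε (y, s) = 0 := by
    intro ε y hy s
    simp [hF, hf, hnB y hy]
  set bd : EuclideanSpace ℝ (Fin (Module.finrank ℝ 𝔤 - 1)) × ℝ → ℝ := fun z =>
    B.indicator (fun _ => M) z.1 * |k z.2| with hbd
  have hbdi : Integrable bd :=
    Integrable.mul_prod ((integrable_indicator_iff hBc.measurableSet).2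
      (integrableOn_const hBc.measure_lt_top.ne)) hk.abs
  have hbound : ∀ ε, 0 < ε → ∀ z, ‖F ε z‖ ≤ bd z := by
    rintro ε hε ⟨y, s⟩
    by_cases hy : y ∈ B
    · have hyb := hBb hy
      rw [hFe ε hε y hyb, hbd]
      simp only [indicator_of_mem hy]
      rcases le_or_gt 0 s with hs | hs
      · simp [hk0 s hs]
      rw [Real.norm_eq_abs, abs_mul]
      refine mul_le_mul_of_nonneg_right ?_ (abs_nonneg _)
      by_cases hq : c.lin (y, c.height y + ε * s) ∈ K
      · refine hM _ hq ((c.mem_iff_defFun_neg (hKb hq)).2 ?_)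
        rw [c.defFun_lin]
        nlinarith
      · rwa [hg0 _ hq, abs_zero]
    · rw [hF0 ε y hy, hbd]
      simp [hy]
  have hFm : ∀ ε, 0 < ε → AEStronglyMeasurable (F ε) := by
    intro ε hε
    refine (((hcont ε hε).measurable.comp ?_).const_mul ε).aestronglyMeasurable
    exact c.lin.continuous.measurable.comp (measurable_fst.prodMk
      ((c.measurable_extHeight.comp measurable_fst).add (measurable_snd.const_mul ε)))
  have heq : ∀ ε, 0 < ε → ∫ q, f ε q = ∫ z, F ε z := by
    intro ε hε
    have hfi : Integrable (f ε) := (hcont ε hε).integrable_of_hasCompactSupport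
      (HasCompactSupport.intro hK fun q hq => by simp [hg0 q hq])
    rw [c.integral_eq_integral_graph hfi]
    refine Eq.trans ?_ (integral_prod _ (hbdi.mono' (hFm ε hε)
      (Filter.Eventually.of_forall (hbound ε hε)))).symm
    refine integral_congr_ae (Filter.Eventually.of_forall fun y => ?_)
    simp only [hF]
    rw [integral_const_mul, Measure.integral_comp_mul_left
      (fun s => f ε (c.lin (y, c.extHeight y + s))) ε, abs_inv, abs_of_pos hε, smul_eq_mul,
      mul_inv_cancel_left₀ hε.ne']
  have hlimz : ∀ z, Filter.Tendsto (fun ε => F ε z) (𝓝[>] 0)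
      (𝓝 (c.base.indicator (fun y => g (c.param y)) z.1 * k z.2)) := by
    rintro ⟨y, s⟩
    by_cases hy : y ∈ c.base
    · simp only [indicator_of_mem hy]
      have h1 : Filter.Tendsto (fun ε => g (c.lin (y, c.height y + ε * s)) * k s) (𝓝[>] 0)
          (𝓝 (g (c.param y) * k s)) := by
        rcases le_or_gt 0 s with hs | hs
        · simp [hk0 s hs]
        refine Filter.Tendsto.mul_const _ ((hlim y hy).comp ?_)
        refine tendsto_nhdsWithin_iff.2 ⟨?_, ?_⟩
        · have : Filter.Tendsto (fun ε : ℝ => ε * s) (𝓝 0) (𝓝 (0 * s)) :=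
            (continuous_id.mul continuous_const).tendsto 0
          rw [zero_mul] at this
          exact this.mono_left nhdsWithin_le_nhds
        · filter_upwards [self_mem_nhdsWithin] with ε hε using mul_neg_of_pos_of_neg hε hs
      refine h1.congr' ?_
      filter_upwards [self_mem_nhdsWithin] with ε hε using (hFe ε hε y hy s).symm
    · simp only [indicator_of_notMem hy, zero_mul]
      refine tendsto_const_nhds.congr fun ε => (hF0 ε y (fun h => hy (hBb h)) s).symm
  have hmain := tendsto_integral_filter_of_dominated_convergence (l := 𝓝[>] (0 : ℝ)) bd
    (by filter_upwards [self_mem_nhdsWithin] with ε hε using hFm ε hε)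
    (by filter_upwards [self_mem_nhdsWithin] with ε hε
          using Filter.Eventually.of_forall (hbound ε hε))
    hbdi (Filter.Eventually.of_forall hlimz)
  have hval : ∫ z : EuclideanSpace ℝ (Fin (Module.finrank ℝ 𝔤 - 1)) × ℝ,
      c.base.indicator (fun y => g (c.param y)) z.1 * k z.2
      = (∫ y in c.base, g (c.param y)) * ∫ s, k s := by
    rw [← integral_indicator c.isOpen_base.measurableSet]
    exact integral_prod_mul _ _
  rw [hval] at hmain
  refine hmain.congr' ?_
  filter_upwards [self_mem_nhdsWithin] with ε hε using (heq ε hε).symm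

end GraphChart

namespace CarnotGroup

variable {𝔤 : Type*} [NormedAddCommGroup 𝔤] [InnerProductSpace ℝ 𝔤] [FiniteDimensional ℝ 𝔤]
  [MeasurableSpace 𝔤] [BorelSpace 𝔤] (G : CarnotGroup 𝔤) {Ω : Set 𝔤}

/-- The divergence theorem for a left-invariant vector field, localized to a graph chart. -/
theorem integral_lieDeriv_mul_add_of_graphChart (hΩ : IsC2Open Ω) (c : GraphChart Ω)
    {ξ : 𝔤} {F ζ : 𝔤 → ℝ} (hF : ContinuousOn F (closure Ω))
    (hd : ∀ p ∈ Ω, DifferentiableAt ℝ (fun t : ℝ => F (G.mul p (t • ξ))) 0)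
    (hXF : ContinuousOn (G.lieDeriv ξ F) Ω) (hi : IntegrableOn (G.lieDeriv ξ F) Ω)
    (hζ : ContDiff ℝ 1 ζ) (hs : HasCompactSupport ζ) (hsb : tsupport ζ ⊆ c.box) :
    ∫ p in Ω, (G.lieDeriv ξ F p * ζ p + F p * fderiv ℝ ζ p (G.leftField ξ p))
      = ∫ p in frontier Ω, F p * ζ p * ⟪G.outerNormal Ω p, ξ⟫ ∂(G.surfaceMeasure Ω) := by
  set K := tsupport ζ with hKdef
  have hKc : IsCompact K := hs
  set k := deriv smoothCutoff with hkdef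
  set D : 𝔤 → ℝ := fun q => fderiv ℝ ζ q (G.leftField ξ q) with hD
  set A : 𝔤 → ℝ := fun q => fderiv ℝ c.defFun q (G.leftField ξ q) with hA
  set g : 𝔤 → ℝ := fun q => F q * (ζ q * A q) with hg
  set a : 𝔤 → ℝ := fun q => G.lieDeriv ξ F q * ζ q + F q * D q with ha
  have hζd : Differentiable ℝ ζ := hζ.differentiable (by simp)
  have hζ0 : ∀ q, q ∉ K → ζ q = 0 := fun q hq => image_eq_zero_of_notMem_tsupport hq
  have hζev : ∀ q, q ∉ K → ζ =ᶠ[𝓝 q] fun _ => 0 := fun q hq =>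
    notMem_tsupport_iff_eventuallyEq.1 hq
  have hD0 : ∀ q, q ∉ K → D q = 0 := fun q hq => by
    simp [hD, (hζev q hq).fderiv_eq]
  have hDc : Continuous D := (hζ.continuous_fderiv (by simp)).clm_apply
    (G.contDiff_leftField ξ).continuous
  have hφd : ∀ q ∈ c.box, ContDiffAt ℝ 1 c.defFun q := fun q hq =>
    (c.contDiffAt_defFun hq.1).of_le (by norm_num)
  have hAc : ∀ q ∈ c.box, ContinuousAt A q := fun q hq =>
    ((hφd q hq).fderiv_right (m := 0) (by norm_num)).continuousAt.clm_apply
      (G.contDiff_leftField ξ).continuous.continuousAt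
  -- For each ε this test function is supported where φ ≤ −ε, inside Ω, so interior integration by
  -- parts applies. The derivative falling on the cutoff produces the collar weight.
  set χ : ℝ → 𝔤 → ℝ := fun ε q => ζ q * smoothCutoff (c.defFun q / ε) with hχ
  have hχev : ∀ ε q, q ∉ K → χ ε =ᶠ[𝓝 q] fun _ => 0 := fun ε q hq => by
    filter_upwards [hζev q hq] with z hz
    simp [hχ, hz]
  have hχc : ∀ ε, 0 < ε → ContDiff ℝ 1 (χ ε) := by
    intro ε hε
    refine contDiff_iff_contDiffAt.2 fun q => ?_
    by_cases hq : q ∈ K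
    · refine hζ.contDiffAt.mul (ContDiffAt.comp (g := smoothCutoff) q
        (contDiff_smoothCutoff.of_le (m := 1) (by exact_mod_cast le_top)).contDiffAt ?_)
      exact (hφd q (hsb hq)).div_const ε
    · exact contDiffAt_const.congr_of_eventuallyEq (hχev ε q hq)
  have hclosed : ∀ ε, IsClosed (K ∩ {q | c.defFun q ≤ -ε}) := fun ε => by
    have hc : ContinuousOn c.defFun K := fun q hq =>
      (hφd q (hsb hq)).continuousAt.continuousWithinAt
    exact hc.preimage_isClosed_of_isClosed hKc.isClosed isClosed_Iic
  have hsubΩ : ∀ ε, 0 < ε → K ∩ {q | c.defFun q ≤ -ε} ⊆ Ω := fun ε hε q hq =>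
    (c.mem_iff_defFun_neg (hsb hq.1)).2 (lt_of_le_of_lt hq.2 (by linarith))
  have hdiv : ∀ {ε t : ℝ}, 0 < ε → -ε < t → -1 < t / ε := fun hε h => by
    rw [lt_div_iff₀ hε]; linarith
  have hχs : ∀ ε, 0 < ε → tsupport (χ ε) ⊆ K ∩ {q | c.defFun q ≤ -ε} := by
    intro ε hε
    refine closure_minimal (fun q hq => ?_) (hclosed ε)
    rw [Function.mem_support] at hq
    refine ⟨by_contra fun h => hq (by simp [hχ, hζ0 q h]), ?_⟩
    by_contra h
    exact hq (by simp [hχ, smoothCutoff_of_neg_one_le (hdiv hε (not_le.1 h)).le])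
  have hχk : ∀ ε, 0 < ε → HasCompactSupport (χ ε) := fun ε hε =>
    hKc.of_isClosed_subset (isClosed_tsupport _) ((hχs ε hε).trans inter_subset_left)
  have hχd : ∀ ε, 0 < ε → ∀ q, fderiv ℝ (χ ε) q (G.leftField ξ q)
      = D q * smoothCutoff (c.defFun q / ε) + ζ q * A q * (ε⁻¹ * k (c.defFun q / ε)) := by
    intro ε hε q
    by_cases hq : q ∈ K
    · have h1 : HasFDerivAt c.defFun (fderiv ℝ c.defFun q) q :=
        ((hφd q (hsb hq)).differentiableAt (by simp)).hasFDerivAt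
      have h2 := (hasDerivAt_smoothCutoff (c.defFun q / ε)).comp_hasFDerivAt q
        (h1.mul_const ε⁻¹)
      have h3 := ((hζd q).hasFDerivAt.mul h2).fderiv
      have h4 : χ ε = ζ * (smoothCutoff ∘ fun y => c.defFun y * ε⁻¹) := by
        ext y; simp [hχ, div_eq_mul_inv]
      rw [h4, h3]
      simp [hD, hA, hkdef, div_eq_mul_inv]
      ring
    · rw [(hχev ε q hq).fderiv_eq, hD0 q hq, hζ0 q hq]
      simp
  have hRc : ∀ ε, 0 < ε → Continuous fun q => ζ q * A q * (ε⁻¹ * k (c.defFun q / ε)) := by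
    intro ε hε
    have e : (fun q => ζ q * A q * (ε⁻¹ * k (c.defFun q / ε)))
        = fun q => ζ q * (A q * (ε⁻¹ * k (c.defFun q / ε))) := by ext q; ring
    rw [e]
    have hco : ContinuousOn (fun q => A q * (ε⁻¹ * k (c.defFun q / ε))) c.box := by
      intro q hq
      refine ((hAc q hq).mul (continuousAt_const.mul ?_)).continuousWithinAt
      exact ContinuousAt.comp (f := fun q => c.defFun q / ε)
        continuous_deriv_smoothCutoff.continuousAt
        ((hφd q hq).continuousAt.div_const ε)
    simpa only [mul_comm] using
      hco.continuous_mul_of_tsupport_subset c.isOpen_box hζ.continuous hsb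
  have hRs : ∀ ε, 0 < ε → tsupport (fun q => ζ q * A q * (ε⁻¹ * k (c.defFun q / ε)))
      ⊆ K ∩ {q | c.defFun q ≤ -ε} := by
    intro ε hε
    refine closure_minimal (fun q hq => ?_) (hclosed ε)
    rw [Function.mem_support] at hq
    refine ⟨by_contra fun h => hq (by simp [hζ0 q h]), ?_⟩
    by_contra h
    exact hq (by simp [hkdef, deriv_smoothCutoff_eq_zero_of_lt (hdiv hε (not_le.1 h))])
  have hFΩ : ContinuousOn F Ω := hF.mono subset_closure
  have hgc : ∀ ε, 0 < ε → Continuous fun q => g q * (ε⁻¹ * k (c.defFun q / ε)) := by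
    intro ε hε
    have := hFΩ.continuous_mul_of_tsupport_subset hΩ.1 (hRc ε hε)
      ((hRs ε hε).trans (hsubΩ ε hε))
    simpa only [hg, mul_assoc] using this
  have hai : IntegrableOn a Ω := by
    obtain ⟨C, hC⟩ := hs.exists_bound_of_continuous hζ.continuous
    refine Integrable.add (Integrable.mul_bdd (c := C) hi
      hζ.continuous.aestronglyMeasurable (Filter.Eventually.of_forall hC)) ?_
    have h1 : IntegrableOn (fun q => F q * D q) (closure Ω ∩ K) :=
      ((hF.mono inter_subset_left).mul hDc.continuousOn).integrableOn_compact
        (hKc.inter_left isClosed_closure)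
    exact h1.of_forall_sdiff_eq_zero hΩ.1.measurableSet fun q hq => by
      have : q ∉ K := fun h => hq.2 ⟨subset_closure hq.1, h⟩
      simp [hD0 q this]
  have ha0 : ∀ q, q ∉ K → a q = 0 := fun q hq => by simp [ha, hζ0 q hq, hD0 q hq]
  have hacc : ∀ ε, AEStronglyMeasurable (fun q => a q * smoothCutoff (c.defFun q / ε))
      (volume.restrict Ω) := by
    intro ε
    refine ContinuousOn.aestronglyMeasurable (fun q hq => ?_) hΩ.1.measurableSet
    by_cases hqK : q ∈ K
    · refine ContinuousWithinAt.mul ?_ ?_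
      · exact ((hXF q hq).mul hζ.continuous.continuousWithinAt).add
          ((hFΩ q hq).mul hDc.continuousWithinAt)
      · exact (ContinuousAt.comp (f := fun q => c.defFun q / ε)
          contDiff_smoothCutoff.continuous.continuousAt
          ((hφd q (hsb hqK)).continuousAt.div_const ε)).continuousWithinAt
    · refine (continuousAt_const (y := (0 : ℝ)) |>.congr ?_).continuousWithinAt
      filter_upwards [(isClosed_tsupport ζ).isOpen_compl.mem_nhds hqK] with z hz
      rw [ha0 z hz, MulZeroClass.zero_mul]
  have habd : ∀ ε q, ‖a q * smoothCutoff (c.defFun q / ε)‖ ≤ ‖a q‖ := by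
    intro ε q
    rw [norm_mul]
    exact mul_le_of_le_one_right (norm_nonneg _) (abs_smoothCutoff_le_one _)
  have hgi : ∀ ε, 0 < ε → Integrable fun q => g q * (ε⁻¹ * k (c.defFun q / ε)) := fun ε hε =>
    (hgc ε hε).integrable_of_hasCompactSupport
      (HasCompactSupport.intro hKc fun q hq => by simp [hg, hζ0 q hq])
  have hid : ∀ ε, 0 < ε → ∫ q in Ω, a q * smoothCutoff (c.defFun q / ε)
      = -∫ q, g q * (ε⁻¹ * k (c.defFun q / ε)) := by
    intro ε hε
    have h0 := G.integral_lieDeriv_mul_add hΩ.1 hFΩ hd hXF (hχc ε hε) (hχk ε hε)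
      ((hχs ε hε).trans (hsubΩ ε hε))
    have e : ∀ q, G.lieDeriv ξ F q * χ ε q + F q * fderiv ℝ (χ ε) q (G.leftField ξ q)
        = a q * smoothCutoff (c.defFun q / ε) + g q * (ε⁻¹ * k (c.defFun q / ε)) := by
      intro q
      rw [hχd ε hε q]
      simp only [ha, hg, hχ]
      ring
    simp only [e] at h0
    have hsm : IntegrableOn (fun q => a q * smoothCutoff (c.defFun q / ε)) Ω :=
      Integrable.mono hai (hacc ε) (Filter.Eventually.of_forall (habd ε))
    rw [integral_add hsm (hgi ε hε).integrableOn] at h0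
    have h1 : ∫ q in Ω, g q * (ε⁻¹ * k (c.defFun q / ε))
        = ∫ q, g q * (ε⁻¹ * k (c.defFun q / ε)) := by
      refine setIntegral_eq_integral_of_forall_compl_eq_zero fun q hq => ?_
      have : q ∉ tsupport (fun q => ζ q * A q * (ε⁻¹ * k (c.defFun q / ε))) := fun h =>
        hq (hsubΩ ε hε (hRs ε hε h))
      have h2 := image_eq_zero_of_notMem_tsupport this
      simp only [hg, mul_assoc] at h2 ⊢
      rw [h2, MulZeroClass.mul_zero]
    rw [← h1]
    linarith
  have hlimL : Filter.Tendsto (fun ε => ∫ q in Ω, a q * smoothCutoff (c.defFun q / ε)) (𝓝[>] 0)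
      (𝓝 (∫ q in Ω, a q)) := by
    refine tendsto_integral_filter_of_dominated_convergence (fun q => ‖a q‖)
      (Filter.Eventually.of_forall hacc)
      (Filter.Eventually.of_forall fun ε => Filter.Eventually.of_forall (habd ε)) hai.norm ?_
    refine (ae_restrict_iff' hΩ.1.measurableSet).2 (Filter.Eventually.of_forall fun q hq => ?_)
    by_cases hqK : q ∈ K
    · have hneg := (c.mem_iff_defFun_neg (hsb hqK)).1 hq
      refine tendsto_const_nhds.congr' ?_
      -- For ε < −φ(q)/2 one has φ(q)/ε ≤ −2, where the cutoff equals 1.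
      filter_upwards [Ioo_mem_nhdsGT (show (0 : ℝ) < -c.defFun q / 2 by linarith)] with ε hε
      rw [smoothCutoff_of_le_neg_two, mul_one]
      rw [div_le_iff₀ hε.1]
      linarith [hε.2]
    · simp [ha0 q hqK]
  obtain ⟨M, hM⟩ := (hKc.inter_left (isClosed_closure (s := Ω))).exists_bound_of_continuousOn
    (f := g) ((hF.mono inter_subset_left).mul (hζ.continuous.continuousOn.mul
      fun q hq => (hAc q (hsb hq.2)).continuousWithinAt))
  have hlimR := c.tendsto_integral_collar (g := g) (k := k) (K := K) (M := max M 0) hKc hsb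
    integrable_deriv_smoothCutoff
    (fun s hs => deriv_smoothCutoff_eq_zero_of_lt (by linarith)) hgc
    (fun q hq => by simp [hg, hζ0 q hq]) (le_max_right _ _)
    (fun q hq hqΩ => (hM q ⟨subset_closure hqΩ, hq⟩).trans (le_max_left _ _)) (fun y hy => by
      have hpb := c.param_mem_box hy
      have ht : Filter.Tendsto (fun s : ℝ => c.lin (y, c.height y + s)) (𝓝[<] 0)
          (𝓝 (c.param y)) := by
        have h1 : Continuous fun s : ℝ => c.lin (y, c.height y + s) :=
          c.lin.continuous.comp (continuous_const.prodMk (continuous_const.add continuous_id))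
        have h2 := h1.tendsto 0
        rw [add_zero] at h2
        exact h2.mono_left nhdsWithin_le_nhds
      have ht2 : Filter.Tendsto (fun s : ℝ => c.lin (y, c.height y + s)) (𝓝[<] 0)
          (𝓝[closure Ω] (c.param y)) := by
        refine tendsto_nhdsWithin_iff.2 ⟨ht, ?_⟩
        filter_upwards [ht.eventually_mem (c.isOpen_box.mem_nhds hpb), self_mem_nhdsWithin]
          with s hs hs0
        refine subset_closure ((c.mem_iff_defFun_neg hs).2 ?_)
        rw [c.defFun_lin, add_sub_cancel_left]
        exact hs0
      exact ((hF _ (frontier_subset_closure (c.param_mem_frontier hΩ.1 hy))).tendsto.comp ht2).mul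
        (((hζ.continuous.tendsto _).comp ht).mul ((hAc _ hpb).tendsto.comp ht)))
  -- The cutoff derivative has total mass −1, which cancels the minus sign in `hid`.
  rw [integral_deriv_smoothCutoff, mul_neg_one] at hlimR
  have hlim2 : Filter.Tendsto (fun ε => ∫ q in Ω, a q * smoothCutoff (c.defFun q / ε)) (𝓝[>] 0)
      (𝓝 (∫ y in c.base, g (c.param y))) := by
    rw [← neg_neg (∫ y in c.base, g (c.param y))]
    refine hlimR.neg.congr' ?_
    filter_upwards [self_mem_nhdsWithin] with ε hε using (hid ε hε).symm
  rw [tendsto_nhds_unique hlimL hlim2]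
  have hsurf := c.setIntegral_surfaceMeasure G.toExpLieGroup hΩ.1
    (g := fun p => F p * ζ p * ⟪G.outerNormal Ω p, ξ⟫)
    (((hF.mono frontier_subset_closure).mul hζ.continuous.continuousOn).mul
      ((G.continuousOn_outerNormal hΩ).inner continuousOn_const))
    (fun q _ hq => by simp [hζ0 q (fun h => hq (hsb h))]) (c.continuousOn_areaDensity_param G)
  rw [hsurf]
  -- On the graph dφ(ξ) = ‖∇φ‖⟨ν,ξ⟩, and ‖∇φ‖ is precisely the area density.
  refine setIntegral_congr_fun c.isOpen_base.measurableSet fun y hy => ?_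
  have hφ := c.isLocalDefiningFunction (c.param_mem_box hy) (c.defFun_param y)
  simp only [hg, hA]
  rw [c.areaDensity_param G hy, G.fderiv_leftField_eq_norm_mul hφ]
  ring

/-- The divergence theorem for a left-invariant vector field. -/
theorem setIntegral_lieDeriv (hΩ : IsC2Open Ω) (hb : Bornology.IsBounded Ω)
    {ξ : 𝔤} {F : 𝔤 → ℝ} (hF : ContinuousOn F (closure Ω))
    (hd : ∀ p ∈ Ω, DifferentiableAt ℝ (fun t : ℝ => F (G.mul p (t • ξ))) 0)
    (hXF : ContinuousOn (G.lieDeriv ξ F) Ω) (hi : IntegrableOn (G.lieDeriv ξ F) Ω) :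
    ∫ p in Ω, G.lieDeriv ξ F p
      = ∫ p in frontier Ω, F p * ⟪G.outerNormal Ω p, ξ⟫ ∂(G.surfaceMeasure Ω) := by
  have hcl : IsCompact (closure Ω) := hb.isCompact_closure
  have hfr : IsCompact (frontier Ω) := hcl.of_isClosed_subset isClosed_frontier
    frontier_subset_closure
  have hfin := G.isFiniteMeasure_surfaceMeasure hΩ hb
  choose c hc using fun p (hp : p ∈ frontier Ω) => hΩ.exists_graphChart hp
  obtain ⟨t, ht⟩ := hfr.elim_nhds_subcover' (fun p hp => (c p hp).box ∩ Metric.ball p 1)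
    fun p hp => ((c p hp).isOpen_box.inter Metric.isOpen_ball).mem_nhds
      ⟨hc p hp, Metric.mem_ball_self one_pos⟩
  -- The index `none` stands for Ω itself, where no boundary term arises. The unit balls only make
  -- the sets bounded, so that the partition functions have compact support.
  set U : Option t → Set 𝔤 := fun i => i.elim Ω fun p =>
    (c p.1 p.1.2).box ∩ Metric.ball (p.1 : 𝔤) 1 with hU
  have hUo : ∀ i, IsOpen (U i) := by
    rintro (_ | p)
    · exact hΩ.1
    · exact (c p.1 p.1.2).isOpen_box.inter Metric.isOpen_ball
  have hUc : closure Ω ⊆ ⋃ i, U i := by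
    intro p hp
    by_cases hpΩ : p ∈ Ω
    · exact mem_iUnion.2 ⟨none, hpΩ⟩
    · have hpf : p ∈ frontier Ω := ⟨hp, by rwa [hΩ.1.interior_eq]⟩
      obtain ⟨q, hq, hpq⟩ := mem_iUnion₂.1 (ht hpf)
      exact mem_iUnion.2 ⟨some ⟨q, hq⟩, hpq⟩
  have hUb : ∀ i, Bornology.IsBounded (U i) := by
    rintro (_ | p)
    · exact hb
    · exact Metric.isBounded_ball.subset inter_subset_right
  obtain ⟨f, hf⟩ := SmoothPartitionOfUnity.exists_isSubordinate (modelWithCornersSelf ℝ 𝔤)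
    (isClosed_closure (s := Ω)) U hUo hUc
  have hfs : ∀ i, ContDiff ℝ 1 (f i) := fun i =>
    ((f i).contMDiff.contDiff).of_le (by exact_mod_cast le_top)
  have hfk : ∀ i, HasCompactSupport (f i) := fun i =>
    Metric.isCompact_of_isClosed_isBounded (isClosed_tsupport _) ((hUb i).subset (hf i))
  have hsum : ∀ p ∈ closure Ω, ∑ i, f i p = 1 := fun p hp => by
    rw [← finsum_eq_sum_of_fintype]; exact f.sum_eq_one hp
  have hloc : ∀ i, ∫ p in Ω, (G.lieDeriv ξ F p * f i p
        + F p * fderiv ℝ (f i) p (G.leftField ξ p))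
      = ∫ p in frontier Ω, F p * f i p * ⟪G.outerNormal Ω p, ξ⟫ ∂(G.surfaceMeasure Ω) := by
    rintro (_ | q)
    · rw [G.integral_lieDeriv_mul_add hΩ.1 (hF.mono subset_closure) hd hXF (hfs _) (hfk _)
        (hf none)]
      refine (setIntegral_eq_zero_of_forall_eq_zero fun p hp => ?_).symm
      have : p ∉ tsupport (f none) := fun h => by
        have h1 : p ∈ Ω := hf none h
        rw [frontier, hΩ.1.interior_eq] at hp
        exact hp.2 h1
      rw [image_eq_zero_of_notMem_tsupport this]
      simp
    · exact G.integral_lieDeriv_mul_add_of_graphChart hΩ (c q.1 q.1.2) hF hd hXF hi (hfs _) (hfk _)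
        ((hf (some q)).trans inter_subset_left)
  have hDc : ∀ i, Continuous fun p => fderiv ℝ (f i) p (G.leftField ξ p) := fun i =>
    ((hfs i).continuous_fderiv (by simp)).clm_apply (G.contDiff_leftField ξ).continuous
  have hintL : ∀ i, IntegrableOn (fun p => G.lieDeriv ξ F p * f i p
      + F p * fderiv ℝ (f i) p (G.leftField ξ p)) Ω := by
    intro i
    obtain ⟨C, hC⟩ := (hfk i).exists_bound_of_continuous (hfs i).continuous
    refine Integrable.add (Integrable.mul_bdd (c := C) hi
      (hfs i).continuous.aestronglyMeasurable (Filter.Eventually.of_forall hC)) ?_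
    exact ((hF.mul (hDc i).continuousOn).integrableOn_compact hcl).mono_set subset_closure
  have hintR : ∀ i, IntegrableOn (fun p => F p * f i p * ⟪G.outerNormal Ω p, ξ⟫) (frontier Ω)
      (G.surfaceMeasure Ω) := fun i =>
    (((hF.mono frontier_subset_closure).mul (hfs i).continuous.continuousOn).mul
      ((G.continuousOn_outerNormal hΩ).inner continuousOn_const)).integrableOn_compact hfr
  have hsumint := Finset.sum_congr rfl fun i (_ : i ∈ (Finset.univ : Finset (Option t))) => hloc i
  rw [← integral_finsetSum _ fun i _ => hintL i, ← integral_finsetSum _ fun i _ => hintR i]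
    at hsumint
  refine Eq.trans ?_ (hsumint.trans ?_)
  · refine setIntegral_congr_fun hΩ.1.measurableSet fun p hp => ?_
    -- The partition functions sum to 1 near p, so the terms carrying their derivatives cancel.
    have h1 : ∑ i, fderiv ℝ (f i) p (G.leftField ξ p) = 0 := by
      have h2 : HasFDerivAt (fun q => ∑ i, f i q) (∑ i, fderiv ℝ (f i) p) p :=
        HasFDerivAt.fun_sum fun i _ => ((hfs i).differentiable (by simp) p).hasFDerivAt
      have h3 : (fun q => ∑ i, f i q) =ᶠ[𝓝 p] fun _ => 1 := by
        filter_upwards [hΩ.1.mem_nhds hp] with q hq using hsum q (subset_closure hq)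
      have h4 := h2.unique ((hasFDerivAt_const (1 : ℝ) p).congr_of_eventuallyEq h3)
      rw [← _root_.sum_apply, h4]
      rfl
    simp only [Finset.sum_add_distrib, ← Finset.mul_sum, h1, hsum p (subset_closure hp)]
    simp
  · refine setIntegral_congr_fun isClosed_frontier.measurableSet fun p hp => ?_
    simp only [← Finset.sum_mul, ← Finset.mul_sum, hsum p (frontier_subset_closure hp), mul_one]

end CarnotGroup

/-! ### Horizontal frames and the horizontal mean curvature -/

section Frame

variable {𝔤 : Type*} [NormedAddCommGroup 𝔤] [InnerProductSpace ℝ 𝔤] {V : Submodule ℝ 𝔤}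

theorem OrthonormalBasis.sum_inner_coe_mul_inner {ι : Type*} [Fintype ι]
    (e : OrthonormalBasis ι ℝ V) {a : 𝔤} (ha : a ∈ V) (b : 𝔤) :
    ∑ i, ⟪a, (e i : 𝔤)⟫ * ⟪(e i : 𝔤), b⟫ = ⟪a, b⟫ := by
  have h : a = ∑ i, ⟪(e i : 𝔤), a⟫ • (e i : 𝔤) := by
    have := congrArg Subtype.val (e.sum_repr' ⟨a, ha⟩)
    simpa using this.symm
  conv_rhs => rw [h, sum_inner]
  refine Finset.sum_congr rfl fun i _ => ?_
  rw [inner_smul_left, real_inner_comm]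
  simp

variable [FiniteDimensional ℝ 𝔤]

/-- Parseval's identity for an orthonormal frame of a hyperplane of `V` with unit normal `n`. -/
theorem Orthonormal.sum_inner_mul_inner_add {n : 𝔤} (hn : n ∈ V) (hn1 : ‖n‖ = 1)
    {E : Fin (Module.finrank ℝ V - 1) → 𝔤} (hE : Orthonormal ℝ E) (hEV : ∀ k, E k ∈ V)
    (hEn : ∀ k, ⟪n, E k⟫ = 0) {x y : 𝔤} (hx : x ∈ V) :
    ∑ k, ⟪x, E k⟫ * ⟪E k, y⟫ + ⟪x, n⟫ * ⟪n, y⟫ = ⟪x, y⟫ := by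
  set v : Fin (Module.finrank ℝ V - 1) ⊕ Unit → V :=
    Sum.elim (fun k => ⟨E k, hEV k⟩) fun _ => ⟨n, hn⟩ with hv
  have hon : Orthonormal ℝ v := by
    refine ⟨?_, ?_⟩
    · rintro (k | k)
      · exact hE.1 k
      · exact hn1
    · rintro (k | k) (l | l) hkl
      · exact hE.2 fun h => hkl (by rw [h])
      · change ⟪E k, n⟫ = 0
        rw [real_inner_comm, hEn]
      · exact hEn l
      · exact absurd rfl hkl
  have hpos : 0 < Module.finrank ℝ V := by
    have : Nontrivial V := ⟨⟨n, hn⟩, 0, fun h => by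
      have : n = 0 := congrArg Subtype.val h
      simp [this] at hn1⟩
    exact Module.finrank_pos
  obtain ⟨b, hb⟩ := Orthonormal.exists_orthonormalBasis_extension_of_card_eq (𝕜 := ℝ) (E := V)
    (ι := Fin (Module.finrank ℝ V - 1) ⊕ Unit) (by simp; omega) (v := v) (s := univ)
    (hon.comp _ Subtype.val_injective)
  have h := b.sum_inner_coe_mul_inner hx y
  simp only [Fintype.sum_sum_type, hb _ (mem_univ _)] at h
  simpa [hv] using h

/-- A unit field tangent to `V` has a local orthonormal frame of its orthogonal complement
in `V`: a frame at one point is carried along by rotations. -/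
theorem exists_contDiffAt_orthonormal_frame {n : 𝔤 → 𝔤} {p : 𝔤} (hn : ContDiffAt ℝ 1 n p)
    (hnV : ∀ q, n q ∈ V) (hn1 : ∀ᶠ q in 𝓝 p, ‖n q‖ = 1) :
    ∃ E : Fin (Module.finrank ℝ V - 1) → 𝔤 → 𝔤, (∀ k, ContDiffAt ℝ 1 (E k) p) ∧
      ∀ᶠ q in 𝓝 p, Orthonormal ℝ (fun k => E k q) ∧
        ∀ k, E k q ∈ V ∧ ⟪n q, E k q⟫ = 0 := by
  have hp1 : ‖n p‖ = 1 := hn1.self_of_nhds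
  have hpos : 0 < Module.finrank ℝ V := by
    have : Nontrivial V := ⟨⟨n p, hnV p⟩, 0, fun h => by
      have : n p = 0 := congrArg Subtype.val h
      simp [this] at hp1⟩
    exact Module.finrank_pos
  obtain ⟨b, hb⟩ := Orthonormal.exists_orthonormalBasis_extension_of_card_eq (𝕜 := ℝ) (E := V)
    (ι := Fin (Module.finrank ℝ V - 1) ⊕ Unit) (by simp; omega)
    (v := fun _ => ⟨n p, hnV p⟩) (s := {Sum.inr ()})
    ⟨fun _ => hp1, fun i j hij => absurd (Subsingleton.elim i j) hij⟩
  have hb' : b (Sum.inr ()) = ⟨n p, hnV p⟩ := hb _ rfl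
  set β : Fin (Module.finrank ℝ V - 1) → 𝔤 := fun k => b (Sum.inl k) with hβ
  have hβn : ∀ k, ⟪n p, β k⟫ = 0 := fun k => by
    have : ⟪b (Sum.inr ()), b (Sum.inl k)⟫ = 0 := b.orthonormal.2 (by simp)
    rw [hb'] at this
    exact this
  have hββ : ∀ k l, ⟪β k, β l⟫ = if k = l then 1 else 0 := fun k l => by
    have := orthonormal_iff_ite.1 b.orthonormal (Sum.inl k) (Sum.inl l)
    simpa using this
  -- The rotation carrying n(p) to n(q) in the plane they span, evaluated on vectors orthogonal to
  -- n(p). The denominator is 2 at q = p, hence nonzero nearby.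
  set E : Fin (Module.finrank ℝ V - 1) → 𝔤 → 𝔤 := fun k q =>
    β k - (⟪β k, n q⟫ / (1 + ⟪n p, n q⟫)) • (n p + n q) with hE
  have hc : ContDiffAt ℝ 1 (fun q => 1 + ⟪n p, n q⟫) p :=
    contDiffAt_const.add (contDiffAt_const.inner ℝ hn)
  have hc0 : 1 + ⟪n p, n p⟫ ≠ 0 := by
    rw [real_inner_self_eq_norm_sq, hp1]; norm_num
  refine ⟨E, fun k => ?_, ?_⟩
  · exact contDiffAt_const.sub
      (((contDiffAt_const.inner ℝ hn).div hc hc0).smul (contDiffAt_const.add hn))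
  · filter_upwards [hn1, hc.continuousAt.eventually_ne hc0] with q hq hq0
    have hnn : ⟪n q, n q⟫ = 1 := by rw [real_inner_self_eq_norm_sq, hq]; norm_num
    have hpp : ⟪n p, n p⟫ = 1 := by rw [real_inner_self_eq_norm_sq, hp1]; norm_num
    refine ⟨orthonormal_iff_ite.2 fun k l => ?_, fun k => ⟨?_, ?_⟩⟩
    · have h1 : ⟪n q, n p⟫ = ⟪n p, n q⟫ := real_inner_comm _ _
      have h2 : ⟪n q, β l⟫ = ⟪β l, n q⟫ := real_inner_comm _ _
      have h3 : ⟪β k, n p⟫ = 0 := (real_inner_comm _ _).trans (hβn k)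
      simp only [hE, inner_sub_left, inner_sub_right, inner_add_left, inner_add_right,
        inner_smul_left, inner_smul_right, hββ, hnn, hpp, hβn, h1, h2, h3, conj_trivial]
      generalize (if k = l then (1 : ℝ) else 0) = δ
      field_simp
      ring
    · exact V.sub_mem (b (Sum.inl k)).2 (V.smul_mem _ (V.add_mem (hnV p) (hnV q)))
    · simp only [hE, inner_sub_right, inner_add_right, inner_smul_right, hnn,
        real_inner_comm (n p) (n q), real_inner_comm (β k) (n q)]
      field_simp
      ring

end Frame

namespace CarnotGroup

variable {𝔤 : Type*} [NormedAddCommGroup 𝔤] [InnerProductSpace ℝ 𝔤] (G : CarnotGroup 𝔤)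
  {Ω : Set 𝔤} {p : 𝔤}

/-- A bracket with a horizontal vector lies in the layers of index at least 2, which are orthogonal
to V_1. -/
theorem inner_bracket_self {ξ : 𝔤} (hξ : ξ ∈ G.layer 1) (a : 𝔤) : ⟪G.bracket a ξ, ξ⟫ = 0 := by
  have ha : a ∈ ⨆ j, G.layer j := by rw [G.iSup_layer]; trivial
  induction ha using Submodule.iSup_induction' with
  | mem j x hx =>
    rcases Nat.eq_zero_or_pos j with rfl | hj
    · rw [G.layer_zero, Submodule.mem_bot] at hx
      rw [hx, G.bracket_zero_left, inner_zero_left]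
    · have := G.bracket_mem_layer_one_add hξ hx
      rw [G.bracket_swap, inner_neg_left, neg_eq_zero]
      exact (G.layer_ortho (j + 1) 1 (by omega)).inner_eq this hξ
  | zero => rw [G.bracket_zero_left, inner_zero_left]
  | add x y _ _ hx hy => rw [G.bracket_add_left, inner_add_left, hx, hy, add_zero]

variable [FiniteDimensional ℝ 𝔤]

/-- Every surviving Koszul term pairs a bracket [b_a, ξ] with ξ. So ∇_E E for horizontal E is just
the derivative of its components, and structure constants do not enter the curvature. -/
theorem koszul_self {ξ : 𝔤} (hξ : ξ ∈ G.layer 1) : G.koszul ξ ξ = 0 := by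
  refine Finset.sum_eq_zero fun a _ => ?_
  rw [G.bracket_self, G.bracket_swap ξ, inner_neg_left, G.inner_bracket_self hξ]
  simp

theorem inner_hNormal {ξ : 𝔤} (hξ : ξ ∈ G.layer 1) :
    ⟪G.hNormal Ω p, ξ⟫ = ⟪G.outerNormal Ω p, ξ⟫ := by
  rw [hNormal, Submodule.inner_starProjection_left_eq_right,
    Submodule.starProjection_eq_self_iff.2 hξ]

theorem hNormal_mem : G.hNormal Ω p ∈ G.layer 1 := Submodule.starProjection_apply_mem _ _

/-- The normalized horizontal gradient of a defining function is a C¹ field on a full neighbourhood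
which equals ν^H on the boundary. A frame of its orthogonal complement in V_1 is therefore tangent
along the boundary. -/
theorem exists_isHMeanCurvature (hΩ : IsC2Open Ω) (hp : p ∈ frontier Ω) (hW : G.angle Ω p ≠ 0) :
    ∃ c, G.IsHMeanCurvature Ω p c := by
  obtain ⟨φ, hφ⟩ := hΩ.2 p hp
  set N : 𝔤 → 𝔤 := fun q => (G.layer 1).starProjection (G.lieGrad φ q) with hN
  have hNc : ContDiffAt ℝ 1 N p :=
    (G.layer 1).starProjection.contDiff.contDiffAt.comp p (G.contDiffAt_lieGrad hφ.1)
  have hNp : N p ≠ 0 := by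
    intro h
    refine hW ?_
    rw [angle, hNormal, G.outerNormal_eq hφ, map_smul]
    change ‖_ • N p‖ = 0
    rw [h, smul_zero, norm_zero]
  have hne : ∀ᶠ q in 𝓝 p, N q ≠ 0 := hNc.continuousAt.eventually_ne hNp
  obtain ⟨E, hE, hEo⟩ := exists_contDiffAt_orthonormal_frame (V := G.layer 1)
    (n := fun q => ‖N q‖⁻¹ • N q) (p := p) (((hNc.norm ℝ hNp).inv (norm_ne_zero_iff.2 hNp)).smul hNc)
    (fun q => Submodule.smul_mem _ _ (Submodule.starProjection_apply_mem _ _))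
    (by
      filter_upwards [hne] with q hq
      rw [norm_smul, norm_inv, norm_norm, inv_mul_cancel₀ (norm_ne_zero_iff.2 hq)])
  refine ⟨_, E, hE, ?_, rfl⟩
  filter_upwards [nhdsWithin_le_nhds hEo, nhdsWithin_le_nhds hne, hφ.eventually hΩ.1]
    with q hq hqN hqφ
  refine ⟨hq.1, fun k => ⟨(hq.2 k).1, ?_⟩⟩
  have h1 := (hq.2 k).2
  rw [inner_smul_left] at h1
  have h2 : ⟪N q, E k q⟫ = 0 := by
    simpa [hqN] using h1
  rw [← G.inner_hNormal (hq.2 k).1, hNormal, G.outerNormal_eq hqφ, map_smul, inner_smul_left]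
  change _ * ⟪N q, E k q⟫ = 0
  rw [h2, MulZeroClass.mul_zero]

theorem isHMeanCurvature_hMeanCurvature (hΩ : IsC2Open Ω) (hp : p ∈ frontier Ω)
    (hW : G.angle Ω p ≠ 0) : G.IsHMeanCurvature Ω p (G.hMeanCurvature Ω p) := by
  have hch : p ∉ G.charSet Ω := fun h => hW h.2
  have h : p ∈ frontier Ω \ G.charSet Ω ∧ ∃ c, G.IsHMeanCurvature Ω p c :=
    ⟨⟨hp, hch⟩, G.exists_isHMeanCurvature hΩ hp hW⟩
  rw [hMeanCurvature, if_neg hch, hMeanCurvatureAux, dif_pos h]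
  exact h.2.choose_spec

end CarnotGroup

/-! ### Boundary values of derivatives and of the flux -/

namespace ExpLieGroup

variable {𝔤 : Type*} [NormedAddCommGroup 𝔤] [InnerProductSpace ℝ 𝔤] (G : ExpLieGroup 𝔤)
  {m : ℕ} {X : Fin m → 𝔤} {Ω s : Set 𝔤} {u : 𝔤 → ℝ}

/-- The derivative of `f` within `s` along a left-invariant vector field. -/
def lieDerivWithin (s : Set 𝔤) (ξ : 𝔤) (f : 𝔤 → ℝ) (p : 𝔤) : ℝ :=
  fderivWithin ℝ f s p (G.leftField ξ p)

/-- The flux `hFlux`, with derivatives within `s`. -/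
def hFluxWithin (s : Set 𝔤) (X : Fin m → 𝔤) (u : 𝔤 → ℝ) (j : Fin m) (p : 𝔤) : ℝ :=
  ∑ i, (G.lieDerivWithin s (X j) u p * G.lieDerivWithin s (X i) (G.lieDerivWithin s (X i) u) p
    - G.lieDerivWithin s (X i) u p
      * (2 * G.lieDerivWithin s (X i) (G.lieDerivWithin s (X j) u) p
        - G.lieDerivWithin s (X j) (G.lieDerivWithin s (X i) u) p))

theorem contDiffOn_lieDerivWithin (hs : UniqueDiffOn ℝ s) {n k : ℕ∞ω} (hn : n ≤ ∞)
    (hu : ContDiffOn ℝ k u s) (hk : n + 1 ≤ k) (ξ : 𝔤) :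
    ContDiffOn ℝ n (G.lieDerivWithin s ξ u) s :=
  (hu.fderivWithin hs hk).clm_apply ((G.contDiff_leftField ξ).of_le hn).contDiffOn

theorem lieDerivWithin_closure_eqOn (hΩ : IsOpen Ω) {f g : 𝔤 → ℝ}
    (hfg : EqOn f g Ω) (hg : DifferentiableOn ℝ g Ω) (ξ : 𝔤) :
    EqOn (G.lieDerivWithin (closure Ω) ξ f) (G.lieDeriv ξ g) Ω := by
  intro p hp
  have hn : closure Ω ∈ 𝓝 p := Filter.mem_of_superset (hΩ.mem_nhds hp) subset_closure
  have he : f =ᶠ[𝓝 p] g := hfg.eventuallyEq_of_mem (hΩ.mem_nhds hp)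
  rw [lieDerivWithin, fderivWithin_of_mem_nhds hn, he.fderiv_eq,
    G.lieDeriv_eq_fderiv (hg.differentiableAt (hΩ.mem_nhds hp))]

theorem lieDerivWithin_lieDerivWithin_eqOn (hΩ : IsOpen Ω) (hu : ContDiffOn ℝ 2 u Ω) (ξ η : 𝔤) :
    EqOn (G.lieDerivWithin (closure Ω) ξ (G.lieDerivWithin (closure Ω) η u))
      (G.lieDeriv ξ (G.lieDeriv η u)) Ω :=
  G.lieDerivWithin_closure_eqOn hΩ
    (G.lieDerivWithin_closure_eqOn hΩ (fun _ _ => rfl) (hu.differentiableOn (by simp)) η)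
    ((G.contDiffOn_lieDeriv hΩ (n := 1) (by exact_mod_cast le_top) hu (by norm_num)
      η).differentiableOn (by simp)) ξ

theorem hFluxWithin_closure_eqOn (hΩ : IsOpen Ω) (hu : ContDiffOn ℝ 2 u Ω) (j : Fin m) :
    EqOn (G.hFluxWithin (closure Ω) X u j) (G.hFlux X u j) Ω := by
  intro p hp
  have h1 := fun i => G.lieDerivWithin_closure_eqOn hΩ (f := u) (fun _ _ => rfl)
    (hu.differentiableOn (by simp)) (X i) hp
  have h2 := fun i k => G.lieDerivWithin_lieDerivWithin_eqOn hΩ hu (X i) (X k) hp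
  simp only [hFluxWithin, hFlux, h1, h2]

theorem continuousOn_lieDerivWithin_lieDerivWithin (hs : UniqueDiffOn ℝ s)
    (hu : ContDiffOn ℝ 2 u s) (ξ η : 𝔤) :
    ContinuousOn (G.lieDerivWithin s ξ (G.lieDerivWithin s η u)) s :=
  (G.contDiffOn_lieDerivWithin hs (n := 0) (by simp) (G.contDiffOn_lieDerivWithin hs (n := 1)
    (by exact_mod_cast le_top) hu (by norm_num) η) (by norm_num) ξ).continuousOn

theorem continuousOn_lieDerivWithin (hs : UniqueDiffOn ℝ s)
    (hu : ContDiffOn ℝ 2 u s) (ξ : 𝔤) : ContinuousOn (G.lieDerivWithin s ξ u) s :=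
  (G.contDiffOn_lieDerivWithin hs (n := 1) (by exact_mod_cast le_top) hu (by norm_num)
    ξ).continuousOn

theorem continuousOn_hFluxWithin (hs : UniqueDiffOn ℝ s) (hu : ContDiffOn ℝ 2 u s) (j : Fin m) :
    ContinuousOn (G.hFluxWithin s X u j) s := by
  have h1 := fun i => G.continuousOn_lieDerivWithin hs hu (X i)
  have h2 := fun i k => G.continuousOn_lieDerivWithin_lieDerivWithin hs hu (X i) (X k)
  exact continuousOn_finsetSum _ fun i _ => ((h1 j).mul (h2 i i)).sub
    ((h1 i).mul ((continuousOn_const.mul (h2 i j)).sub (h2 j i)))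

/-- The differential of a function that vanishes on the boundary is a multiple of the normal. -/
theorem exists_lieDerivWithin_eq_mul_inner [FiniteDimensional ℝ 𝔤] (hΩ : IsC2Open Ω) {p : 𝔤}
    (hp : p ∈ frontier Ω) (hu : DifferentiableWithinAt ℝ u (closure Ω) p)
    (h0 : ∀ p ∈ frontier Ω, u p = 0) :
    ∃ c : ℝ, ∀ η, G.lieDerivWithin (closure Ω) η u p = c * ⟪G.outerNormal Ω p, η⟫ := by
  obtain ⟨φ, hφ⟩ := hΩ.2 p hp
  set ν := G.outerNormal Ω p with hν
  have hν1 : ⟪ν, ν⟫ = 1 := by rw [real_inner_self_eq_norm_sq, G.norm_outerNormal hφ]; norm_num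
  refine ⟨G.lieDerivWithin (closure Ω) ν u p, fun η => ?_⟩
  -- The vector η − ⟨ν,η⟩ν is tangent, so u has zero derivative along it.
  have ht : fderivWithin ℝ u (closure Ω) p (G.leftField (η + (-⟪ν, η⟫) • ν) p) = 0 := by
    refine fderivWithin_eq_zero_of_tangent hΩ hφ hu
      (Filter.eventually_of_mem self_mem_nhdsWithin h0) ?_
    rw [G.fderiv_leftField_eq_norm_mul hφ, ← hν, inner_add_right, inner_smul_right, hν1]
    ring
  rw [G.leftField_add, G.leftField_smul, map_add, map_smul, smul_eq_mul] at ht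
  simp only [lieDerivWithin]
  linarith

end ExpLieGroup

namespace CarnotGroup

variable {𝔤 : Type*} [NormedAddCommGroup 𝔤] [InnerProductSpace ℝ 𝔤] [FiniteDimensional ℝ 𝔤]
  (G : CarnotGroup 𝔤) {m : ℕ} {X : Fin m → 𝔤} {Ω : Set 𝔤} {u : 𝔤 → ℝ} {p : 𝔤}

/-- Differentiating `E u = 0` along a horizontal tangent field `E` expresses the Hessian of `u`
at a boundary point through the derivative of `E`. -/
theorem sum_lieDerivWithin_lieDerivWithin_eq (e : OrthonormalBasis (Fin m) ℝ (G.layer 1))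
    (hX : ∀ i, X i = (e i : 𝔤)) (hΩ : IsC2Open Ω) (hu : ContDiffOn ℝ 2 u (closure Ω))
    (h0 : ∀ p ∈ frontier Ω, u p = 0) (hp : p ∈ frontier Ω) {E : 𝔤 → 𝔤} (hE : ContDiffAt ℝ 1 E p)
    (hEt : ∀ᶠ q in 𝓝[frontier Ω] p, E q ∈ G.layer 1 ∧ ⟪G.outerNormal Ω q, E q⟫ = 0) :
    ∑ i, ∑ j, ⟪X i, E p⟫ * ⟪E p, X j⟫
        * G.lieDerivWithin (closure Ω) (X i) (G.lieDerivWithin (closure Ω) (X j) u) p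
      = -∑ j, ⟪X j, fderiv ℝ E p (G.leftField (E p) p)⟫
        * G.lieDerivWithin (closure Ω) (X j) u p := by
  have huniq := hΩ.uniqueDiffOn_closure
  have hpc : p ∈ closure Ω := frontier_subset_closure hp
  obtain ⟨φ, hφ⟩ := hΩ.2 p hp
  obtain ⟨hEp, hEν⟩ := hEt.self_of_nhdsWithin hp
  set L : Fin m → 𝔤 → ℝ := fun j => G.lieDerivWithin (closure Ω) (X j) u with hL
  set v := G.leftField (E p) p with hv
  set f : 𝔤 → ℝ := fun q => ∑ j, ⟪X j, E q⟫ * L j q with hf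
  have hLd : ∀ j, HasFDerivWithinAt (L j) (fderivWithin ℝ (L j) (closure Ω) p) (closure Ω) p :=
    fun j => ((G.contDiffOn_lieDerivWithin huniq (n := 1) (by exact_mod_cast le_top) hu
      (by norm_num) (X j)).differentiableOn (by simp) p hpc).hasFDerivWithinAt
  have hEd : HasFDerivAt E (fderiv ℝ E p) p := (hE.differentiableAt (by simp)).hasFDerivAt
  have hfd : HasFDerivWithinAt f (∑ j, (⟪X j, E p⟫ • fderivWithin ℝ (L j) (closure Ω) p
      + L j p • (innerSL ℝ (X j)).comp (fderiv ℝ E p))) (closure Ω) p := by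
    refine HasFDerivWithinAt.fun_sum fun j _ => ?_
    exact (((innerSL ℝ (X j)).hasFDerivAt.comp p hEd).hasFDerivWithinAt).mul (hLd j)
  -- f is the derivative E u. It vanishes at nearby boundary points because E is tangent there and
  -- du is a multiple of the normal.
  have hf0 : ∀ᶠ q in 𝓝[frontier Ω] p, f q = 0 := by
    filter_upwards [hEt, self_mem_nhdsWithin] with q hq hqf
    obtain ⟨c, hc⟩ := G.exists_lieDerivWithin_eq_mul_inner hΩ hqf
      (hu.differentiableOn (by simp) q (frontier_subset_closure hqf)) h0
    have h1 := e.sum_inner_coe_mul_inner hq.1 (G.outerNormal Ω q)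
    rw [real_inner_comm, hq.2] at h1
    calc f q = c * ∑ j, ⟪E q, (e j : 𝔤)⟫ * ⟪(e j : 𝔤), G.outerNormal Ω q⟫ := by
          rw [hf, Finset.mul_sum]
          refine Finset.sum_congr rfl fun j _ => ?_
          rw [← hX, hL]
          simp only
          rw [hc, real_inner_comm (E q), real_inner_comm (X j) (G.outerNormal Ω q)]
          ring
      _ = 0 := by rw [h1, MulZeroClass.mul_zero]
  -- E is itself tangent at p, so E(E u) = 0. The product rule splits this into the Hessian term and
  -- the term in which E is differentiated.
  have ht := fderivWithin_eq_zero_of_tangent hΩ hφ hfd.differentiableWithinAt hf0 (v := v) (by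
    rw [hv, G.fderiv_leftField_eq_norm_mul hφ, hEν, MulZeroClass.mul_zero])
  rw [hfd.fderivWithin (huniq p hpc)] at ht
  have hvs : v = ∑ i, ⟪X i, E p⟫ • G.leftField (X i) p := by
    have h1 : E p = ∑ i, ⟪X i, E p⟫ • X i := by
      have := congrArg Subtype.val (e.sum_repr' ⟨E p, hEp⟩)
      simp only [hX]
      simpa using this.symm
    have h2 := congrArg (fderiv ℝ (G.mul p) 0) h1
    rw [map_sum] at h2
    simp only [map_smul] at h2
    exact h2
  have hLv : ∀ j, fderivWithin ℝ (L j) (closure Ω) p v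
      = ∑ i, ⟪X i, E p⟫ * G.lieDerivWithin (closure Ω) (X i) (L j) p := fun j => by
    rw [hvs, map_sum]
    simp only [map_smul, smul_eq_mul]
    rfl
  simp only [_root_.sum_apply, _root_.add_apply, _root_.smul_apply,
    ContinuousLinearMap.comp_apply, innerSL_apply_apply, smul_eq_mul, hLv,
    Finset.sum_add_distrib] at ht
  rw [Finset.sum_comm, eq_neg_iff_add_eq_zero, ← ht]
  congr 1
  · refine Finset.sum_congr rfl fun j _ => ?_
    rw [Finset.mul_sum]
    refine Finset.sum_congr rfl fun i _ => ?_
    rw [real_inner_comm (X j) (E p)]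
    ring
  · exact Finset.sum_congr rfl fun j _ => mul_comm _ _

/-- At the boundary, the normal component of the flux is the mean curvature integrand. -/
theorem sum_hFluxWithin_mul_inner (e : OrthonormalBasis (Fin m) ℝ (G.layer 1))
    (hX : ∀ i, X i = (e i : 𝔤)) (hΩ : IsC2Open Ω) (hu : ContDiffOn ℝ 2 u (closure Ω))
    (h0 : ∀ p ∈ frontier Ω, u p = 0) (hp : p ∈ frontier Ω) :
    ∑ j, G.hFluxWithin (closure Ω) X u j p * ⟪G.outerNormal Ω p, X j⟫
      = G.angle Ω p * (G.hMeanCurvature Ω p * G.hGradSq X Ω u p) := by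
  obtain ⟨c, hc⟩ := G.exists_lieDerivWithin_eq_mul_inner hΩ hp
    (hu.differentiableOn (by simp) p (frontier_subset_closure hp)) h0
  have hXm : ∀ i, X i ∈ G.layer 1 := fun i => by rw [hX]; exact (e i).2
  set N := G.hNormal Ω p with hN
  set W := G.angle Ω p with hW
  set A : Fin m → Fin m → ℝ := fun i j =>
    G.lieDerivWithin (closure Ω) (X i) (G.lieDerivWithin (closure Ω) (X j) u) p with hA
  have hcN : ∀ i, G.lieDerivWithin (closure Ω) (X i) u p = c * ⟪N, X i⟫ := fun i => by
    rw [hc, hN, G.inner_hNormal (hXm i)]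
  have hNsq : ∑ j, ⟪N, X j⟫ ^ 2 = W ^ 2 := by
    have := e.sum_inner_coe_mul_inner (G.hNormal_mem (Ω := Ω) (p := p)) N
    rw [← hN, real_inner_self_eq_norm_sq] at this
    rw [hW, angle, ← hN, ← this]
    refine Finset.sum_congr rfl fun j _ => ?_
    rw [← hX, real_inner_comm N (X j), sq]
  have hgrad : G.hGradSq X Ω u p = c ^ 2 * W ^ 2 := by
    rw [← hNsq, Finset.mul_sum]
    refine Finset.sum_congr rfl fun i _ => ?_
    change (G.lieDerivWithin (closure Ω) (X i) u p) ^ 2 = _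
    rw [hcN, mul_pow]
  -- With X_i u = c N_i the contraction against N_iN_j does not see the order of the two
  -- derivatives, so the weights 2 and −1 combine to a single A(N,N).
  have hflux : ∑ j, G.hFluxWithin (closure Ω) X u j p * ⟪G.outerNormal Ω p, X j⟫
      = c * (W ^ 2 * ∑ i, A i i - ∑ i, ∑ j, ⟪N, X i⟫ * ⟪N, X j⟫ * A i j) := by
    have hsym : ∑ i, ∑ j, ⟪N, X i⟫ * ⟪N, X j⟫ * A j i = ∑ i, ∑ j, ⟪N, X i⟫ * ⟪N, X j⟫ * A i j := by
      rw [Finset.sum_comm]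
      refine Finset.sum_congr rfl fun i _ => Finset.sum_congr rfl fun j _ => ?_
      ring
    have h1 : ∑ j, G.hFluxWithin (closure Ω) X u j p * ⟪G.outerNormal Ω p, X j⟫
        = ∑ j, ∑ i, (c * (⟪N, X j⟫ ^ 2 * A i i) - (2 * (c * (⟪N, X j⟫ * ⟪N, X i⟫ * A i j))
          - c * (⟪N, X j⟫ * ⟪N, X i⟫ * A j i))) := by
      refine Finset.sum_congr rfl fun j _ => ?_
      rw [← G.inner_hNormal (hXm j), ← hN, ExpLieGroup.hFluxWithin, Finset.sum_mul]
      refine Finset.sum_congr rfl fun i _ => ?_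
      rw [hcN, hcN]
      simp only [hA]
      ring
    rw [h1]
    simp only [Finset.sum_sub_distrib, ← Finset.mul_sum]
    rw [hsym, ← hNsq, Finset.sum_mul]
    ring
  rw [hflux, hgrad]
  -- At a characteristic point both sides are zero, whatever value the curvature takes there.
  by_cases hW0 : W = 0
  · have hN0 : N = 0 := norm_eq_zero.1 hW0
    simp [hW0, hN0]
  · obtain ⟨E, hEc, hEf, hH⟩ := G.isHMeanCurvature_hMeanCurvature hΩ hp hW0
    obtain ⟨hEo, hEt⟩ := hEf.self_of_nhdsWithin hp
    set n := G.hGauss Ω p with hn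
    have hnN : n = W⁻¹ • N := rfl
    have hnm : n ∈ G.layer 1 := Submodule.smul_mem _ _ G.hNormal_mem
    have hn1 : ‖n‖ = 1 := by
      have hWp : 0 ≤ W := norm_nonneg _
      rw [hnN, norm_smul, norm_inv, Real.norm_of_nonneg hWp]
      exact inv_mul_cancel₀ hW0
    have hNE : ∀ k, ⟪N, E k p⟫ = 0 := fun k => by
      rw [hN, G.inner_hNormal (hEt k).1, (hEt k).2]
    have hnE : ∀ k, ⟪n, E k p⟫ = 0 := fun k => by
      rw [hnN, inner_smul_left, hNE, MulZeroClass.mul_zero]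
    have hk := fun k => G.sum_lieDerivWithin_lieDerivWithin_eq e hX hΩ hu h0 hp (hEc k)
      (hEf.mono fun q hq => hq.2 k)
    have hk' : ∀ k, ∑ i, ∑ j, ⟪X i, E k p⟫ * ⟪E k p, X j⟫ * A i j
        = -(c * (W * ⟪G.hConnection p (E k p) (E k), n⟫)) := by
      intro k
      rw [hk k]
      congr 1
      have h1 : ⟪G.hConnection p (E k p) (E k), n⟫
          = W⁻¹ * ⟪N, fderiv ℝ (E k) p (G.leftField (E k p) p)⟫ := by
        rw [hConnection, Submodule.inner_starProjection_left_eq_right,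
          Submodule.starProjection_eq_self_iff.2 hnm, ExpLieGroup.leviCivita,
          G.koszul_self (hEt k).1, add_zero, hnN, inner_smul_right, real_inner_comm]
      rw [h1, mul_inv_cancel_left₀ hW0, ← e.sum_inner_coe_mul_inner
        (G.hNormal_mem (Ω := Ω) (p := p)), Finset.mul_sum]
      refine Finset.sum_congr rfl fun j _ => ?_
      rw [hcN, ← hX]
      ring
    -- The E_k and the unit vector n = N/W form an orthonormal basis of V_1, so the trace over the
    -- E_k is the full trace minus A(n,n).
    have htr : ∑ k, ∑ i, ∑ j, ⟪X i, E k p⟫ * ⟪E k p, X j⟫ * A i j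
        = ∑ i, A i i - W⁻¹ ^ 2 * ∑ i, ∑ j, ⟪N, X i⟫ * ⟪N, X j⟫ * A i j := by
      rw [Finset.sum_comm, Finset.mul_sum, ← Finset.sum_sub_distrib]
      refine Finset.sum_congr rfl fun i _ => ?_
      rw [Finset.sum_comm]
      have h1 : ∀ j, ∑ k, ⟪X i, E k p⟫ * ⟪E k p, X j⟫ * A i j
          = (if i = j then A i j else 0) - W⁻¹ ^ 2 * (⟪N, X i⟫ * ⟪N, X j⟫ * A i j) := by
        intro j
        have h2 := hEo.sum_inner_mul_inner_add hnm hn1 (fun k => (hEt k).1) hnE (hXm i) (y := X j)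
        have h3 : ⟪X i, X j⟫ = if i = j then 1 else 0 := by
          rw [hX, hX]
          exact orthonormal_iff_ite.1 e.orthonormal i j
        rw [h3, hnN, inner_smul_left, inner_smul_right, real_inner_comm N (X i)] at h2
        rw [← Finset.sum_mul, eq_sub_of_add_eq h2]
        simp only [conj_trivial]
        split_ifs <;> ring
      simp only [h1, Finset.sum_sub_distrib, ← Finset.mul_sum]
      simp
    simp only [hk', Finset.sum_neg_distrib, ← Finset.mul_sum] at htr
    rw [hH]
    set S := ∑ k, ⟪G.hConnection p (E k p) (E k), n⟫ with hS
    have h4 : W ^ 2 * ∑ i, A i i - ∑ i, ∑ j, ⟪N, X i⟫ * ⟪N, X j⟫ * A i j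
        = W ^ 2 * (-(c * (W * S))) := by
      rw [htr]
      field_simp
    rw [h4]
    ring

end CarnotGroup

/-! ### Continuous extension and integrability of the integrands -/

/-- `f` extends continuously from `s` to its closure. -/
def ExtendsToClosure {E : Type*} [TopologicalSpace E] (s : Set E) (f : E → ℝ) : Prop :=
  ∃ v : E → ℝ, ContinuousOn v (closure s) ∧ EqOn v f s

namespace ExtendsToClosure

variable {E : Type*} [TopologicalSpace E] {s : Set E} {f g : E → ℝ}

theorem const (c : ℝ) : ExtendsToClosure s fun _ => c := ⟨_, continuousOn_const, fun _ _ => rfl⟩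

theorem add (hf : ExtendsToClosure s f) (hg : ExtendsToClosure s g) :
    ExtendsToClosure s fun x => f x + g x := by
  obtain ⟨v, hv, hvf⟩ := hf
  obtain ⟨w, hw, hwg⟩ := hg
  exact ⟨_, hv.add hw, fun x hx => congrArg₂ (· + ·) (hvf hx) (hwg hx)⟩

theorem sub (hf : ExtendsToClosure s f) (hg : ExtendsToClosure s g) :
    ExtendsToClosure s fun x => f x - g x := by
  obtain ⟨v, hv, hvf⟩ := hf
  obtain ⟨w, hw, hwg⟩ := hg
  exact ⟨_, hv.sub hw, fun x hx => congrArg₂ (· - ·) (hvf hx) (hwg hx)⟩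

theorem mul (hf : ExtendsToClosure s f) (hg : ExtendsToClosure s g) :
    ExtendsToClosure s fun x => f x * g x := by
  obtain ⟨v, hv, hvf⟩ := hf
  obtain ⟨w, hw, hwg⟩ := hg
  exact ⟨_, hv.mul hw, fun x hx => congrArg₂ (· * ·) (hvf hx) (hwg hx)⟩

theorem pow (hf : ExtendsToClosure s f) (n : ℕ) : ExtendsToClosure s fun x => f x ^ n := by
  obtain ⟨v, hv, hvf⟩ := hf
  exact ⟨_, hv.pow n, fun x hx => congrArg (· ^ n) (hvf hx)⟩

theorem sum {ι : Type*} [Fintype ι] {f : ι → E → ℝ} (hf : ∀ i, ExtendsToClosure s (f i)) :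
    ExtendsToClosure s fun x => ∑ i, f i x := by
  choose v hv hvf using hf
  exact ⟨_, continuousOn_finsetSum _ fun i _ => hv i,
    fun x hx => Finset.sum_congr rfl fun i _ => hvf i hx⟩

theorem congr (hf : ExtendsToClosure s f) (h : EqOn f g s) : ExtendsToClosure s g := by
  obtain ⟨v, hv, hvf⟩ := hf
  exact ⟨v, hv, hvf.trans h⟩

theorem continuousOn (hf : ExtendsToClosure s f) : ContinuousOn f s := by
  obtain ⟨v, hv, hvf⟩ := hf
  exact (hv.mono subset_closure).congr hvf.symm

theorem integrableOn {E : Type*} [MetricSpace E] [ProperSpace E] [MeasurableSpace E]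
    [BorelSpace E] {μ : Measure E} [IsFiniteMeasureOnCompacts μ] {s : Set E} {f : E → ℝ}
    (hf : ExtendsToClosure s f) (hs : MeasurableSet s) (hb : Bornology.IsBounded s) :
    IntegrableOn f s μ := by
  obtain ⟨v, hv, hvf⟩ := hf
  exact (((hv.integrableOn_compact hb.isCompact_closure).mono_set subset_closure).congr_fun hvf hs)

end ExtendsToClosure

namespace ExpLieGroup

variable {𝔤 : Type*} [NormedAddCommGroup 𝔤] [InnerProductSpace ℝ 𝔤] (G : ExpLieGroup 𝔤)
  {m : ℕ} {X : Fin m → 𝔤} {Ω : Set 𝔤} {u : 𝔤 → ℝ}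

theorem extendsToClosure_lieDeriv (hΩ : IsC2Open Ω) (hu : ContDiffOn ℝ 2 u (closure Ω)) (ξ : 𝔤) :
    ExtendsToClosure Ω (G.lieDeriv ξ u) :=
  ⟨_, G.continuousOn_lieDerivWithin hΩ.uniqueDiffOn_closure hu ξ,
    G.lieDerivWithin_closure_eqOn hΩ.1 (fun _ _ => rfl)
      ((hu.mono subset_closure).differentiableOn (by simp)) ξ⟩

theorem extendsToClosure_lieDeriv_lieDeriv (hΩ : IsC2Open Ω) (hu : ContDiffOn ℝ 2 u (closure Ω))
    (ξ η : 𝔤) : ExtendsToClosure Ω (G.lieDeriv ξ (G.lieDeriv η u)) :=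
  ⟨_, G.continuousOn_lieDerivWithin_lieDerivWithin hΩ.uniqueDiffOn_closure hu ξ η,
    G.lieDerivWithin_lieDerivWithin_eqOn hΩ.1 (hu.mono subset_closure) ξ η⟩

theorem extendsToClosure_hLaplacian (hΩ : IsC2Open Ω) (hu : ContDiffOn ℝ 2 u (closure Ω)) :
    ExtendsToClosure Ω (G.hLaplacian X u) :=
  .sum fun _ => G.extendsToClosure_lieDeriv_lieDeriv hΩ hu _ _

theorem extendsToClosure_hHessianNormSq (hΩ : IsC2Open Ω) (hu : ContDiffOn ℝ 2 u (closure Ω)) :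
    ExtendsToClosure Ω (G.hHessianNormSq X u) := by
  refine .sum fun i => .sum fun j => .pow ?_ 2
  simp only [hHessian, Matrix.of_apply, div_eq_mul_inv]
  exact .mul (.add (G.extendsToClosure_lieDeriv_lieDeriv hΩ hu _ _)
    (G.extendsToClosure_lieDeriv_lieDeriv hΩ hu _ _)) (.const _)

variable [FiniteDimensional ℝ 𝔤]

theorem extendsToClosure_comm₂ (hΩ : IsC2Open Ω) (hu : ContDiffOn ℝ 2 u (closure Ω)) (ξ η : 𝔤) :
    ExtendsToClosure Ω (G.comm₂ ξ η u) :=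
  (ExtendsToClosure.sub (G.extendsToClosure_lieDeriv_lieDeriv hΩ hu ξ η)
    (G.extendsToClosure_lieDeriv_lieDeriv hΩ hu η ξ)).congr
      fun _ hp => (G.comm₂_eq hΩ.1 (hu.mono subset_closure) ξ η hp).symm

theorem extendsToClosure_comm₃ (hΩ : IsC2Open Ω) (hu : ContDiffOn ℝ 2 u (closure Ω))
    (ξ η ζ : 𝔤) : ExtendsToClosure Ω (G.comm₃ ξ η ζ u) :=
  (G.extendsToClosure_lieDeriv hΩ hu (G.bracket (G.bracket ξ η) ζ)).congr fun p hp => by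
    rw [G.comm₃_eq_fderiv]
    exact G.lieDeriv_eqOn hΩ.1 ((hu.mono subset_closure).differentiableOn (by simp)) _ hp

end ExpLieGroup

namespace ExpLieGroup

variable {𝔤 : Type*} [NormedAddCommGroup 𝔤] [InnerProductSpace ℝ 𝔤] (G : ExpLieGroup 𝔤)
  {m : ℕ} {X : Fin m → 𝔤} {Ω : Set 𝔤} {u : 𝔤 → ℝ}

theorem FollandStein.differentiableAt_lieDeriv_lieDeriv (h : G.FollandStein X 3 Ω u) (k i j : Fin m)
    {p : 𝔤} (hp : p ∈ Ω) : DifferentiableAt ℝ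
      (fun t : ℝ => G.lieDeriv (X i) (G.lieDeriv (X j) u) (G.mul p (t • X k))) 0 :=
  h.2.1 k [i, j] (by simp) p hp

theorem FollandStein.extendsToClosure (h : G.FollandStein X 3 Ω u) (k i j : Fin m) :
    ExtendsToClosure Ω (G.lieDeriv (X k) (G.lieDeriv (X i) (G.lieDeriv (X j) u))) :=
  h.2.2 [k, i, j] (by simp)

/-- The product rule writes X_jF_j as a polynomial in horizontal derivatives of u of order one to
three. Orders one and two extend because u is C² up to the boundary, order three by the
Folland–Stein condition. -/
theorem FollandStein.extendsToClosure_lieDeriv_hFlux (h : G.FollandStein X 3 Ω u)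
    (hΩ : IsC2Open Ω) (hu : ContDiffOn ℝ 2 u (closure Ω)) (j : Fin m) :
    ExtendsToClosure Ω (G.lieDeriv (X j) (G.hFlux X u j)) := by
  have h1 := fun i => G.extendsToClosure_lieDeriv hΩ hu (X i)
  have h2 := fun i k => G.extendsToClosure_lieDeriv_lieDeriv hΩ hu (X i) (X k)
  have h3 := fun i k l => h.extendsToClosure G i k l
  refine ExtendsToClosure.congr ?_ fun p hp => ((G.hasDerivAt_hFlux hΩ.1 (hu.mono subset_closure)
    (fun k i j p hp => h.differentiableAt_lieDeriv_lieDeriv G k i j hp) j hp).deriv).symm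
  exact .sum fun i => .sub (.add (.mul (h2 _ _) (h2 _ _)) (.mul (h1 _) (h3 _ _ _)))
    (.add (.mul (h2 _ _) (.sub (.mul (.const 2) (h2 _ _)) (h2 _ _)))
      (.mul (h1 _) (.sub (.mul (.const 2) (h3 _ _ _)) (h3 _ _ _))))

theorem contDiff_wordDeriv (hu : ContDiff ℝ ∞ u) (w : List (Fin m)) :
    ContDiff ℝ ∞ (G.wordDeriv X w u) := by
  induction w with
  | nil => exact hu
  | cons i w ih =>
    exact contDiffOn_univ.1 (G.contDiffOn_lieDeriv isOpen_univ le_rfl ih.contDiffOn le_rfl (X i))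

theorem follandStein_of_contDiff (hu : ContDiff ℝ ∞ u) (k : ℕ) : G.FollandStein X k Ω u :=
  ⟨hu.continuous.continuousOn,
    fun i w _ _ _ => G.differentiableAt_mul_smul isOpen_univ
      ((G.contDiff_wordDeriv hu w).differentiable (by simp)).differentiableOn (X i) (mem_univ _),
    fun w _ => ⟨_, (G.contDiff_wordDeriv hu w).continuous.continuousOn, fun _ _ => rfl⟩⟩

end ExpLieGroup

/-! ### The integrated identity and its consequences -/

namespace CarnotGroup

variable {𝔤 : Type*} [NormedAddCommGroup 𝔤] [InnerProductSpace ℝ 𝔤] [FiniteDimensional ℝ 𝔤]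
  (G : CarnotGroup 𝔤) {m : ℕ} {X : Fin m → 𝔤} {Ω : Set 𝔤} {u : 𝔤 → ℝ}

theorem comm₃_eq_zero_of_step_eq_two (h : G.step = 2) {ξ η ζ : 𝔤} (hξ : ξ ∈ G.layer 1)
    (hη : η ∈ G.layer 1) (hζ : ζ ∈ G.layer 1) (u : 𝔤 → ℝ) (p : 𝔤) : G.comm₃ ξ η ζ u p = 0 := by
  have h3 := G.bracket_mem_layer (G.bracket_mem_layer hξ hη) hζ
  rw [G.layer_of_step_lt _ (by omega), Submodule.mem_bot] at h3
  rw [G.comm₃_eq_fderiv, h3, G.leftField_zero_left, map_zero]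

theorem continuousOn_angle (hΩ : IsC2Open Ω) : ContinuousOn (G.angle Ω) (frontier Ω) :=
  ((G.layer 1).starProjection.continuous.comp_continuousOn (G.continuousOn_outerNormal hΩ)).norm

variable [MeasurableSpace 𝔤] [BorelSpace 𝔤]

theorem restrict_perimeterMeasure_frontier :
    (G.perimeterMeasure Ω).restrict (frontier Ω) = ((G.surfaceMeasure Ω).restrict
      (frontier Ω)).withDensity fun p => ENNReal.ofReal (G.angle Ω p) :=
  restrict_withDensity isClosed_frontier.measurableSet _

theorem integrableOn_perimeterMeasure_iff (hΩ : IsC2Open Ω) {f : 𝔤 → ℝ} :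
    IntegrableOn f (frontier Ω) (G.perimeterMeasure Ω)
      ↔ IntegrableOn (fun p => G.angle Ω p * f p) (frontier Ω) (G.surfaceMeasure Ω) := by
  rw [IntegrableOn, G.restrict_perimeterMeasure_frontier,
    integrable_withDensity_iff_integrable_smul₀'
      ((G.continuousOn_angle hΩ).aemeasurable isClosed_frontier.measurableSet).ennreal_ofReal
      (Filter.Eventually.of_forall fun _ => ENNReal.ofReal_lt_top)]
  simp only [ENNReal.toReal_ofReal (show 0 ≤ G.angle Ω _ from norm_nonneg _), smul_eq_mul]
  rfl

theorem setIntegral_perimeterMeasure (hΩ : IsC2Open Ω) (f : 𝔤 → ℝ) :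
    ∫ p in frontier Ω, f p ∂(G.perimeterMeasure Ω)
      = ∫ p in frontier Ω, G.angle Ω p * f p ∂(G.surfaceMeasure Ω) := by
  rw [G.restrict_perimeterMeasure_frontier, integral_withDensity_eq_integral_toReal_smul₀
      ((G.continuousOn_angle hΩ).aemeasurable isClosed_frontier.measurableSet).ennreal_ofReal
      (Filter.Eventually.of_forall fun _ => ENNReal.ofReal_lt_top)]
  simp only [ENNReal.toReal_ofReal (show 0 ≤ G.angle Ω _ from norm_nonneg _), smul_eq_mul]

/-- The integrated horizontal Bochner identity for functions vanishing on the boundary. -/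
theorem horizontal_bochner (e : OrthonormalBasis (Fin m) ℝ (G.layer 1))
    (hX : ∀ i, X i = (e i : 𝔤)) (hΩ : IsC2Open Ω) (hb : Bornology.IsBounded Ω)
    (hfs : G.FollandStein X 3 Ω u) (hu : ContDiffOn ℝ 2 u (closure Ω))
    (h0 : ∀ p ∈ frontier Ω, u p = 0) :
    IntegrableOn (fun p => G.hMeanCurvature Ω p * G.hGradSq X Ω u p) (frontier Ω)
        (G.perimeterMeasure Ω) ∧
      (∫ p in Ω, (G.hLaplacian X u p ^ 2 - G.hHessianNormSq X u p))
        + 3 / 4 * (∑ i, ∑ j, (∫ p in Ω, G.comm₂ (X i) (X j) u p ^ 2))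
        + (∑ i, ∑ j, (∫ p in Ω, G.lieDeriv (X i) u p * G.comm₃ (X i) (X j) (X j) u p))
        = ∫ p in frontier Ω, G.hMeanCurvature Ω p * G.hGradSq X Ω u p
            ∂(G.perimeterMeasure Ω) := by
  have hfin := G.isFiniteMeasure_surfaceMeasure hΩ hb
  have hcl : IsCompact (closure Ω) := hb.isCompact_closure
  have hfr : IsCompact (frontier Ω) := hcl.of_isClosed_subset isClosed_frontier
    frontier_subset_closure
  have hm := hΩ.1.measurableSet
  have huΩ : ContDiffOn ℝ 2 u Ω := hu.mono subset_closure
  have hFc := fun j => G.continuousOn_hFluxWithin (X := X) hΩ.uniqueDiffOn_closure hu j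
  have hFe := fun j => G.hFluxWithin_closure_eqOn (X := X) hΩ.1 huΩ j
  have hd := fun k i j p (hp : p ∈ Ω) => hfs.differentiableAt_lieDeriv_lieDeriv _ k i j hp
  -- Two versions of the flux are used: the interior one has a computable divergence, the one with
  -- derivatives within the closure has boundary values. They agree on the open set Ω, hence so do
  -- their derivatives there.
  have hev : ∀ j, ∀ p ∈ Ω, G.hFlux X u j =ᶠ[𝓝 p] G.hFluxWithin (closure Ω) X u j :=
    fun j p hp => (hFe j).symm.eventuallyEq_of_mem (hΩ.1.mem_nhds hp)
  have hLe : ∀ j, EqOn (G.lieDeriv (X j) (G.hFlux X u j))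
      (G.lieDeriv (X j) (G.hFluxWithin (closure Ω) X u j)) Ω :=
    fun j p hp => G.lieDeriv_congr (hev j p hp) (X j)
  have hLx := fun j => (hfs.extendsToClosure_lieDeriv_hFlux _ hΩ hu j).congr (hLe j)
  have hdiv := fun j => G.setIntegral_lieDeriv hΩ hb (hFc j)
    (fun p hp => G.differentiableAt_mul_smul_congr (hev j p hp)
      (G.hasDerivAt_hFlux hΩ.1 huΩ hd j hp).differentiableAt)
    (hLx j).continuousOn ((hLx j).integrableOn hm hb)
  have hbi : ∀ j, IntegrableOn (fun p => G.hFluxWithin (closure Ω) X u j p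
      * ⟪G.outerNormal Ω p, X j⟫) (frontier Ω) (G.surfaceMeasure Ω) := fun j =>
    (((hFc j).mono frontier_subset_closure).mul
      ((G.continuousOn_outerNormal hΩ).inner continuousOn_const)).integrableOn_compact hfr
  have hbd : EqOn (fun p => ∑ j, G.hFluxWithin (closure Ω) X u j p * ⟪G.outerNormal Ω p, X j⟫)
      (fun p => G.angle Ω p * (G.hMeanCurvature Ω p * G.hGradSq X Ω u p)) (frontier Ω) :=
    fun p hp => G.sum_hFluxWithin_mul_inner e hX hΩ hu h0 hp
  have hi₁ : IntegrableOn (fun p => G.hLaplacian X u p ^ 2 - G.hHessianNormSq X u p) Ω :=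
    (ExtendsToClosure.sub ((G.extendsToClosure_hLaplacian hΩ hu).pow 2)
      (G.extendsToClosure_hHessianNormSq hΩ hu)).integrableOn hm hb
  have hi₂ : ∀ i j, IntegrableOn (fun p => G.comm₂ (X i) (X j) u p ^ 2) Ω := fun i j =>
    ((G.extendsToClosure_comm₂ hΩ hu _ _).pow 2).integrableOn hm hb
  have hi₃ : ∀ i j, IntegrableOn
      (fun p => G.lieDeriv (X i) u p * G.comm₃ (X i) (X j) (X j) u p) Ω := fun i j =>
    ((G.extendsToClosure_lieDeriv hΩ hu _).mul
      (G.extendsToClosure_comm₃ hΩ hu _ _ _)).integrableOn hm hb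
  refine ⟨?_, ?_⟩
  · rw [G.integrableOn_perimeterMeasure_iff hΩ]
    exact IntegrableOn.congr_fun (integrable_finsetSum _ fun j _ => hbi j) hbd
      isClosed_frontier.measurableSet
  · rw [G.setIntegral_perimeterMeasure hΩ, ← setIntegral_congr_fun
      isClosed_frontier.measurableSet hbd, integral_finsetSum _ fun j _ => hbi j]
    simp only [← hdiv]
    rw [← integral_finsetSum _ fun j _ => (hLx j).integrableOn hm hb]
    have hpt : EqOn (fun p => ∑ j, G.lieDeriv (X j) (G.hFluxWithin (closure Ω) X u j) p)
        (fun p => (G.hLaplacian X u p ^ 2 - G.hHessianNormSq X u p)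
          + 3 / 4 * (∑ i, ∑ j, G.comm₂ (X i) (X j) u p ^ 2)
          + ∑ i, ∑ j, G.lieDeriv (X i) u p * G.comm₃ (X i) (X j) (X j) u p) Ω := fun p hp => by
      simp only [← hLe _ hp]
      exact G.sum_lieDeriv_hFlux hΩ.1 huΩ hd
        (fun k i j => (hfs.extendsToClosure _ k i j).continuousOn) hp
    rw [setIntegral_congr_fun hm hpt]
    have hs₂ : IntegrableOn (fun p => 3 / 4 * (∑ i, ∑ j, G.comm₂ (X i) (X j) u p ^ 2)) Ω :=
      Integrable.const_mul (integrable_finsetSum _ fun i _ => integrable_finsetSum _ fun j _ =>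
        hi₂ i j) _
    have hs₃ : IntegrableOn (fun p => ∑ i, ∑ j,
        G.lieDeriv (X i) u p * G.comm₃ (X i) (X j) (X j) u p) Ω :=
      integrable_finsetSum _ fun i _ => integrable_finsetSum _ fun j _ => hi₃ i j
    have hs₁₂ : IntegrableOn (fun p => (G.hLaplacian X u p ^ 2 - G.hHessianNormSq X u p)
        + 3 / 4 * (∑ i, ∑ j, G.comm₂ (X i) (X j) u p ^ 2)) Ω := hi₁.add hs₂
    rw [integral_add hs₁₂ hs₃, integral_add hi₁ hs₂, integral_const_mul,
      integral_finsetSum _ fun i _ => integrable_finsetSum _ fun j _ => hi₂ i j,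
      integral_finsetSum _ fun i _ => integrable_finsetSum _ fun j _ => hi₃ i j]
    congr 2
    · congr 1
      exact Finset.sum_congr rfl fun i _ => (integral_finsetSum _ fun j _ => hi₂ i j).symm
    · ext i
      exact (integral_finsetSum _ fun j _ => hi₃ i j).symm

end CarnotGroup

end

theorem theoremT {𝔤 : Type*} [NormedAddCommGroup 𝔤] [InnerProductSpace ℝ 𝔤]
    [FiniteDimensional ℝ 𝔤] [MeasurableSpace 𝔤] [BorelSpace 𝔤]
    (G : CarnotGroup 𝔤) {m : ℕ} (e : OrthonormalBasis (Fin m) ℝ (G.layer 1))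
    (X : Fin m → 𝔤) (hX : ∀ i, X i = (e i : 𝔤))
    (Ω : Set 𝔤) (hΩ : IsC2Open Ω) (hb : Bornology.IsBounded Ω) :
    (∀ u : 𝔤 → ℝ, G.FollandStein X 3 Ω u → ContDiffOn ℝ 2 u (closure Ω) →
      (∀ p ∈ Ω, u p ≤ 0) → (∀ p ∈ frontier Ω, u p = 0) →
      IntegrableOn (fun p => G.hLaplacian X u p ^ 2 - G.hHessianNormSq X u p) Ω ∧
      (∀ i j, IntegrableOn (fun p => G.comm₂ (X i) (X j) u p ^ 2) Ω) ∧
      (∀ i j, IntegrableOn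
        (fun p => G.lieDeriv (X i) u p * G.comm₃ (X i) (X j) (X j) u p) Ω) ∧
      IntegrableOn (fun p => G.hMeanCurvature Ω p * G.hGradSq X Ω u p) (frontier Ω)
        (G.perimeterMeasure Ω) ∧
      (∫ p in Ω, (G.hLaplacian X u p ^ 2 - G.hHessianNormSq X u p))
        + 3 / 4 * (∑ i, ∑ j, (∫ p in Ω, G.comm₂ (X i) (X j) u p ^ 2))
        + (∑ i, ∑ j, (∫ p in Ω, G.lieDeriv (X i) u p * G.comm₃ (X i) (X j) (X j) u p))
        = ∫ p in frontier Ω, G.hMeanCurvature Ω p * G.hGradSq X Ω u p ∂(G.perimeterMeasure Ω) ∧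
      (G.step = 2 →
        ∀ i j, (∫ p in Ω, G.lieDeriv (X i) u p * G.comm₃ (X i) (X j) (X j) u p) = 0)) ∧
    (∀ u : 𝔤 → ℝ, ContDiff ℝ ∞ u → HasCompactSupport u → tsupport u ⊆ Ω →
      (∫ p in Ω, G.hHessianNormSq X u p)
        = (∫ p in Ω, G.hLaplacian X u p ^ 2)
          + 3 / 4 * (∑ i, ∑ j, (∫ p in Ω, G.comm₂ (X i) (X j) u p ^ 2))
          + (∑ i, ∑ j, (∫ p in Ω, G.lieDeriv (X i) u p * G.comm₃ (X i) (X j) (X j) u p)) ∧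
      (G.step = 2 →
        ∀ i j, (∫ p in Ω, G.lieDeriv (X i) u p * G.comm₃ (X i) (X j) (X j) u p) = 0)) := by
  have hm := hΩ.1.measurableSet
  have hXm : ∀ i, X i ∈ G.layer 1 := fun i => by rw [hX]; exact (e i).2
  have hstep : G.step = 2 → ∀ (u : 𝔤 → ℝ) (i j),
      (∫ p in Ω, G.lieDeriv (X i) u p * G.comm₃ (X i) (X j) (X j) u p) = 0 := by
    intro h u i j
    simp [G.comm₃_eq_zero_of_step_eq_two h (hXm i) (hXm j) (hXm j)]
  refine ⟨fun u hfs hu _ h0 => ?_, fun u hu _ hsu => ⟨?_, fun h => hstep h u⟩⟩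
  · obtain ⟨hint, heq⟩ := G.horizontal_bochner e hX hΩ hb hfs hu h0
    refine ⟨?_, fun i j => ?_, fun i j => ?_, hint, heq, fun h => hstep h u⟩
    · exact (ExtendsToClosure.sub ((G.extendsToClosure_hLaplacian hΩ hu).pow 2)
        (G.extendsToClosure_hHessianNormSq hΩ hu)).integrableOn hm hb
    · exact ((G.extendsToClosure_comm₂ hΩ hu _ _).pow 2).integrableOn hm hb
    · exact ((G.extendsToClosure_lieDeriv hΩ hu _).mul
        (G.extendsToClosure_comm₃ hΩ hu _ _ _)).integrableOn hm hb
  · have hu2 : ContDiffOn ℝ 2 u (closure Ω) := (hu.of_le two_le_contDiff_infty).contDiffOn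
    have hev : ∀ p ∈ frontier Ω, u =ᶠ[𝓝 p] fun _ => 0 := fun p hp =>
      notMem_tsupport_iff_eventuallyEq.1 fun h => by
        rw [frontier, hΩ.1.interior_eq] at hp
        exact hp.2 (hsu h)
    obtain ⟨-, heq⟩ := G.horizontal_bochner e hX hΩ hb (G.follandStein_of_contDiff hu 3) hu2
      fun p hp => (hev p hp).self_of_nhds
    -- Near the boundary u is identically zero, so its gradient, taken within the closure, vanishes
    -- there and the boundary term disappears.
    have hz : ∫ p in frontier Ω, G.hMeanCurvature Ω p * G.hGradSq X Ω u p
        ∂(G.perimeterMeasure Ω) = 0 := by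
      refine setIntegral_eq_zero_of_forall_eq_zero fun p hp => ?_
      have h1 : fderivWithin ℝ u (closure Ω) p = 0 := by
        rw [((hev p hp).filter_mono nhdsWithin_le_nhds).fderivWithin_eq (hev p hp).self_of_nhds]
        simp
      simp [ExpLieGroup.hGradSq, h1]
    rw [hz, integral_sub (((G.extendsToClosure_hLaplacian hΩ hu2).pow 2).integrableOn hm hb)
      ((G.extendsToClosure_hHessianNormSq hΩ hu2).integrableOn hm hb)] at heq
    linarith
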